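/- Let $n\ge 2$, let $F=F_n$ be the free group of rank $n$ with Cayley tree $T$, and let $\underline w$ be a finite list of nontrivial elements of $F$. Let $\mathcal D=\mathcal D_{\underline w}$ be the quotient of $\partial T$ obtained by identifying, for all $g\in F$ and $w\in\underline w$, the two points $gw^{\infty}=\lim_i gw^i$ and $gw^{-\infty}=\lim_i gw^{-i}$. It carries the quotient topology and the induced action of $F$. Assume that $\mathcal D$ is connected. A cut set is a subset of $\mathcal D$ whose complement is not connected. A cut point is a point $x$ such that $\{x\}$ is a cut set. A cut pair is a two-point cut set neither point of which is a cut point. A cut pair $\{x_0,x_1\}$ crosses a cut pair $S$ if $x_0$ and $x_1$ lie in different components of $\mathcal D\setminus S$. A cut pair is uncrossed if no cut pair crosses it. An uncrossed collection is a non-empty union of $F$-orbits of cut points (regarded as one-point sets) and uncrossed cut pairs. Let $\{S_i\}_{i\in I}$ be an uncrossed collection. Its Bass–Serre tree is the following bipartite graph with the induced action of $F$. The Type 1 vertices are the sets $S_i$. For each $S_i$ and each component $U$ of $\mathcal D\setminus S_i$ there is a Type 2 vertex adjacent to $S_i$, namely the set consisting of $S_i$ and of all $S_j\subset U$ such that no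 $S_k$ separates $S_i$ from $S_j$ (that is, such that $S_i$ and $S_j$ do not lie in different components of $\mathcal D\setminus S_k$ for any $k$); equal sets define the same Type 2 vertex. Let $\Gamma$ be the quotient graph of groups, whose vertex groups are the stabilizers in $F$ of representatives of the $F$-orbits of vertices. Then for every cut point or cut pair $S$ of $\mathcal D$ (crossed or not, in the collection or not), the setwise stabilizer of $S$ in $F$ is elliptic in $\Gamma$: it is conjugate in $F$ into a vertex group of $\Gamma$. -/

import Mathlib

open Filter Topology
open scoped Pointwise

namespace LinePattern

/-- The inverse of a letter of the free group on `Fin n`; the letter `(a, true)` is the generator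
`a` and `(a, false)` is its inverse. -/
def invLetter {n : ℕ} (x : Fin n × Bool) : Fin n × Bool := (x.1, !x.2)

theorem invLetter_invLetter {n : ℕ} (x : Fin n × Bool) : invLetter (invLetter x) = x := by
  simp [invLetter]

/-- The boundary at infinity of the Cayley tree of the free group on `Fin n`: its points are the
geodesic rays from the identity, that is, the infinite reduced words. -/
def Boundary (n : ℕ) : Type :=
  {ξ : ℕ → Fin n × Bool // ∀ i, ξ (i + 1) ≠ invLetter (ξ i)}

/-- The topology in which two rays are close if they share a long initial segment (the product
topology, the letters being discrete). -/
instance (n : ℕ) : TopologicalSpace (Boundary n) :=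
  inferInstanceAs (TopologicalSpace {ξ : ℕ → Fin n × Bool // ∀ i, ξ (i + 1) ≠ invLetter (ξ i)})

namespace Boundary

/-- Delete the first letter. -/
def tail {n : ℕ} (ξ : Boundary n) : Boundary n := ⟨fun i => ξ.1 (i + 1), fun i => ξ.2 (i + 1)⟩

/-- Left multiplication of an infinite reduced word by one letter, followed by reduction. -/
def letterMul {n : ℕ} (x : Fin n × Bool) (ξ : Boundary n) : Boundary n :=
  if h : ξ.1 0 = invLetter x then ξ.tail
  else ⟨fun i => Nat.casesOn i x ξ.1, fun i => by
    cases i with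
    | zero => exact h
    | succ i => exact ξ.2 i⟩

theorem letterMul_of_eq {n : ℕ} {x : Fin n × Bool} {ξ : Boundary n} (h : ξ.1 0 = invLetter x) :
    letterMul x ξ = ξ.tail := by
  simp [letterMul, h]

theorem letterMul_zero {n : ℕ} {x : Fin n × Bool} {ξ : Boundary n} (h : ξ.1 0 ≠ invLetter x) :
    (letterMul x ξ).1 0 = x := by
  simp [letterMul, h]

theorem letterMul_succ {n : ℕ} {x : Fin n × Bool} {ξ : Boundary n} (h : ξ.1 0 ≠ invLetter x)
    (i : ℕ) : (letterMul x ξ).1 (i + 1) = ξ.1 i := by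
  simp [letterMul, h]

theorem letterMul_cancel {n : ℕ} (x : Fin n × Bool) (ξ : Boundary n) :
    letterMul (invLetter x) (letterMul x ξ) = ξ := by
  by_cases h : ξ.1 0 = invLetter x
  · have h1 : ξ.tail.1 0 ≠ invLetter (invLetter x) := by
      rw [← h]; exact ξ.2 0
    rw [letterMul_of_eq h]
    apply Subtype.ext
    funext i
    cases i with
    | zero => rw [letterMul_zero h1, h]
    | succ i => rw [letterMul_succ h1]; rfl
  · rw [letterMul_of_eq (by rw [letterMul_zero h, invLetter_invLetter])]
    apply Subtype.ext
    funext i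
    exact letterMul_succ h i

/-- A generator acts on the boundary as a permutation. -/
def genPerm {n : ℕ} (a : Fin n) : Equiv.Perm (Boundary n) where
  toFun := letterMul (a, true)
  invFun := letterMul (a, false)
  left_inv := letterMul_cancel (a, true)
  right_inv := letterMul_cancel (a, false)

/-- The action of the free group on its boundary that extends left multiplication. -/
instance (n : ℕ) : MulAction (FreeGroup (Fin n)) (Boundary n) :=
  MulAction.compHom (Boundary n) (FreeGroup.lift (genPerm (n := n)))

theorem of_smul {n : ℕ} (a : Fin n) (ξ : Boundary n) :
    FreeGroup.of a • ξ = letterMul (a, true) ξ := by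
  change (FreeGroup.lift (genPerm (n := n)) (FreeGroup.of a)) ξ = _
  rw [FreeGroup.lift_apply_of]; rfl

theorem of_inv_smul {n : ℕ} (a : Fin n) (ξ : Boundary n) :
    (FreeGroup.of a)⁻¹ • ξ = letterMul (a, false) ξ := by
  change (FreeGroup.lift (genPerm (n := n)) (FreeGroup.of a)⁻¹) ξ = _
  rw [map_inv, FreeGroup.lift_apply_of]; rfl

theorem continuous_letterMul {n : ℕ} (x : Fin n × Bool) :
    Continuous (letterMul x : Boundary n → Boundary n) := by
  have hc : ∀ i : ℕ, Continuous (fun ξ : Boundary n => ξ.1 i) := fun i =>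
    (continuous_apply i).comp continuous_subtype_val
  refine Continuous.subtype_mk (f := fun ξ : Boundary n => (letterMul x ξ).1) ?_ _
  refine continuous_pi fun i => ?_
  cases i with
  | zero =>
    have : (fun ξ : Boundary n => (letterMul x ξ).1 0) =
        (fun p : (Fin n × Bool) × (Fin n × Bool) => if p.1 = invLetter x then p.2 else x) ∘
          (fun ξ : Boundary n => (ξ.1 0, ξ.1 1)) := by
      funext ξ
      by_cases h : ξ.1 0 = invLetter x
      · simp only [Function.comp, h, if_true, letterMul_of_eq h]; rfl
      · simp only [Function.comp, h, if_false, letterMul_zero h]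
    rw [this]
    exact continuous_of_discreteTopology.comp ((hc 0).prodMk (hc 1))
  | succ i =>
    have : (fun ξ : Boundary n => (letterMul x ξ).1 (i + 1)) =
        (fun p : (Fin n × Bool) × (Fin n × Bool) × (Fin n × Bool) =>
          if p.1 = invLetter x then p.2.1 else p.2.2) ∘
          (fun ξ : Boundary n => (ξ.1 0, ξ.1 (i + 2), ξ.1 i)) := by
      funext ξ
      by_cases h : ξ.1 0 = invLetter x
      · simp only [Function.comp, h, if_true, letterMul_of_eq h]; rfl
      · simp only [Function.comp, h, if_false, letterMul_succ h]
    rw [this]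
    exact continuous_of_discreteTopology.comp ((hc 0).prodMk ((hc (i + 2)).prodMk (hc i)))

instance (n : ℕ) : ContinuousConstSMul (FreeGroup (Fin n)) (Boundary n) where
  continuous_const_smul g := by
    induction g using FreeGroup.induction_on with
    | C1 => simpa using continuous_id'
    | of a => simpa only [of_smul] using continuous_letterMul _
    | inv_of a _ => simpa only [of_inv_smul] using continuous_letterMul _
    | mul x y hx hy => simpa only [mul_smul, Function.comp_def] using hx.comp hy

end Boundary

/-- A sequence of vertices of the Cayley tree (elements of the free group) converges to the
boundary point `ξ`: every initial segment of `ξ` is eventually an initial segment of the reduced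
words of the elements of the sequence. -/
def ConvergesTo {n : ℕ} (u : ℕ → FreeGroup (Fin n)) (ξ : Boundary n) : Prop :=
  ∀ k : ℕ, ∀ᶠ i in atTop, ∀ j < k, (u i).toWord[j]? = some (ξ.1 j)

theorem ConvergesTo.letter {n : ℕ} {u v : ℕ → FreeGroup (Fin n)} {ξ : Boundary n}
    (h : ConvergesTo u ξ) (x : Fin n × Bool)
    (hv : ∀ i, (v i).toWord = FreeGroup.reduce (x :: (u i).toWord)) :
    ConvergesTo v (Boundary.letterMul x ξ) := by
  intro k
  filter_upwards [h (k + 1)] with i hi j hj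
  have h0 := hi 0 (by omega)
  rw [hv i, FreeGroup.reduce.cons, FreeGroup.reduce_toWord]
  cases hw : (u i).toWord with
  | nil => simp [hw] at h0
  | cons hd tl =>
    rw [hw] at h0 hi
    have hhd : hd = ξ.1 0 := by simpa using h0
    by_cases hx : ξ.1 0 = invLetter x
    · have hc : x.1 = hd.1 ∧ x.2 = !hd.2 := by
        rw [hhd, hx]; simp [invLetter]
      rw [Boundary.letterMul_of_eq hx]
      simp only [hc, and_self, if_true]
      have := hi (j + 1) (by omega)
      rw [List.getElem?_cons_succ] at this
      exact this
    · have hc : ¬ (x.1 = hd.1 ∧ x.2 = !hd.2) := by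
        rintro ⟨h1, h2⟩
        exact hx (by rw [← hhd]; ext <;> simp [invLetter, h1, h2])
      simp only [hc, if_false]
      cases j with
      | zero => simp [Boundary.letterMul_zero hx]
      | succ j =>
        rw [Boundary.letterMul_succ hx]
        simpa using hi j (by omega)

theorem ConvergesTo.smul {n : ℕ} (g : FreeGroup (Fin n)) :
    ∀ {u : ℕ → FreeGroup (Fin n)} {ξ : Boundary n}, ConvergesTo u ξ →
      ConvergesTo (fun i => g * u i) (g • ξ) := by
  induction g using FreeGroup.induction_on with
  | C1 => intro u ξ h; simpa using h
  | of a =>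
    intro u ξ h
    rw [Boundary.of_smul]
    exact h.letter _ fun i => by rw [FreeGroup.toWord_mul, FreeGroup.toWord_of]; rfl
  | inv_of a _ =>
    intro u ξ h
    rw [Boundary.of_inv_smul]
    exact h.letter _ fun i => by
      rw [FreeGroup.toWord_mul, FreeGroup.toWord_inv, FreeGroup.toWord_of]; rfl
  | mul x y hx hy =>
    intro u ξ h
    simpa only [mul_smul, mul_assoc] using hx (hy h)

/-- `ξ` and `η` are the endpoints `g w^∞` and `g w^{-∞}` of a line of the line pattern generated by
the multiword `W`. -/
def IsLine {n : ℕ} (W : List (FreeGroup (Fin n))) (ξ η : Boundary n) : Prop :=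
  ∃ w ∈ W, ∃ g : FreeGroup (Fin n),
    ConvergesTo (fun i => g * w ^ i) ξ ∧ ConvergesTo (fun i => g * w⁻¹ ^ i) η

theorem IsLine.smul {n : ℕ} {W : List (FreeGroup (Fin n))} {ξ η : Boundary n}
    (h : IsLine W ξ η) (g : FreeGroup (Fin n)) : IsLine W (g • ξ) (g • η) := by
  obtain ⟨w, hw, f, h1, h2⟩ := h
  refine ⟨w, hw, g * f, ?_, ?_⟩
  · simpa only [mul_assoc] using h1.smul g
  · simpa only [mul_assoc] using h2.smul g

/-- The decomposition space of the multiword `W`: the quotient of the boundary that identifies the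
two endpoints of each line of the line pattern. -/
def DecompSpace {n : ℕ} (W : List (FreeGroup (Fin n))) : Type := Quot (IsLine W)

/-- The decomposition space carries the quotient topology. -/
instance {n : ℕ} (W : List (FreeGroup (Fin n))) : TopologicalSpace (DecompSpace W) :=
  inferInstanceAs (TopologicalSpace (Quot (IsLine W)))

/-- The action of the free group on the decomposition space induced by that on the boundary. -/
instance {n : ℕ} (W : List (FreeGroup (Fin n))) :
    MulAction (FreeGroup (Fin n)) (DecompSpace W) where
  smul g := Quot.map (fun ξ => g • ξ) fun _ _ h => h.smul g
  one_smul x := by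
    induction x using Quot.ind with
    | mk ξ => exact congrArg (Quot.mk _) (one_smul _ ξ)
  mul_smul g h x := by
    induction x using Quot.ind with
    | mk ξ => exact congrArg (Quot.mk _) (mul_smul g h ξ)

instance {n : ℕ} (W : List (FreeGroup (Fin n))) :
    ContinuousConstSMul (FreeGroup (Fin n)) (DecompSpace W) where
  continuous_const_smul g := by
    refine continuous_quot_lift _ ?_
    exact continuous_quot_mk.comp (continuous_const_smul g)

section CutSets

variable {X : Type} [TopologicalSpace X]

/-- A cut set is a set whose complement is not connected. -/
def IsCutSet (S : Set X) : Prop := ¬ IsPreconnected Sᶜ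

/-- `S` consists of a single cut point. -/
def IsCutPoint (S : Set X) : Prop := ∃ x, S = {x} ∧ IsCutSet ({x} : Set X)

/-- `S` is a cut pair: a two-point cut set neither point of which is a cut point. -/
def IsCutPair (S : Set X) : Prop :=
  ∃ x y, x ≠ y ∧ S = {x, y} ∧ IsCutSet ({x, y} : Set X) ∧
    ¬ IsCutSet ({x} : Set X) ∧ ¬ IsCutSet ({y} : Set X)

/-- The two points of `R` lie in different components of the complement of `S`. -/
def Crosses (R S : Set X) : Prop :=
  ∃ x y, R = {x, y} ∧ x ∉ S ∧ y ∉ S ∧ connectedComponentIn Sᶜ x ≠ connectedComponentIn Sᶜ y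

/-- `S` is a cut pair that is crossed by no cut pair. -/
def IsUncrossedCutPair (S : Set X) : Prop :=
  IsCutPair S ∧ ∀ R : Set X, IsCutPair R → ¬ Crosses R S

/-- `P` separates `S` from `R`: these lie in different components of the complement of `P`. -/
def Separates (P S R : Set X) : Prop :=
  ∃ x y, S ⊆ connectedComponentIn Pᶜ x ∧ R ⊆ connectedComponentIn Pᶜ y ∧
    connectedComponentIn Pᶜ x ≠ connectedComponentIn Pᶜ y

/-- For a collection `C` of cut sets, a member `S` of it and the component of the complement of `S`
that contains `x`: the set consisting of `S` and of all members of `C` in that component which are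
minimal with respect to `S`, that is, not separated from `S` by a member of `C`. -/
def minimalStar (C : Set (Set X)) (S : Set X) (x : X) : Set (Set X) :=
  insert S {R | R ∈ C ∧ R ⊆ connectedComponentIn Sᶜ x ∧ ∀ P ∈ C, ¬ Separates P S R}

end CutSets

section Action

variable {G X : Type} [Group G] [TopologicalSpace X] [MulAction G X] [ContinuousConstSMul G X]

theorem smul_connectedComponentIn (g : G) (S : Set X) {x : X} (hx : x ∉ S) :
    g • connectedComponentIn Sᶜ x = connectedComponentIn (g • S)ᶜ (g • x) := by
  have h := (Homeomorph.smul g).image_connectedComponentIn (s := Sᶜ) (x := x) hx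
  rw [← Set.smul_set_compl]
  exact h

theorem Separates.smul {P S R : Set X} (h : Separates P S R) (hS : S.Nonempty) (hR : R.Nonempty)
    (g : G) : Separates (g • P) (g • S) (g • R) := by
  obtain ⟨x, y, h1, h2, h3⟩ := h
  have hx : x ∉ P := by
    obtain ⟨s, hs⟩ := hS
    exact connectedComponentIn_nonempty_iff.1 ⟨s, h1 hs⟩
  have hy : y ∉ P := by
    obtain ⟨s, hs⟩ := hR
    exact connectedComponentIn_nonempty_iff.1 ⟨s, h2 hs⟩
  refine ⟨g • x, g • y, ?_, ?_, ?_⟩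
  · rw [← smul_connectedComponentIn g P hx]; exact Set.smul_set_mono h1
  · rw [← smul_connectedComponentIn g P hy]; exact Set.smul_set_mono h2
  · rw [← smul_connectedComponentIn g P hx, ← smul_connectedComponentIn g P hy]
    exact fun h => h3 (smul_left_cancel g h)

theorem smul_minimalStar_subset {C : Set (Set X)} (hne : ∀ S ∈ C, S.Nonempty)
    (hC : ∀ g : G, ∀ S ∈ C, g • S ∈ C) {S : Set X} (hS : S ∈ C) {x : X} (hx : x ∉ S) (g : G) :
    g • minimalStar C S x ⊆ minimalStar C (g • S) (g • x) := by
  rintro _ ⟨R, hR, rfl⟩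
  rcases hR with rfl | ⟨hRC, hRS, hmin⟩
  · exact Or.inl rfl
  · refine Or.inr ⟨hC g R hRC, ?_, fun P hP hsep => ?_⟩
    · rw [← smul_connectedComponentIn g S hx]; exact Set.smul_set_mono hRS
    · refine hmin (g⁻¹ • P) (hC _ P hP) ?_
      have := hsep.smul (hne _ (hC g S hS)) (hne _ (hC g R hRC)) g⁻¹
      simpa only [inv_smul_smul] using this

theorem smul_minimalStar {C : Set (Set X)} (hne : ∀ S ∈ C, S.Nonempty)
    (hC : ∀ g : G, ∀ S ∈ C, g • S ∈ C) {S : Set X} (hS : S ∈ C) {x : X} (hx : x ∉ S) (g : G) :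
    g • minimalStar C S x = minimalStar C (g • S) (g • x) := by
  refine (smul_minimalStar_subset hne hC hS hx g).antisymm ?_
  have hx' : g • x ∉ g • S := by rwa [Set.smul_mem_smul_set_iff]
  have h := smul_minimalStar_subset hne hC (hC g S hS) hx' g⁻¹
  rw [inv_smul_smul, inv_smul_smul] at h
  have h2 := Set.smul_set_mono (a := g) h
  rwa [smul_inv_smul] at h2

end Action

/-- An uncrossed collection: a non-empty union of orbits of cut points and uncrossed cut pairs of
the decomposition space. -/
structure UncrossedCollection {n : ℕ} (W : List (FreeGroup (Fin n))) where
  sets : Set (Set (DecompSpace W))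
  nonempty : sets.Nonempty
  isCutPoint_or_isUncrossedCutPair : ∀ S ∈ sets, IsCutPoint S ∨ IsUncrossedCutPair S
  smul_mem : ∀ g : FreeGroup (Fin n), ∀ S ∈ sets, g • S ∈ sets

namespace UncrossedCollection

variable {n : ℕ} {W : List (FreeGroup (Fin n))} (C : UncrossedCollection W)

theorem nonempty_of_mem (S : Set (DecompSpace W)) (hS : S ∈ C.sets) : S.Nonempty := by
  rcases C.isCutPoint_or_isUncrossedCutPair S hS with ⟨x, rfl, _⟩ | ⟨⟨x, y, _, rfl, _⟩, _⟩
  · exact ⟨x, rfl⟩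
  · exact ⟨x, Or.inl rfl⟩

/-- Type 1 vertices of the Bass–Serre tree: the members of the collection. -/
def TypeOne : Type := {S : Set (DecompSpace W) // S ∈ C.sets}

/-- Type 2 vertices of the Bass–Serre tree: one for each member `S` of the collection and each
component of its complement, namely the set consisting of `S` and of the members of the collection
in that component that are minimal with respect to `S`. Such sets are identified when equal. -/
def TypeTwo : Type :=
  {T : Set (Set (DecompSpace W)) // ∃ S ∈ C.sets, ∃ x, x ∉ S ∧ T = minimalStar C.sets S x}

instance : MulAction (FreeGroup (Fin n)) C.TypeOne where
  smul g S := ⟨g • S.1, C.smul_mem g S.1 S.2⟩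
  one_smul S := Subtype.ext (one_smul _ S.1)
  mul_smul g h S := Subtype.ext (mul_smul g h S.1)

instance : MulAction (FreeGroup (Fin n)) C.TypeTwo where
  smul g T := ⟨g • T.1, by
    obtain ⟨S, hS, x, hx, hT⟩ := T.2
    refine ⟨g • S, C.smul_mem g S hS, g • x, by rwa [Set.smul_mem_smul_set_iff], ?_⟩
    rw [hT]
    exact smul_minimalStar C.nonempty_of_mem C.smul_mem hS hx g⟩
  one_smul T := Subtype.ext (one_smul _ T.1)
  mul_smul g h T := Subtype.ext (mul_smul g h T.1)

/-- The vertices of the Bass–Serre tree. -/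
abbrev Vertex : Type := C.TypeOne ⊕ C.TypeTwo

/-- A Type 2 vertex is adjacent to the Type 1 vertex `S` if it arises from a component of the
complement of `S`. -/
def Incident (S : C.TypeOne) (T : C.TypeTwo) : Prop :=
  ∃ x, x ∉ S.1 ∧ T.1 = minimalStar C.sets S.1 x

/-- The Bass–Serre tree of the splitting given by the collection. -/
def tree : SimpleGraph C.Vertex where
  Adj
    | .inl S, .inr T => C.Incident S T
    | .inr T, .inl S => C.Incident S T
    | _, _ => False
  symm := ⟨by rintro (S | T) (S' | T') h <;> exact h⟩
  loopless := ⟨by rintro (S | T) h <;> exact h⟩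

theorem Incident.smul {C : UncrossedCollection W} {S : C.TypeOne} {T : C.TypeTwo}
    (h : C.Incident S T) (g : FreeGroup (Fin n)) : C.Incident (g • S) (g • T) := by
  obtain ⟨x, hx, hT⟩ := h
  refine ⟨g • x, (Set.smul_mem_smul_set_iff (a := g)).not.2 hx, ?_⟩
  change g • T.1 = _
  rw [hT]
  exact smul_minimalStar C.nonempty_of_mem C.smul_mem S.2 hx g

/-- The group acts on the Bass–Serre tree by graph automorphisms, without inversions because the
two types of vertices are preserved. -/
theorem tree_adj_smul {v v' : C.Vertex} (h : C.tree.Adj v v') (g : FreeGroup (Fin n)) :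
    C.tree.Adj (g • v) (g • v') := by
  rcases v with S | T <;> rcases v' with S' | T'
  · exact h
  · exact Incident.smul (h : C.Incident S T') g
  · exact Incident.smul (h : C.Incident S' T) g
  · exact h

/-- The vertices of the graph of groups `Γ` of the collection: the orbits of vertices of its
Bass–Serre tree. -/
abbrev GraphVertex : Type := MulAction.orbitRel.Quotient (FreeGroup (Fin n)) C.Vertex

/-- The vertex group of `Γ` at a vertex `q`, as a subgroup of the free group: the stabilizer of a
chosen lift of `q` to the Bass–Serre tree. -/
noncomputable def vertexGroup (q : C.GraphVertex) : Subgroup (FreeGroup (Fin n)) :=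
  MulAction.stabilizer (FreeGroup (Fin n)) (Quotient.out q)

/-- A subgroup is elliptic in `Γ` if it is conjugate into a vertex group of `Γ`; equivalently, if
it fixes a vertex of the Bass–Serre tree. -/
def IsElliptic (H : Subgroup (FreeGroup (Fin n))) : Prop :=
  ∃ q : C.GraphVertex, ∃ f : FreeGroup (Fin n), ∀ h ∈ H, f * h * f⁻¹ ∈ C.vertexGroup q

end UncrossedCollection

end LinePattern

/-! ### Reduced words, rays and convergence to the boundary -/

namespace LinePattern

variable {n : ℕ}

/-! A trivial stabilizer fixes every vertex of the tree, and a member `S` of the collection is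
itself a Type 1 vertex. So let `S` lie outside the collection and have nontrivial stabilizer. The
members that no member separates from `S` turn out to form a Type 2 vertex. This set depends only on
`S` and the collection, hence the stabilizer of `S` fixes it.

Sets are compared through their preimages in the boundary. A nontrivial element has at most two
fixed points there, and two elements that share one have nontrivial powers fixing the same points
(`exists_common_power`). Hence sets that are axial (`IsAxial`) are equal or disjoint
(`IsAxial.eq_of_mem`). Here `S` is axial by `isAxial_of_smul_eq`. Members of the collection are
axial too, so `S` is disjoint from each of them and, these being cut points or uncrossed, lies on
one side of each (`subset_side`). Separation then behaves like betweenness in a tree, and a member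
with the fewest separators from `S` has none, provided that these numbers are finite.

Two finiteness results carry the proof. The first says that cut points and uncrossed cut pairs form
finitely many orbits and have nontrivial stabilizers. A point with one preimage is not a cut point
(`isPreconnected_compl_of_fiber`), so cut points come from lines. A cut pair containing a point with
two preimages is crossed (`exists_crosses_of_fiber`), so the points of an uncrossed pair have one
preimage each. A geodesic joining preimages of its two points then leaves the pattern at infinitely
many vertices; moved to the identity, these give pairs in a compact set disjoint from the fibres of
the projection. Near two distinct points there are only finitely many uncrossed cut pairs
(`exists_nhds_finite_uncrossed`): among nested ones, a middle pair would be crossed by a pair made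
of outer points. Compactness and the pigeonhole principle finish.

The second is `UncrossedCollection.finite_separates`. Infinitely many separators in one orbit would
be carried to one set `R` by shortest elements tending to a boundary point `α`. Minimality keeps `α`
off `R`, while these elements move points of both separated sets close to `α`, hence to the same
side of `R`. -/

theorem ne_invLetter_iff {a b : Fin n × Bool} :
    b ≠ invLetter a ↔ (a.1 = b.1 → a.2 = b.2) := by
  rcases a with ⟨a, s⟩
  rcases b with ⟨b, t⟩
  cases s <;> cases t <;> simp [invLetter, eq_comm]

/-- A letter as an element of the free group. -/
def letter (x : Fin n × Bool) : FreeGroup (Fin n) := FreeGroup.mk [x]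

theorem letter_inv (x : Fin n × Bool) : (letter x)⁻¹ = letter (invLetter x) := by
  simp [letter, invLetter, FreeGroup.inv_mk, FreeGroup.invRev]

theorem letter_smul (x : Fin n × Bool) (ξ : Boundary n) :
    letter x • ξ = Boundary.letterMul x ξ := by
  rcases x with ⟨a, _ | _⟩
  · rw [← Boundary.of_inv_smul]; rfl
  · rw [← Boundary.of_smul]; rfl

theorem letter_induction {p : FreeGroup (Fin n) → Prop} (one : p 1)
    (mul : ∀ x g, p g → p (letter x * g)) (g : FreeGroup (Fin n)) : p g := by
  rw [← FreeGroup.mk_toWord (x := g)]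
  induction g.toWord with
  | nil => exact one
  | cons x L ih => simpa [letter, FreeGroup.mul_mk] using mul x _ ih

/-- The vertex at distance `k` from the identity on the ray to `ξ`. -/
def pre (ξ : Boundary n) (k : ℕ) : FreeGroup (Fin n) := FreeGroup.mk ((List.range k).map ξ.1)

theorem toWord_pre (ξ : Boundary n) (k : ℕ) : (pre ξ k).toWord = (List.range k).map ξ.1 := by
  rw [pre, FreeGroup.toWord_mk, FreeGroup.IsReduced.reduce_eq]
  rw [FreeGroup.IsReduced, List.isChain_iff_getElem]
  intro i hi
  simpa using ne_invLetter_iff.1 (ξ.2 i)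

theorem norm_pre (ξ : Boundary n) (k : ℕ) : (pre ξ k).norm = k := by
  simp [FreeGroup.norm, toWord_pre]

theorem pre_injective (ξ : Boundary n) : Function.Injective (pre ξ) := fun k l h => by
  rw [← norm_pre ξ k, h, norm_pre]

@[simp] theorem pre_zero (ξ : Boundary n) : pre ξ 0 = 1 := rfl

theorem pre_succ (ξ : Boundary n) (k : ℕ) : pre ξ (k + 1) = pre ξ k * letter (ξ.1 k) := by
  simp [pre, letter, List.range_succ, FreeGroup.mul_mk]

theorem pre_succ' (ξ : Boundary n) (k : ℕ) : pre ξ (k + 1) = letter (ξ.1 0) * pre ξ.tail k := by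
  simp [pre, letter, List.range_succ_eq_map, FreeGroup.mul_mk, Boundary.tail, Function.comp_def]

/-- The ray to `ξ` and the geodesic to `u` share the first `k` letters. -/
def StartsWith (u : FreeGroup (Fin n)) (ξ : Boundary n) (k : ℕ) : Prop :=
  ∀ j < k, u.toWord[j]? = some (ξ.1 j)

theorem StartsWith.mono {u : FreeGroup (Fin n)} {ξ : Boundary n} {k l : ℕ}
    (h : StartsWith u ξ k) (hl : l ≤ k) : StartsWith u ξ l := fun j hj => h j (by omega)

theorem startsWith_pre (ξ : Boundary n) (k : ℕ) : StartsWith (pre ξ k) ξ k := fun j hj => by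
  simp [toWord_pre, hj]

theorem StartsWith.le_norm {u : FreeGroup (Fin n)} {ξ : Boundary n} {k : ℕ}
    (h : StartsWith u ξ k) : k ≤ u.norm := by
  by_contra hk
  have := h u.norm (by omega)
  simp [FreeGroup.norm] at this

theorem StartsWith.exists_eq_mul {u : FreeGroup (Fin n)} {ξ : Boundary n} {k : ℕ}
    (h : StartsWith u ξ k) : ∃ z, u = pre ξ k * z ∧ u.norm = k + z.norm ∧
      ∀ j, z.toWord[j]? = u.toWord[k + j]? := by
  have hk := h.le_norm
  have htake : u.toWord.take k = (List.range k).map ξ.1 := by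
    apply List.ext_getElem?
    intro j
    by_cases hj : j < k
    · simp [hj, h j hj]
    · simp [hj]
  have hw : (FreeGroup.mk (u.toWord.drop k)).toWord = u.toWord.drop k := by
    rw [FreeGroup.toWord_mk, FreeGroup.IsReduced.reduce_eq]
    exact FreeGroup.isReduced_toWord.infix (List.drop_suffix k _).isInfix
  refine ⟨FreeGroup.mk (u.toWord.drop k), ?_, ?_, ?_⟩
  · rw [pre, ← htake, FreeGroup.mul_mk, List.take_append_drop, FreeGroup.mk_toWord]
  · simp only [FreeGroup.norm] at hk ⊢
    rw [hw, List.length_drop]; omega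
  · intro j; rw [hw, List.getElem?_drop]

/-- A sequence in the free group converges to `ξ` along a filter. -/
def ConvTo {ι : Type*} (l : Filter ι) (u : ι → FreeGroup (Fin n)) (ξ : Boundary n) : Prop :=
  ∀ k, ∀ᶠ i in l, StartsWith (u i) ξ k

theorem convTo_pre (ξ : Boundary n) : ConvTo atTop (pre ξ) ξ := fun k => by
  filter_upwards [eventually_ge_atTop k] with l hl
  exact (startsWith_pre ξ l).mono hl

theorem ConvTo.unique {ι : Type*} {l : Filter ι} [l.NeBot] {u : ι → FreeGroup (Fin n)}
    {ξ η : Boundary n} (h : ConvTo l u ξ) (h' : ConvTo l u η) : ξ = η := by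
  apply Subtype.ext
  funext j
  obtain ⟨i, hi, hi'⟩ := ((h (j + 1)).and (h' (j + 1))).exists
  have := (hi j (by omega)).symm.trans (hi' j (by omega))
  simpa using this

theorem toWord_mul_letter (u : FreeGroup (Fin n)) (x : Fin n × Bool) :
    (∃ L, u.toWord = L ++ [invLetter x] ∧ (u * letter x).toWord = L) ∨
      (u * letter x).toWord = u.toWord ++ [x] := by
  rcases List.eq_nil_or_concat u.toWord with h | ⟨L, y, h⟩
  · right
    rw [FreeGroup.toWord_mul, h]
    simp [letter]
  · have hL : FreeGroup.IsReduced (L ++ [y]) := by rw [← List.concat_eq_append, ← h]; exact FreeGroup.isReduced_toWord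
    have hu : u = FreeGroup.mk L * letter y := by
      rw [letter, FreeGroup.mul_mk, ← List.concat_eq_append, ← h, FreeGroup.mk_toWord]
    by_cases hy : y = invLetter x
    · left
      refine ⟨L, by rw [h, hy, List.concat_eq_append], ?_⟩
      rw [hu, hy, ← letter_inv, inv_mul_cancel_right, FreeGroup.toWord_mk,
        FreeGroup.IsReduced.reduce_eq]
      exact hL.infix ⟨[], [y], by simp⟩
    · right
      have : FreeGroup.IsReduced (L ++ [y] ++ [x]) := by
        refine FreeGroup.IsReduced.append_overlap hL ?_ (by simp)
        have hx : x ≠ invLetter y := fun e => hy (by rw [e, invLetter_invLetter])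
        simpa using ne_invLetter_iff.1 hx
      rw [FreeGroup.toWord_mul, h, List.concat_eq_append]
      simpa [letter] using this.reduce_eq

/-- Each letter of `c` removes or adds one letter at the end, so cancellation reaches at most
`c.norm` letters deep. -/
theorem toWord_mul_getElem? (u c : FreeGroup (Fin n)) :
    ∀ j, j + c.norm < u.norm → (u * c).toWord[j]? = u.toWord[j]? := by
  have key : ∀ (L : List (Fin n × Bool)) (u : FreeGroup (Fin n)) (j : ℕ),
      j + L.length < u.norm → (u * FreeGroup.mk L).toWord[j]? = u.toWord[j]? := by
    intro L
    induction L with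
    | nil => intro u j _; rw [← FreeGroup.one_eq_mk, mul_one]
    | cons x L ih =>
      intro u j hj
      have e : u * FreeGroup.mk (x :: L) = u * letter x * FreeGroup.mk L := by
        rw [mul_assoc, letter, FreeGroup.mul_mk]; rfl
      rw [List.length_cons] at hj
      rcases toWord_mul_letter u x with ⟨M, h1, h2⟩ | h
      · have hM : u.norm = M.length + 1 := by simp [FreeGroup.norm, h1]
        rw [e, ih _ _ (by rw [FreeGroup.norm, h2]; omega), h2, h1,
          List.getElem?_append_left (by omega)]
      · have hM : (u * letter x).norm = u.norm + 1 := by simp [FreeGroup.norm, h]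
        rw [e, ih _ _ (by omega), h, List.getElem?_append_left]
        rw [FreeGroup.norm] at hj; omega
  intro j hj
  have := key c.toWord u j hj
  rwa [FreeGroup.mk_toWord] at this

theorem StartsWith.mul {u c : FreeGroup (Fin n)} {ξ : Boundary n} {k : ℕ}
    (h : StartsWith u ξ (k + c.norm)) : StartsWith (u * c) ξ k := fun j hj => by
  have := h.le_norm
  rw [toWord_mul_getElem? _ _ _ (by omega)]
  exact h j (by omega)

theorem ConvTo.mul_right {ι : Type*} {l : Filter ι} {u : ι → FreeGroup (Fin n)}
    {ξ : Boundary n} (h : ConvTo l u ξ) (c : FreeGroup (Fin n)) :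
    ConvTo l (fun i => u i * c) ξ := fun k => by
  filter_upwards [h (k + c.norm)] with i hi
  exact hi.mul

/-- Each letter of `g` either cancels the first letter of the ray, which uses up one more letter of
`ξ`, or lengthens the ray by one. Hence `g` carries the ray to `ξ` onto the ray to `g • ξ` up to
finite initial segments, with a shift by `d - s`. -/
theorem exists_mul_pre (g : FreeGroup (Fin n)) :
    ∀ ξ : Boundary n, ∃ s d, ∀ l, g * pre ξ (l + s) = pre (g • ξ) (l + d) := by
  induction g using letter_induction with
  | one => intro ξ; exact ⟨0, 0, fun l => by simp⟩
  | mul x g ih =>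
    intro ξ
    obtain ⟨s, d, h⟩ := ih ξ
    by_cases hx : (g • ξ).1 0 = invLetter x
    · refine ⟨s + 1, d, fun l => ?_⟩
      rw [show l + (s + 1) = l + 1 + s by omega, mul_assoc, h, mul_smul, letter_smul,
        Boundary.letterMul_of_eq hx, show l + 1 + d = l + d + 1 by omega, pre_succ', hx,
        ← letter_inv, mul_inv_cancel_left]
    · refine ⟨s, d + 1, fun l => ?_⟩
      rw [mul_assoc, h, mul_smul, letter_smul, ← add_assoc, pre_succ',
        Boundary.letterMul_zero hx]
      congr 2
      apply Subtype.ext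
      funext i
      exact (Boundary.letterMul_succ hx i).symm

theorem getElem?_smul_of_ne (L : List (Fin n × Bool)) (hL : FreeGroup.IsReduced L)
    (ξ : Boundary n) (h : ∀ x ∈ L.getLast?, ξ.1 0 ≠ invLetter x) :
    ∀ j < L.length, L[j]? = some ((FreeGroup.mk L • ξ).1 j) := by
  induction L with
  | nil => simp
  | cons x L ih =>
    have e : FreeGroup.mk (x :: L) • ξ = Boundary.letterMul x (FreeGroup.mk L • ξ) := by
      rw [← letter_smul, ← mul_smul, letter, FreeGroup.mul_mk]; rfl
    have hL' : FreeGroup.IsReduced L := hL.infix ⟨[x], [], by simp⟩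
    have h0 : (FreeGroup.mk L • ξ).1 0 ≠ invLetter x := by
      cases L with
      | nil => simpa [← FreeGroup.one_eq_mk] using h
      | cons y L =>
        have h1 := ih hL' (fun z hz => h z (by simpa using hz)) 0 (by simp)
        have : y = (FreeGroup.mk (y :: L) • ξ).1 0 := by simpa using h1
        rw [← this]
        exact ne_invLetter_iff.2 (FreeGroup.isReduced_cons_cons.1 hL).1
    intro j hj
    rw [e]
    cases j with
    | zero => simp [Boundary.letterMul_zero h0]
    | succ j =>
      rw [Boundary.letterMul_succ h0, List.getElem?_cons_succ]
      refine ih hL' (fun z hz => h z ?_) j (by simpa using hj)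
      cases L with
      | nil => simp at hz
      | cons y L => simpa using hz

/-- The hypothesis says that nothing cancels between the last letter of `g` and the first letter of
`ξ`, so `g • ξ` is the concatenation. -/
theorem startsWith_smul_of_ne (g : FreeGroup (Fin n)) (ξ : Boundary n)
    (h : g⁻¹.toWord[0]? ≠ some (ξ.1 0)) : StartsWith g (g • ξ) g.norm := by
  have := getElem?_smul_of_ne g.toWord FreeGroup.isReduced_toWord ξ ?_
  · rw [FreeGroup.mk_toWord] at this; exact this
  · intro x hx e
    refine h ?_
    rcases List.eq_nil_or_concat g.toWord with h' | ⟨L, y, h'⟩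
    · simp [h'] at hx
    · rw [FreeGroup.toWord_inv, h']
      simp only [h', List.concat_eq_append, List.getLast?_append, List.getLast?_singleton, Option.some_or, Option.mem_def, Option.some.injEq] at hx
      simp [FreeGroup.invRev, e, hx, invLetter]

end LinePattern

/-! ### Dynamics of the action on the boundary -/

namespace LinePattern

variable {n : ℕ}

theorem pre_inv_smul (y : Boundary n) (m : ℕ) :
    ∀ j, ((pre y m)⁻¹ • y).1 j = y.1 (m + j) := by
  induction m with
  | zero => intro j; simp
  | succ m ih =>
    intro j
    have h0 : ((pre y m)⁻¹ • y).1 0 = invLetter (invLetter (y.1 m)) := by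
      rw [ih, invLetter_invLetter]; rfl
    rw [pre_succ, mul_inv_rev, mul_smul, letter_inv, letter_smul, Boundary.letterMul_of_eq h0]
    change ((pre y m)⁻¹ • y).1 (j + 1) = _
    rw [ih, show m + (j + 1) = m + 1 + j by omega]

theorem exists_first_ne {y z : Boundary n} (h : y ≠ z) :
    ∃ m, y.1 m ≠ z.1 m ∧ ∀ j < m, y.1 j = z.1 j := by
  classical
  have h' : ∃ m, y.1 m ≠ z.1 m := by
    by_contra! hc
    exact h (Subtype.ext (funext hc))
  exact ⟨Nat.find h', Nat.find_spec h', fun j hj => by simpa using Nat.find_min h' hj⟩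

theorem pre_congr {y z : Boundary n} {m : ℕ} (h : ∀ j < m, y.1 j = z.1 j) : pre y m = pre z m := by
  rw [pre, pre]
  congr 1
  exact List.map_congr_left fun j hj => h j (by simpa using hj)

/-- The convergence property of the action on the boundary. -/
theorem ConvTo.eventually_smul {ι : Type*} {l : Filter ι} {u : ι → FreeGroup (Fin n)}
    {α β y : Boundary n} (hα : ConvTo l u α) (hβ : ConvTo l (fun i => (u i)⁻¹) β) (hy : y ≠ β)
    (k : ℕ) : ∀ᶠ i in l, ∀ j < k, (u i • y).1 j = α.1 j := by
  -- The rays to `y` and `β` branch after `m` letters. Since `(u i)⁻¹` follows `β` beyond the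
  -- branching, `u i * pre y m` meets the rest of `y` without cancellation; it still starts like
  -- `α`, as right multiplication by a fixed element changes only the end of the word.
  obtain ⟨m, hm, hlt⟩ := exists_first_ne hy
  filter_upwards [hα (k + (pre y m).norm), hβ (m + 1)] with i hi hi'
  obtain ⟨z, hz, -, hz'⟩ := (hi'.mono (Nat.le_succ m)).exists_eq_mul
  rw [← pre_congr hlt] at hz
  have hu : u i = z⁻¹ * (pre y m)⁻¹ := by rw [← inv_inv (u i), hz, mul_inv_rev]
  have hP : u i * pre y m = z⁻¹ := by rw [hu, inv_mul_cancel_right]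
  have h1 := hi.mul
  rw [hP] at h1
  have h2 := startsWith_smul_of_ne z⁻¹ ((pre y m)⁻¹ • y) (by
    rw [inv_inv, hz', hi' _ (by omega), pre_inv_smul]
    simpa [eq_comm] using hm)
  have hle := h1.le_norm
  intro j hj
  have h3 := (h2 j (by omega)).symm.trans (h1 j hj)
  rw [hu, mul_smul]
  simpa using h3

/-- `a` translates a terminal segment of the ray to `y` towards `y`. -/
def Fwd (a : FreeGroup (Fin n)) (y : Boundary n) : Prop :=
  ∃ s t, 0 < t ∧ ∀ l, a * pre y (l + s) = pre y (l + s + t)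

/-- The sign of the shift `d - s` tells the direction. A zero shift would make `a` fix a vertex of
the Cayley tree, where the action is free. -/
theorem fwd_or_fwd_inv {a : FreeGroup (Fin n)} (ha : a ≠ 1) {y : Boundary n} (h : a • y = y) :
    Fwd a y ∨ Fwd a⁻¹ y := by
  obtain ⟨s, d, hg⟩ := exists_mul_pre a y
  rw [h] at hg
  rcases lt_trichotomy s d with hsd | rfl | hsd
  · exact Or.inl ⟨s, d - s, by omega, fun l => by rw [hg]; congr 1; omega⟩
  · exact absurd (mul_eq_right.1 (hg 0)) ha
  · refine Or.inr ⟨d, s - d, by omega, fun l => ?_⟩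
    rw [← hg, inv_mul_cancel_left]; congr 1; omega

theorem Fwd.convTo {a : FreeGroup (Fin n)} {y : Boundary n} (h : Fwd a y) :
    ConvTo atTop (fun i : ℕ => a ^ i) y := by
  obtain ⟨s, t, ht, h⟩ := h
  have hp : ∀ i : ℕ, a ^ i * pre y s = pre y (s + i * t) := by
    intro i
    induction i with
    | zero => simp
    | succ i ih =>
      have := h (i * t)
      rw [pow_succ', mul_assoc, ih, add_comm s, this]; congr 1; ring
  have h1 : ConvTo atTop (fun i : ℕ => a ^ i * pre y s) y := by
    intro k
    filter_upwards [eventually_ge_atTop k] with i hi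
    rw [hp]
    exact (startsWith_pre _ _).mono (by nlinarith)
  simpa using h1.mul_right (pre y s)⁻¹

theorem eq_of_fwd {a : FreeGroup (Fin n)} {y z : Boundary n} (hy : Fwd a y) (hz : Fwd a z) :
    y = z :=
  hy.convTo.unique hz.convTo

/-- A nontrivial element has at most two fixed points on the boundary. -/
theorem eq_or_eq_or_eq_of_smul_eq {a : FreeGroup (Fin n)} (ha : a ≠ 1) {x y z : Boundary n}
    (hx : a • x = x) (hy : a • y = y) (hz : a • z = z) : x = y ∨ x = z ∨ y = z := by
  -- Of three fixed points two are approached in the same direction, and the limit of the powers in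
  -- that direction is unique.
  rcases fwd_or_fwd_inv ha hx with h1 | h1 <;> rcases fwd_or_fwd_inv ha hy with h2 | h2 <;>
    rcases fwd_or_fwd_inv ha hz with h3 | h3
  all_goals first
    | exact Or.inl (eq_of_fwd h1 h2)
    | exact Or.inr (Or.inl (eq_of_fwd h1 h3))
    | exact Or.inr (Or.inr (eq_of_fwd h2 h3))

theorem Fwd.pow_mul_pre {a : FreeGroup (Fin n)} {y : Boundary n} {s t : ℕ}
    (h : ∀ l, a * pre y (l + s) = pre y (l + s + t)) (m l : ℕ) :
    a ^ m * pre y (l + s) = pre y (l + s + m * t) := by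
  induction m with
  | zero => simp
  | succ m ih =>
    have := h (l + m * t)
    rw [pow_succ', mul_assoc, ih, show l + s + m * t = l + m * t + s by ring, this]
    congr 1; ring

theorem smul_inv_pow_eq {G X : Type*} [Group G] [MulAction G X] {a b : G} {y : X} (hb : b = a ∨ b = a⁻¹)
    (h : a • y = y) (m : ℕ) : b ^ m • y = y := by
  have hb' : b ∈ MulAction.stabilizer G y := by
    rcases hb with rfl | rfl
    · exact h
    · exact inv_mem (show a ∈ MulAction.stabilizer G y from h)
  exact pow_mem hb' m

/-- Two nontrivial elements with a common fixed point on the boundary have a common nontrivial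
power, up to inversion. -/
theorem exists_common_power {a b : FreeGroup (Fin n)} (ha : a ≠ 1) (hb : b ≠ 1)
    {y : Boundary n} (hay : a • y = y) (hby : b • y = y) :
    ∃ c : FreeGroup (Fin n), c ≠ 1 ∧ ∀ z : Boundary n, (a • z = z → c • z = z) ∧
      (b • z = z → c • z = z) := by
  obtain ⟨a', ha', ⟨s, t, ht, h⟩⟩ : ∃ a', (a' = a ∨ a' = a⁻¹) ∧ Fwd a' y := by
    rcases fwd_or_fwd_inv ha hay with h | h
    exacts [⟨a, Or.inl rfl, h⟩, ⟨_, Or.inr rfl, h⟩]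
  obtain ⟨b', hb', ⟨s', t', ht', h'⟩⟩ : ∃ b', (b' = b ∨ b' = b⁻¹) ∧ Fwd b' y := by
    rcases fwd_or_fwd_inv hb hby with h | h
    exacts [⟨b, Or.inl rfl, h⟩, ⟨_, Or.inr rfl, h⟩]
  have e1 := Fwd.pow_mul_pre h t' s'
  have e2 := Fwd.pow_mul_pre h' t s
  -- Both powers translate the ray to `y` by `t * t'`, so they agree on a vertex and therefore
  -- coincide.
  have e : a' ^ t' = b' ^ t := by
    apply mul_right_cancel (b := pre y (s' + s))
    rw [e1, add_comm s' s, e2]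
    congr 1; ring
  refine ⟨a' ^ t', fun h1 => ?_, fun z => ⟨fun hz => smul_inv_pow_eq ha' hz t', fun hz => ?_⟩⟩
  · rw [h1, one_mul] at e1
    have := pre_injective y e1
    have : 0 < t' * t := by positivity
    omega
  · rw [e]; exact smul_inv_pow_eq hb' hz t

/-- Elements whose geodesic follows the ray to a fixed point of `r` for long enough can be
shortened by left multiplication by `r` or its inverse. -/
theorem exists_startsWith_imp_shorter {r : FreeGroup (Fin n)} (hr : r ≠ 1) {y : Boundary n}
    (h : r • y = y) : ∃ k, ∀ g : FreeGroup (Fin n), StartsWith g y k →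
      (r * g).norm < g.norm ∨ (r⁻¹ * g).norm < g.norm := by
  have key : ∀ r : FreeGroup (Fin n), Fwd r y → ∃ k, ∀ g : FreeGroup (Fin n),
      StartsWith g y k → (r⁻¹ * g).norm < g.norm := by
    rintro r ⟨s, t, ht, h⟩
    refine ⟨s + t, fun g hg => ?_⟩
    obtain ⟨z, hz, hn, -⟩ := hg.exists_eq_mul
    have h0 := h 0
    rw [zero_add] at h0
    have : r⁻¹ * g = pre y s * z := by rw [hz, ← h0, mul_assoc, inv_mul_cancel_left]
    have h1 := FreeGroup.norm_mul_le (pre y s) z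
    rw [norm_pre] at h1
    rw [this]; omega
  rcases fwd_or_fwd_inv hr h with h | h
  · obtain ⟨k, hk⟩ := key r h
    exact ⟨k, fun g hg => Or.inr (hk g hg)⟩
  · obtain ⟨k, hk⟩ := key _ h
    exact ⟨k, fun g hg => Or.inl (by simpa using hk g hg)⟩

theorem finite_norm_le (L : ℕ) : {g : FreeGroup (Fin n) | g.norm ≤ L}.Finite :=
  (List.finite_length_le (Fin n × Bool) L).preimage FreeGroup.toWord_injective.injOn

/-- There are finitely many letters, so along an ultrafilter each coordinate is eventually constant;
unbounded norm ensures that the coordinate exists. -/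
theorem exists_convTo {ι : Type*} (l : Ultrafilter ι) {u : ι → FreeGroup (Fin n)}
    (h : ∀ k, ∀ᶠ i in l, k ≤ (u i).norm) : ∃ α : Boundary n, ConvTo l u α := by
  have h1 : ∀ j : ℕ, ∃ x, ∀ᶠ i in l, (u i).toWord[j]? = some x := by
    intro j
    obtain ⟨o, ho⟩ := Ultrafilter.eq_pure_of_finite (l.map fun i => (u i).toWord[j]?)
    have h2 : ∀ᶠ i in l, (u i).toWord[j]? = o := by
      have : {o} ∈ l.map fun i => (u i).toWord[j]? := by rw [ho]; exact rfl
      exact this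
    obtain ⟨i, hi, hi'⟩ := ((h (j + 1)).and h2).exists
    cases o with
    | none =>
      rw [List.getElem?_eq_none_iff] at hi'
      simp only [FreeGroup.norm] at hi; omega
    | some x => exact ⟨x, h2⟩
  choose x hx using h1
  refine ⟨⟨x, fun j => ?_⟩, fun k => ?_⟩
  · obtain ⟨i, h1, h2⟩ := ((hx j).and (hx (j + 1))).exists
    obtain ⟨hj, h1⟩ := List.getElem?_eq_some_iff.1 h1
    obtain ⟨hj', h2⟩ := List.getElem?_eq_some_iff.1 h2
    rw [← h1, ← h2]
    exact ne_invLetter_iff.2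
      (List.isChain_iff_getElem.1 (FreeGroup.isReduced_toWord (x := u i)) j hj')
  · have : ∀ᶠ i in l, ∀ j ∈ Finset.range k, (u i).toWord[j]? = some (x j) :=
      (Filter.eventually_all_finset _).2 fun j _ => hx j
    filter_upwards [this] with i hi j hj using hi j (by simpa using hj)

theorem exists_int_switch {p : ℤ → Prop} {M N : ℕ} (hN : ¬ p (-N))
    (h : ∀ m : ℕ, M ≤ m → p m) : ∃ i, ¬ p i ∧ p (i + 1) := by
  by_contra! hc
  have hall : ∀ m : ℕ, ¬ p (-N + m) := by
    intro m
    induction m with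
    | zero => simpa using hN
    | succ m ih => rw [Nat.cast_succ, ← add_assoc]; exact hc _ ih
  have := hall (N + M)
  rw [Nat.cast_add, neg_add_cancel_left] at this
  exact this (h M le_rfl)

/-! ### Lines of the pattern through a vertex -/

section Lines

variable {W : List (FreeGroup (Fin n))}

theorem IsLine.exists_smul_eq (hW : ∀ w ∈ W, w ≠ 1) {ξ η : Boundary n} (h : IsLine W ξ η) :
    ∃ a : FreeGroup (Fin n), a ≠ 1 ∧ ConvTo atTop (fun i : ℕ => a ^ i) ξ ∧
      ConvTo atTop (fun i : ℕ => (a ^ i)⁻¹) η ∧ a • ξ = ξ ∧ a • η = η := by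
  obtain ⟨w, hw, g, h1, h2⟩ := h
  have e : ∀ i : ℕ, (g * w * g⁻¹) ^ i = g * w ^ i * g⁻¹ := fun i => conj_pow
  refine ⟨g * w * g⁻¹, fun hc => hW w hw (by simpa using hc), ?_, ?_, ?_, ?_⟩
  · simp only [e]; exact ConvTo.mul_right h1 g⁻¹
  · have e' : ∀ i : ℕ, ((g * w * g⁻¹) ^ i)⁻¹ = g * w⁻¹ ^ i * g⁻¹ := fun i => by
      rw [e, mul_inv_rev, mul_inv_rev, inv_inv, inv_pow, mul_assoc]
    simp only [e']; exact ConvTo.mul_right h2 g⁻¹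
  · refine ConvTo.unique (l := atTop) (h1.smul (g * w * g⁻¹)) (fun k => ?_)
    filter_upwards [(tendsto_add_atTop_nat 1).eventually (h1 k)] with i hi
    have : g * w * g⁻¹ * (g * w ^ i) = g * w ^ (i + 1) := by rw [pow_succ']; group
    rw [this]; exact hi
  · have h3 : ConvTo atTop (fun i : ℕ => g * w * g⁻¹ * (g * w⁻¹ ^ (i + 1)))
        ((g * w * g⁻¹) • η) := fun k =>
      (tendsto_add_atTop_nat 1).eventually ((h2.smul (g * w * g⁻¹)) k)
    refine h3.unique (fun k => ?_)
    filter_upwards [h2 k] with i hi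
    have : g * w * g⁻¹ * (g * w⁻¹ ^ (i + 1)) = g * w⁻¹ ^ i := by rw [pow_succ']; group
    rw [this]; exact hi

/-- Different first letters mean that the line passes through the identity. Somewhere along `g * w ^
i` the first letter switches to that of `ξ`. A single multiplication by `w` can change the first
letter only if the norm is at most `w.norm`, so the line has one of finitely many base points. -/
theorem finite_isLine (W : List (FreeGroup (Fin n))) :
    {p : Boundary n × Boundary n | IsLine W p.1 p.2 ∧ p.1.1 0 ≠ p.2.1 0}.Finite := by
  set B : FreeGroup (Fin n) → FreeGroup (Fin n) → Set (Boundary n × Boundary n) := fun w g =>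
    {p | ConvergesTo (fun i => g * w ^ i) p.1 ∧ ConvergesTo (fun i => g * w⁻¹ ^ i) p.2} with hB
  have hsub : ∀ w g, (B w g).Finite := fun w g => Set.Subsingleton.finite fun p hp q hq =>
    Prod.ext (ConvTo.unique (l := atTop) hp.1 hq.1) (ConvTo.unique (l := atTop) hp.2 hq.2)
  have hfin : (⋃ w ∈ {w | w ∈ W}, ⋃ g ∈ {g : FreeGroup (Fin n) | g.norm ≤ w.norm}, B w g).Finite :=
    (List.finite_toSet W).biUnion fun w _ => (finite_norm_le _).biUnion fun g _ => hsub w g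
  refine hfin.subset ?_
  rintro ⟨ξ, η⟩ ⟨⟨w, hw, g, h1, h2⟩, hne⟩
  let p : ℤ → Prop := fun i => (g * w ^ i).toWord[0]? = some (ξ.1 0)
  have hex : ∃ i : ℤ, ¬ p i ∧ p (i + 1) := by
    obtain ⟨M, hM⟩ := eventually_atTop.1 (h1 1)
    obtain ⟨N, hN⟩ := eventually_atTop.1 (h2 1)
    refine exists_int_switch (M := M) (N := N) ?_ fun m hm => ?_
    · have : (g * w⁻¹ ^ N).toWord[0]? = some (η.1 0) := hN N le_rfl 0 (by omega)
      simp only [p, zpow_neg, zpow_natCast]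
      rw [inv_pow] at this
      rw [this]
      simpa using hne.symm
    · simpa [p] using hM m hm 0 (by omega)
  obtain ⟨i, hi, hi'⟩ := hex
  have hle : (g * w ^ i).norm ≤ w.norm := by
    by_contra! hlt
    apply hi
    have := toWord_mul_getElem? (g * w ^ i) w 0 (by omega)
    simp only [p] at hi' ⊢
    rw [← this, mul_assoc, ← zpow_add_one]
    exact hi'
  simp only [Set.mem_iUnion]
  refine ⟨w, hw, g * w ^ i, hle, ?_, ?_⟩
  · change ConvTo atTop (fun j : ℕ => g * w ^ i * w ^ j) ξ
    obtain ⟨a, rfl | rfl⟩ := i.eq_nat_or_neg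
    · intro k
      filter_upwards [(tendsto_add_atTop_nat a).eventually (h1 k)] with j hj
      rwa [mul_assoc, zpow_natCast, ← pow_add, add_comm]
    · intro k
      filter_upwards [(tendsto_sub_atTop_nat a).eventually (h1 k), eventually_ge_atTop a] with j hj hja
      have : g * w ^ (-(a : ℤ)) * w ^ j = g * w ^ (j - a) := by
        rw [mul_assoc, ← zpow_natCast, ← zpow_natCast, ← zpow_add, Nat.cast_sub hja]; congr 2; ring
      rwa [this]
  · change ConvTo atTop (fun j : ℕ => g * w ^ i * w⁻¹ ^ j) η
    obtain ⟨a, rfl | rfl⟩ := i.eq_nat_or_neg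
    · intro k
      filter_upwards [(tendsto_sub_atTop_nat a).eventually (h2 k), eventually_ge_atTop a] with j hj hja
      have : g * w ^ (a : ℤ) * w⁻¹ ^ j = g * w⁻¹ ^ (j - a) := by
        rw [mul_assoc, inv_pow, inv_pow, ← zpow_natCast w j, ← zpow_natCast w (j - a), ← zpow_neg,
          ← zpow_neg, ← zpow_add, Nat.cast_sub hja]; congr 2; ring
      rwa [this]
    · intro k
      filter_upwards [(tendsto_add_atTop_nat a).eventually (h2 k)] with j hj
      rwa [mul_assoc, zpow_neg, zpow_natCast, ← inv_pow, ← pow_add, add_comm]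

end Lines

end LinePattern

/-! ### The decomposition space is compact, Hausdorff and locally connected -/

namespace LinePattern

section GeneralTopology

theorem t2Space_of_isClosedMap {X Y : Type*} [TopologicalSpace X] [TopologicalSpace Y]
    [CompactSpace X] [T2Space X] {f : X → Y} (hf : IsClosedMap f) (hc : Continuous f)
    (hs : Function.Surjective f) : T2Space Y := by
  have h1 : ∀ y, IsClosed ({y} : Set Y) := fun y => by
    obtain ⟨x, rfl⟩ := hs y
    simpa using hf {x} isClosed_singleton
  refine ⟨fun x y hxy => ?_⟩
  obtain ⟨U, V, hU, hV, hxU, hyV, hUV⟩ := SeparatedNhds.of_isCompact_isCompact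
    ((h1 x).preimage hc).isCompact ((h1 y).preimage hc).isCompact
    (Disjoint.preimage f (by simpa using hxy))
  refine ⟨(f '' Uᶜ)ᶜ, (f '' Vᶜ)ᶜ, (hf _ hU.isClosed_compl).isOpen_compl,
    (hf _ hV.isClosed_compl).isOpen_compl, ?_, ?_, ?_⟩
  · rintro ⟨z, hz, rfl⟩; exact hz (hxU rfl)
  · rintro ⟨z, hz, rfl⟩; exact hz (hyV rfl)
  · rw [Set.disjoint_left]
    intro z hz hz'
    obtain ⟨w, rfl⟩ := hs z
    have h2 : w ∈ U := by by_contra hw; exact hz ⟨w, hw, rfl⟩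
    have h3 : w ∈ V := by by_contra hw; exact hz' ⟨w, hw, rfl⟩
    exact Set.disjoint_left.1 hUV h2 h3

variable {X : Type*} [TopologicalSpace X] [CompactSpace X] [T2Space X] [ConnectedSpace X]

/-- A component of `A` missing the finite set `A ∩ B` could be split off from it by a clopen subset
of `A`, which would then be clopen in the connected space `X`. So the components of the points of `A
∩ B` exhaust `A`. -/
theorem exists_finite_preconnected_cover {A B : Set X} (hA : IsClosed A) (hB : IsClosed B)
    (hAB : A ∪ B = Set.univ) (hfin : (A ∩ B).Finite) :
    ∃ 𝒦 : Set (Set X), 𝒦.Finite ∧ (∀ K ∈ 𝒦, IsClosed K ∧ IsPreconnected K) ∧ ⋃₀ 𝒦 = A := by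
  by_cases hne : (A ∩ B).Nonempty
  swap
  · have hd : A ∩ B = ∅ := Set.not_nonempty_iff_eq_empty.1 hne
    have hAc : Aᶜ = B := (IsCompl.of_eq hd hAB).compl_eq
    have : IsClopen A := ⟨hA, by rw [← isClosed_compl_iff, hAc]; exact hB⟩
    rcases isClopen_iff.1 this with h | h
    · exact ⟨∅, Set.finite_empty, by simp, by simp [h]⟩
    · refine ⟨{A}, Set.finite_singleton _, ?_, by simp⟩
      rintro K rfl
      exact ⟨hA, h ▸ isPreconnected_univ⟩
  have : CompactSpace A := isCompact_iff_compactSpace.1 hA.isCompact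
  refine ⟨(fun z => closure (connectedComponentIn A z)) '' (A ∩ B), hfin.image _, ?_, ?_⟩
  · rintro _ ⟨z, -, rfl⟩
    exact ⟨isClosed_closure, isPreconnected_connectedComponentIn.closure⟩
  apply Set.Subset.antisymm
  · rintro x ⟨_, ⟨z, -, rfl⟩, hx⟩
    exact (closure_minimal (connectedComponentIn_subset A z) hA) hx
  intro x hx
  suffices h : ∃ z ∈ A ∩ B, z ∈ connectedComponentIn A x by
    obtain ⟨z, hz, hzx⟩ := h
    refine ⟨_, ⟨z, hz, rfl⟩, subset_closure ?_⟩
    rw [← connectedComponentIn_eq hzx]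
    exact mem_connectedComponentIn hx
  by_contra! hc
  have h1 : ∀ z ∈ A ∩ B, ∃ s : Set A, IsClopen s ∧ ⟨x, hx⟩ ∈ s ∧ ∀ h : z ∈ A, ⟨z, h⟩ ∉ s := by
    intro z hz
    have h2 : (⟨z, hz.1⟩ : A) ∉ connectedComponent (⟨x, hx⟩ : A) := fun h => hc z hz (by
      rw [connectedComponentIn_eq_image hx]; exact ⟨_, h, rfl⟩)
    rw [connectedComponent_eq_iInter_isClopen, Set.mem_iInter] at h2
    push Not at h2
    obtain ⟨⟨s, hs, hxs⟩, hzs⟩ := h2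
    exact ⟨s, hs, hxs, fun _ => hzs⟩
  choose! s hs hxs hzs using h1
  set P : Set A := ⋂ z ∈ A ∩ B, s z with hP
  have hPc : IsClopen P := hfin.isClopen_biInter fun z hz => hs z hz
  have hcl : ∀ Q : Set A, IsClosed Q → IsClosed (Subtype.val '' Q) := fun Q hQ =>
    hA.isClosedEmbedding_subtypeVal.isClosedMap Q hQ
  have hcompl : (Subtype.val '' P)ᶜ = Subtype.val '' Pᶜ ∪ B := by
    ext y
    constructor
    · intro hy
      by_cases hyA : y ∈ A
      · exact Or.inl ⟨⟨y, hyA⟩, fun h => hy ⟨_, h, rfl⟩, rfl⟩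
      · exact Or.inr ((hAB.ge (Set.mem_univ y)).resolve_left hyA)
    · rintro (⟨z, hz, rfl⟩ | hy)
      · rintro ⟨w, hw, e⟩
        exact hz (Subtype.ext e ▸ hw)
      · rintro ⟨w, hw, rfl⟩
        exact hzs w.1 ⟨w.2, hy⟩ w.2 (Set.mem_iInter₂.1 hw _ ⟨w.2, hy⟩)
  have hclopen : IsClopen (Subtype.val '' P) := by
    refine ⟨hcl P hPc.1, ?_⟩
    rw [← isClosed_compl_iff, hcompl]
    exact (hcl _ hPc.compl.1).union hB
  have huniv := hclopen.eq_univ ⟨x, ⟨x, hx⟩, Set.mem_iInter₂.2 fun z hz => hxs z hz, rfl⟩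
  obtain ⟨z, hz⟩ := hne
  obtain ⟨w, hw, rfl⟩ := huniv.ge (Set.mem_univ z)
  exact hzs w.1 hz w.2 (Set.mem_iInter₂.1 hw _ hz)

end GeneralTopology

variable {n : ℕ}

instance : CompactSpace (Boundary n) := by
  have : IsClosed {ξ : ℕ → Fin n × Bool | ∀ i, ξ (i + 1) ≠ invLetter (ξ i)} := by
    simp only [Set.ofPred_forall]
    refine isClosed_iInter fun i => ?_
    have hc : Continuous fun ξ : ℕ → Fin n × Bool => (ξ i, ξ (i + 1)) := by fun_prop
    exact (isClosed_discrete
      {p : (Fin n × Bool) × (Fin n × Bool) | p.2 ≠ invLetter p.1}).preimage hc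
  exact isCompact_iff_compactSpace.1 this.isCompact

instance : T2Space (Boundary n) :=
  inferInstanceAs (T2Space {ξ : ℕ → Fin n × Bool // ∀ i, ξ (i + 1) ≠ invLetter (ξ i)})

theorem Boundary.continuous_coord (j : ℕ) : Continuous fun ξ : Boundary n => ξ.1 j :=
  (continuous_apply j).comp continuous_subtype_val

/-- The boundary points whose first `k` letters agree with those of `ξ`. -/
def cyl (ξ : Boundary n) (k : ℕ) : Set (Boundary n) := {η | ∀ j < k, η.1 j = ξ.1 j}

theorem mem_cyl_self (ξ : Boundary n) (k : ℕ) : ξ ∈ cyl ξ k := fun _ _ => rfl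

theorem isClopen_cyl (ξ : Boundary n) (k : ℕ) : IsClopen (cyl ξ k) := by
  have : cyl ξ k = ⋂ j ∈ Finset.range k, (fun η : Boundary n => η.1 j) ⁻¹' {ξ.1 j} := by
    ext η; simp [cyl]
  rw [this]
  exact isClopen_biInter_finset fun j _ =>
    (isClopen_discrete _).preimage (Boundary.continuous_coord j)

theorem cyl_mem_nhds (ξ : Boundary n) (k : ℕ) : cyl ξ k ∈ 𝓝 ξ :=
  (isClopen_cyl ξ k).2.mem_nhds (mem_cyl_self ξ k)

theorem exists_cyl_subset {ξ : Boundary n} {U : Set (Boundary n)} (hU : U ∈ 𝓝 ξ) :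
    ∃ k, cyl ξ k ⊆ U := by
  obtain ⟨V, hVU, hV, hξ⟩ := mem_nhds_iff.1 hU
  obtain ⟨V', hV', rfl⟩ := isOpen_induced_iff.1 hV
  obtain ⟨I, u, hu, hI⟩ := isOpen_pi_iff.1 hV' ξ.1 hξ
  refine ⟨I.sup id + 1, fun η hη => hVU (hI fun j hj => ?_)⟩
  rw [hη j (Nat.lt_succ_of_le (Finset.le_sup (f := id) hj))]
  exact (hu j hj).2

theorem tendsto_boundary_iff {ι : Type*} {l : Filter ι} {u : ι → Boundary n} {α : Boundary n} :
    Tendsto u l (𝓝 α) ↔ ∀ k, ∀ᶠ i in l, ∀ j < k, (u i).1 j = α.1 j := by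
  constructor
  · intro h k
    exact h (cyl_mem_nhds α k)
  · intro h U hU
    obtain ⟨k, hk⟩ := exists_cyl_subset hU
    exact (h k).mono fun i hi => hk hi

theorem ConvTo.tendsto_smul {ι : Type*} {l : Filter ι} {u : ι → FreeGroup (Fin n)}
    {α β y : Boundary n} (hα : ConvTo l u α) (hβ : ConvTo l (fun i => (u i)⁻¹) β) (hy : y ≠ β) :
    Tendsto (fun i => u i • y) l (𝓝 α) :=
  tendsto_boundary_iff.2 fun k => hα.eventually_smul hβ hy k

section Quotient

variable {W : List (FreeGroup (Fin n))}

variable (W) in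
/-- The projection of the boundary to the decomposition space. -/
def proj (ξ : Boundary n) : DecompSpace W := Quot.mk _ ξ

theorem proj_surjective : Function.Surjective (proj W) := Quot.mk_surjective

theorem isQuotientMap_proj : IsQuotientMap (proj W) := isQuotientMap_quot_mk

theorem continuous_proj : Continuous (proj W) := isQuotientMap_proj.continuous

theorem proj_smul (g : FreeGroup (Fin n)) (ξ : Boundary n) : proj W (g • ξ) = g • proj W ξ := rfl

theorem proj_smul_eq_iff (g : FreeGroup (Fin n)) (ξ η : Boundary n) :
    proj W (g • ξ) = proj W (g • η) ↔ proj W ξ = proj W η := by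
  rw [proj_smul, proj_smul, smul_left_cancel_iff]

/-- The line relation needs no transitive closure: two lines with a common end have axes with a
common nontrivial power, which fixes all their ends, and there are at most two of these. -/
theorem proj_eq_iff (hW : ∀ w ∈ W, w ≠ 1) {ξ η : Boundary n} :
    proj W ξ = proj W η ↔ ξ = η ∨ IsLine W ξ η ∨ IsLine W η ξ := by
  have hfix : ∀ {x y : Boundary n}, IsLine W x y ∨ IsLine W y x →
      ∃ a : FreeGroup (Fin n), a ≠ 1 ∧ a • x = x ∧ a • y = y := by
    rintro x y (h | h)
    · obtain ⟨a, ha, -, -, h1, h2⟩ := h.exists_smul_eq hW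
      exact ⟨a, ha, h1, h2⟩
    · obtain ⟨a, ha, -, -, h1, h2⟩ := h.exists_smul_eq hW
      exact ⟨a, ha, h2, h1⟩
  constructor
  · intro h
    have h' := Quot.eqvGen_exact h
    clear h
    induction h' with
    | rel x y h => exact Or.inr (Or.inl h)
    | refl x => exact Or.inl rfl
    | symm x y _ ih => tauto
    | trans x y z _ _ ih1 ih2 =>
      rcases ih1 with rfl | ih1
      · exact ih2
      rcases ih2 with rfl | ih2
      · exact Or.inr ih1
      obtain ⟨a, ha, hax, hay⟩ := hfix ih1
      obtain ⟨b, hb, hby, hbz⟩ := hfix ih2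
      obtain ⟨c, hc, hcc⟩ := exists_common_power ha hb hay hby
      rcases eq_or_eq_or_eq_of_smul_eq hc ((hcc x).1 hax) ((hcc y).1 hay) ((hcc z).2 hbz) with
        rfl | rfl | rfl
      · exact Or.inr ih2
      · exact Or.inl rfl
      · exact Or.inr ih1
  · rintro (rfl | h | h)
    · rfl
    · exact Quot.sound h
    · exact (Quot.sound h).symm

theorem exists_axis (hW : ∀ w ∈ W, w ≠ 1) {ξ η : Boundary n} (h : proj W ξ = proj W η)
    (hne : ξ ≠ η) : ∃ a : FreeGroup (Fin n), a ≠ 1 ∧ ConvTo atTop (fun i : ℕ => a ^ i) ξ ∧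
      ConvTo atTop (fun i : ℕ => (a ^ i)⁻¹) η ∧ a • ξ = ξ ∧ a • η = η := by
  rcases (proj_eq_iff hW).1 h with h | h | h
  · exact absurd h hne
  · exact h.exists_smul_eq hW
  · obtain ⟨a, ha, h1, h2, h3, h4⟩ := h.exists_smul_eq hW
    refine ⟨a⁻¹, inv_ne_one.2 ha, ?_, ?_, ?_, ?_⟩
    · simpa only [inv_pow] using h2
    · simpa only [inv_pow, inv_inv] using h1
    · exact inv_smul_eq_iff.2 h4.symm
    · exact inv_smul_eq_iff.2 h3.symm

theorem eq_of_proj_eq (hW : ∀ w ∈ W, w ≠ 1) {x y z : Boundary n} (h1 : proj W x = proj W y)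
    (h2 : proj W x = proj W z) : x = y ∨ x = z ∨ y = z := by
  by_contra! hc
  obtain ⟨a, ha, -, -, hax, hay⟩ := exists_axis hW h1 hc.1
  obtain ⟨b, hb, -, -, hbx, hbz⟩ := exists_axis hW h2 hc.2.1
  obtain ⟨c, hcne, hcc⟩ := exists_common_power ha hb hax hbx
  have := eq_or_eq_or_eq_of_smul_eq hcne ((hcc x).1 hax) ((hcc y).1 hay) ((hcc z).2 hbz)
  tauto

theorem finite_fiber (hW : ∀ w ∈ W, w ≠ 1) (x : DecompSpace W) : (proj W ⁻¹' {x}).Finite := by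
  classical
  by_contra hinf
  obtain ⟨t, ht, hcard⟩ := Set.Infinite.exists_subset_card_eq hinf 3
  obtain ⟨a, b, c, hab, hac, hbc, rfl⟩ := Finset.card_eq_three.1 hcard
  have ha : proj W a = x := ht (by simp)
  have hb : proj W b = x := ht (by simp)
  have hc : proj W c = x := ht (by simp)
  have := eq_of_proj_eq hW (ha.trans hb.symm) (ha.trans hc.symm)
  tauto

theorem finite_proj_eq (hW : ∀ w ∈ W, w ≠ 1) :
    {p : Boundary n × Boundary n | proj W p.1 = proj W p.2 ∧ p.1.1 0 ≠ p.2.1 0}.Finite := by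
  refine ((finite_isLine W).union ((finite_isLine W).preimage
    (Prod.swap_injective (α := Boundary n) (β := Boundary n)).injOn)).subset ?_
  rintro ⟨ξ, η⟩ ⟨h, hne⟩
  rcases (proj_eq_iff hW).1 h with h | h | h
  · exact absurd (by rw [h]) hne
  · exact Or.inl ⟨h, hne⟩
  · exact Or.inr ⟨h, hne.symm⟩

/-- Such a line passes through the vertex `pre ξ i`, `i < k`, at which its outer end branches off
from `ξ`. Moving that vertex to the identity reduces the claim to lines through the identity. -/
theorem finite_proj_eq_cyl (hW : ∀ w ∈ W, w ≠ 1) (ξ : Boundary n) (k : ℕ) :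
    {p : Boundary n × Boundary n | proj W p.1 = proj W p.2 ∧ p.1 ∈ cyl ξ k ∧
      p.2 ∉ cyl ξ k}.Finite := by
  have hfin : (⋃ i ∈ {i | i < k}, (fun p : Boundary n × Boundary n => pre ξ i • p) ''
      {p : Boundary n × Boundary n | proj W p.1 = proj W p.2 ∧ p.1.1 0 ≠ p.2.1 0}).Finite :=
    (Set.finite_lt_nat k).biUnion fun i _ => (finite_proj_eq hW).image _
  refine hfin.subset ?_
  rintro ⟨y, z⟩ ⟨h, hy, hz⟩
  obtain ⟨j, hj, hjz⟩ : ∃ j < k, z.1 j ≠ ξ.1 j := by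
    by_contra! hc; exact hz hc
  obtain ⟨i, hi, hlt⟩ := exists_first_ne (y := z) (z := ξ) (fun e => hjz (by rw [e]))
  have hik : i < k := by
    by_contra hik
    exact hjz (hlt j (by omega))
  have hy0 : ((pre ξ i)⁻¹ • y).1 0 = ξ.1 i := by
    rw [← pre_congr (y := y) fun j hj => hy j (by omega), pre_inv_smul]
    exact hy i hik
  have hz0 : ((pre ξ i)⁻¹ • z).1 0 = z.1 i := by
    rw [← pre_congr (y := z) hlt, pre_inv_smul]; rfl
  simp only [Set.mem_iUnion]
  refine ⟨i, hik, (pre ξ i)⁻¹ • (y, z), ⟨(proj_smul_eq_iff _ _ _).2 h, ?_⟩, smul_inv_smul _ _⟩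
  change ((pre ξ i)⁻¹ • y).1 0 ≠ ((pre ξ i)⁻¹ • z).1 0
  rw [hy0, hz0]
  exact hi.symm

/-- Around a point not identified with a point of `K`, a small cylinder misses `K`, and only
finitely many of its points are identified with points outside. Removing those that are identified
with points of `K` leaves a neighbourhood. -/
theorem isClosedMap_proj (hW : ∀ w ∈ W, w ≠ 1) : IsClosedMap (proj W) := by
  intro K hK
  rw [← isQuotientMap_proj.isClosed_preimage, ← isOpen_compl_iff, isOpen_iff_mem_nhds]
  intro η hη
  have hηK : η ∉ K := fun h => hη ⟨η, h, rfl⟩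
  obtain ⟨k, hk⟩ := exists_cyl_subset (hK.isOpen_compl.mem_nhds hηK)
  set T := Prod.fst '' {p : Boundary n × Boundary n | (proj W p.1 = proj W p.2 ∧ p.1 ∈ cyl η k ∧
      p.2 ∉ cyl η k) ∧ p.2 ∈ K}
  have hT : T.Finite := ((finite_proj_eq_cyl hW η k).subset fun p hp => hp.1).image _
  have hηT : η ∉ T := by
    rintro ⟨p, ⟨⟨h, -, -⟩, hp⟩, rfl⟩
    exact hη ⟨p.2, hp, h.symm⟩
  filter_upwards [cyl_mem_nhds η k, hT.isClosed.isOpen_compl.mem_nhds hηT] with ζ hζ hζT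
  rintro ⟨θ, hθ, e⟩
  exact hζT ⟨(ζ, θ), ⟨⟨e.symm, hζ, fun h => hk h hθ⟩, hθ⟩, rfl⟩

instance : CompactSpace (DecompSpace W) :=
  inferInstanceAs (CompactSpace (Quot (IsLine W)))

theorem t2Space_decompSpace (hW : ∀ w ∈ W, w ≠ 1) : T2Space (DecompSpace W) :=
  t2Space_of_isClosedMap (isClosedMap_proj hW) continuous_proj proj_surjective

/-- The images of a cylinder and of its complement meet in finitely many points, so the image of a
cylinder is a finite union of closed connected pieces. Cover the space by finitely many such images
that lie in `U` or miss `x`. The pieces through `x` form a connected neighbourhood in `U`, because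
the union of the others is closed. -/
theorem locallyConnectedSpace_decompSpace (hW : ∀ w ∈ W, w ≠ 1)
    [ConnectedSpace (DecompSpace W)] : LocallyConnectedSpace (DecompSpace W) := by
  have := t2Space_decompSpace hW
  have hcyl : ∀ (ξ : Boundary n) (k : ℕ), ∃ 𝒦 : Set (Set (DecompSpace W)), 𝒦.Finite ∧
      (∀ K ∈ 𝒦, IsClosed K ∧ IsPreconnected K) ∧ ⋃₀ 𝒦 = proj W '' cyl ξ k := by
    intro ξ k
    refine exists_finite_preconnected_cover (B := proj W '' (cyl ξ k)ᶜ)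
      (isClosedMap_proj hW _ (isClopen_cyl ξ k).1)
      (isClosedMap_proj hW _ (isClopen_cyl ξ k).compl.1) ?_ ?_
    · rw [← Set.image_union, Set.union_compl_self, Set.image_univ, proj_surjective.range_eq]
    · refine ((finite_proj_eq_cyl hW ξ k).image fun p => proj W p.1).subset ?_
      rintro _ ⟨⟨y, hy, rfl⟩, ⟨z, hz, e⟩⟩
      exact ⟨(y, z), ⟨e.symm, hy, hz⟩, rfl⟩
  rw [locallyConnectedSpace_iff_connected_subsets]
  intro x U hU
  have h1 : ∀ ξ : Boundary n, ∃ k, proj W '' cyl ξ k ⊆ U ∨ x ∉ proj W '' cyl ξ k := by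
    intro ξ
    by_cases hξ : proj W ξ = x
    · obtain ⟨k, hk⟩ := exists_cyl_subset (continuous_proj.continuousAt.preimage_mem_nhds
        (by rw [hξ]; exact hU))
      exact ⟨k, Or.inl (Set.image_subset_iff.2 hk)⟩
    · obtain ⟨k, hk⟩ := exists_cyl_subset (continuous_proj.continuousAt.preimage_mem_nhds
        (isOpen_compl_singleton.mem_nhds hξ))
      refine ⟨k, Or.inr ?_⟩
      rintro ⟨y, hy, e⟩
      exact hk hy e
  choose k hk using h1
  choose 𝒦 hfin hK hcov using fun ξ => hcyl ξ (k ξ)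
  obtain ⟨t, ht⟩ := isCompact_univ.elim_nhds_subcover (fun ξ => cyl ξ (k ξ))
    (fun ξ _ => cyl_mem_nhds ξ _)
  set 𝒞 : Set (Set (DecompSpace W)) := ⋃ ξ ∈ t, 𝒦 ξ
  have h𝒞 : 𝒞.Finite := t.finite_toSet.biUnion fun ξ _ => hfin ξ
  have hC : ∀ K ∈ 𝒞, IsClosed K ∧ IsPreconnected K ∧ (K ⊆ U ∨ x ∉ K) := by
    intro K hKC
    obtain ⟨ξ, -, hKξ⟩ := Set.mem_iUnion₂.1 hKC
    have hsub : K ⊆ proj W '' cyl ξ (k ξ) := by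
      rw [← hcov ξ]; exact Set.subset_sUnion_of_mem hKξ
    exact ⟨(hK ξ K hKξ).1, (hK ξ K hKξ).2,
      (hk ξ).imp (fun h => hsub.trans h) (fun h h' => h (hsub h'))⟩
  refine ⟨⋃₀ {K ∈ 𝒞 | x ∈ K}, ?_, isPreconnected_sUnion x _ (fun K hK => hK.2)
    (fun K hK => (hC K hK.1).2.1), Set.sUnion_subset fun K hK =>
      (hC K hK.1).2.2.resolve_right (not_not.2 hK.2)⟩
  have hcl : IsClosed (⋃₀ {K ∈ 𝒞 | x ∉ K}) :=
    by
    rw [Set.sUnion_eq_biUnion]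
    exact (h𝒞.subset (Set.sep_subset _ _)).isClosed_biUnion fun K hK => (hC K hK.1).1
  refine mem_of_superset (hcl.isOpen_compl.mem_nhds ?_) ?_
  · rintro ⟨K, hK, hx⟩
    exact hK.2 hx
  · intro y hy
    obtain ⟨η, rfl⟩ := proj_surjective y
    obtain ⟨ξ, hξ, hη⟩ := Set.mem_iUnion₂.1 (ht.2 (Set.mem_univ η))
    have hmem : proj W η ∈ ⋃₀ 𝒦 ξ := by rw [hcov]; exact ⟨η, hη, rfl⟩
    obtain ⟨K, hKξ, hηK⟩ := hmem
    have hKC : K ∈ 𝒞 := Set.mem_iUnion₂.2 ⟨ξ, hξ, hKξ⟩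
    by_cases hx : x ∈ K
    · exact ⟨K, ⟨hKC, hx⟩, hηK⟩
    · exact absurd ⟨K, ⟨hKC, hx⟩, hηK⟩ hy

end Quotient

end LinePattern

/-! ### Separations, crossing and nesting of cut pairs -/

namespace LinePattern

section Separations

variable {X : Type} [TopologicalSpace X]

/-- `A` and `B` form a separation of the complement of `S`. -/
structure Separation (S A B : Set X) : Prop where
  openA : IsOpen A
  openB : IsOpen B
  nonemptyA : A.Nonempty
  nonemptyB : B.Nonempty
  disj : ∀ t, t ∈ A → t ∉ B
  cover : ∀ t, t ∉ S ↔ t ∈ A ∨ t ∈ B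

theorem Separation.symm {S A B : Set X} (h : Separation S A B) : Separation S B A :=
  ⟨h.openB, h.openA, h.nonemptyB, h.nonemptyA, fun t hB hA => h.disj t hA hB,
    fun t => (h.cover t).trans or_comm⟩

theorem Separation.subset_or_subset {S A B K : Set X} (h : Separation S A B)
    (hK : IsPreconnected K) (hKS : ∀ t ∈ K, t ∉ S) : K ⊆ A ∨ K ⊆ B :=
  IsPreconnected.subset_or_subset h.openA h.openB (Set.disjoint_left.2 h.disj)
    (fun t ht => (h.cover t).1 (hKS t ht)) hK

theorem Separation.subset_of_mem {S A B K : Set X} (h : Separation S A B)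
    (hK : IsPreconnected K) (hKS : ∀ t ∈ K, t ∉ S) {x : X} (hx : x ∈ K) (hxA : x ∈ A) : K ⊆ A :=
  (h.subset_or_subset hK hKS).resolve_right fun h' => h.disj x hxA (h' hx)

theorem Separation.isCutSet {S A B : Set X} (h : Separation S A B) : IsCutSet S := by
  intro hc
  rcases h.subset_or_subset hc (fun t ht => ht) with h' | h'
  · obtain ⟨b, hb⟩ := h.nonemptyB
    exact h.disj b (h' ((h.cover b).2 (Or.inr hb))) hb
  · obtain ⟨b, hb⟩ := h.nonemptyA
    exact h.disj b hb (h' ((h.cover b).2 (Or.inl hb)))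

theorem IsCutSet.exists_separation {S : Set X} (h : IsCutSet S) (hS : IsClosed S) :
    ∃ A B, Separation S A B := by
  rw [IsCutSet, IsPreconnected] at h
  push Not at h
  obtain ⟨u, v, hu, hv, huv, hnu, hnv, he⟩ := h
  refine ⟨Sᶜ ∩ u, Sᶜ ∩ v, hS.isOpen_compl.inter hu, hS.isOpen_compl.inter hv, hnu, hnv, ?_, ?_⟩
  · rintro t ⟨h1, h2⟩ ⟨-, h3⟩
    exact Set.notMem_empty t (he ▸ ⟨h1, h2, h3⟩)
  · intro t
    constructor
    · intro ht
      rcases huv ht with h | h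
      exacts [Or.inl ⟨ht, h⟩, Or.inr ⟨ht, h⟩]
    · rintro (h | h) <;> exact h.1

theorem Separation.connectedComponentIn_ne {S A B : Set X} (h : Separation S A B) {x y : X}
    (hx : x ∈ A) (hy : y ∈ B) : connectedComponentIn Sᶜ x ≠ connectedComponentIn Sᶜ y := by
  intro e
  have hxS := (h.cover x).2 (Or.inl hx)
  have hyS := (h.cover y).2 (Or.inr hy)
  have h1 := h.subset_of_mem isPreconnected_connectedComponentIn
    (fun t ht => connectedComponentIn_subset _ _ ht) (mem_connectedComponentIn hxS) hx
  exact h.disj y (h1 (e ▸ mem_connectedComponentIn hyS)) hy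

theorem exists_separation_of_connectedComponentIn_ne [LocallyConnectedSpace X] {S : Set X}
    (hS : IsClosed S) {x y : X} (hx : x ∉ S) (hy : y ∉ S)
    (h : connectedComponentIn Sᶜ x ≠ connectedComponentIn Sᶜ y) :
    ∃ A B, Separation S A B ∧ A = connectedComponentIn Sᶜ x ∧ y ∈ B := by
  have hyx : y ∉ connectedComponentIn Sᶜ x := fun h' => h (connectedComponentIn_eq h')
  refine ⟨_, Sᶜ \ connectedComponentIn Sᶜ x, ⟨hS.isOpen_compl.connectedComponentIn, ?_,
    ⟨x, mem_connectedComponentIn hx⟩, ⟨y, hy, hyx⟩, fun t h1 h2 => h2.2 h1, fun t => ?_⟩, rfl,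
    hy, hyx⟩
  · rw [isOpen_iff_mem_nhds]
    rintro z ⟨hz, hzx⟩
    refine mem_of_superset (hS.isOpen_compl.connectedComponentIn.mem_nhds
      (mem_connectedComponentIn hz)) fun t ht => ⟨connectedComponentIn_subset _ _ ht, fun h' => ?_⟩
    apply hzx
    rw [connectedComponentIn_eq h', ← connectedComponentIn_eq ht]
    exact mem_connectedComponentIn hz
  · constructor
    · intro ht
      by_cases h' : t ∈ connectedComponentIn Sᶜ x
      exacts [Or.inl h', Or.inr ⟨ht, h'⟩]
    · rintro (h' | h')
      exacts [connectedComponentIn_subset _ _ h', h'.1]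

/-- The usual way of emptying a region: an open `U` whose frontier lies in a set `T` that does not
separate has no points off `T`. -/
theorem mem_of_isPreconnected_compl {T U V : Set X} (hT : IsPreconnected Tᶜ) (hU : IsOpen U)
    (hV : IsOpen V) (hUV : ∀ t, t ∈ U → t ∉ V) (hcov : ∀ t, t ∉ T → t ∈ U ∨ t ∈ V)
    {v : X} (hv : v ∈ V) (hvT : v ∉ T) {t : X} (ht : t ∈ U) : t ∈ T := by
  by_contra htT
  rcases IsPreconnected.subset_or_subset hU hV (Set.disjoint_left.2 hUV) (fun t ht => hcov t ht)
    hT with h | h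
  · exact hUV v (h hvT) hv
  · exact hUV t ht (h htT)

theorem IsCutPair.isCutSet {S : Set X} (h : IsCutPair S) : IsCutSet S := by
  obtain ⟨x, y, -, rfl, h, -, -⟩ := h
  exact h

theorem IsCutPair.isPreconnected_compl {S : Set X} (h : IsCutPair S) {a : X} (ha : a ∈ S) :
    IsPreconnected ({a}ᶜ : Set X) := by
  obtain ⟨x, y, -, rfl, -, hx, hy⟩ := h
  rcases ha with rfl | rfl
  exacts [not_not.1 hx, not_not.1 hy]

theorem IsCutPair.eq_pair {S : Set X} (h : IsCutPair S) {a b : X} (ha : a ∈ S) (hb : b ∈ S)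
    (hab : a ≠ b) : S = {a, b} := by
  obtain ⟨x, y, -, rfl, -, -, -⟩ := h
  rcases ha with rfl | rfl <;> rcases hb with rfl | rfl
  · exact absurd rfl hab
  · rfl
  · exact Set.pair_comm _ _
  · exact absurd rfl hab

theorem IsCutPair.exists_notMem {S S' : Set X} (h : IsCutPair S) (h' : IsCutPair S')
    (hne : S ≠ S') : ∃ a ∈ S, a ∉ S' := by
  by_contra! hc
  obtain ⟨x, y, hxy, rfl, -, -, -⟩ := h
  exact hne (h'.eq_pair (hc x (by simp)) (hc y (by simp)) hxy).symm

theorem IsCutPair.isPreconnected_compl_inter [PreconnectedSpace X] {S S' : Set X}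
    (h : IsCutPair S) (h' : IsCutPair S') (hne : S ≠ S') : IsPreconnected (S ∩ S')ᶜ := by
  rcases Set.eq_empty_or_nonempty (S ∩ S') with he | ⟨a, ha⟩
  · rw [he, Set.compl_empty]; exact isPreconnected_univ
  · have : S ∩ S' = {a} := by
      obtain ⟨b, hb, hb'⟩ := h.exists_notMem h' hne
      rw [h.eq_pair ha.1 hb (fun e => hb' (e ▸ ha.2))]
      ext t
      constructor
      · rintro ⟨rfl | rfl, ht'⟩
        exacts [rfl, absurd ht' hb']
      · rintro rfl
        exact ⟨Or.inl rfl, ha.2⟩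
    rw [this]
    exact h.isPreconnected_compl ha.1

theorem Separation.diff_subset_of_not_crosses {S A B R : Set X} (h : Separation S A B)
    (hR : IsCutPair R) (hc : ¬ Crosses R S) : R \ S ⊆ A ∨ R \ S ⊆ B := by
  by_contra! h'
  obtain ⟨h1, h2⟩ := h'
  obtain ⟨x, hx, hxA⟩ := Set.not_subset.1 h1
  obtain ⟨y, hy, hyB⟩ := Set.not_subset.1 h2
  have hxB := ((h.cover x).1 hx.2).resolve_left hxA
  have hyA := ((h.cover y).1 hy.2).resolve_right hyB
  exact hc ⟨y, x, hR.eq_pair hy.1 hx.1 (fun e => hxA (e ▸ hyA)), hy.2, hx.2,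
    h.connectedComponentIn_ne hyA hxB⟩

/-- The separation `(A, B)` of the complement of `S` precedes the separation `(A', B')` of the
complement of `S'`. -/
structure Precedes (S A B S' A' B' : Set X) : Prop where
  diff_subset : ∀ t ∈ S', t ∉ S → t ∈ A
  diff_subset' : ∀ t ∈ S, t ∉ S' → t ∈ B'
  subsetB : B ⊆ B'
  subsetA : A' ⊆ A

/-- Of the four corners of two separations, the one away from both `S' \ S` and `S \ S'` is bounded
by `S ∩ S'` alone. That set is empty or a single point that is no cut point, so the corner is empty.
As `B ∩ B'` is not empty, the empty corner is `B ∩ A'`, which gives the nesting. -/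
theorem Separation.precedes [PreconnectedSpace X] {S A B S' A' B' : Set X}
    (h : Separation S A B) (h' : Separation S' A' B') (hS : IsCutPair S) (hS' : IsCutPair S')
    (hne : S ≠ S') (hc : ¬ Crosses S S') (hA : S' \ S ⊆ A) (hBB : (B ∩ B').Nonempty) :
    Precedes S A B S' A' B' := by
  have hpre := hS.isPreconnected_compl_inter hS' hne
  obtain ⟨s, hs, hs'⟩ := hS.exists_notMem hS' hne
  have hBS : ∀ t, t ∈ B → t ∉ S := fun t ht => (h.cover t).2 (Or.inr ht)
  have hBS' : ∀ t, t ∈ B → t ∉ S' := fun t ht ht' => h.disj t (hA ⟨ht', hBS t ht⟩) ht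
  have key : ∀ {C C' : Set X}, Separation S' C C' → S \ S' ⊆ C → ∀ t, t ∈ B → t ∉ C' := by
    intro C C' hCC hC t ht htC'
    have := mem_of_isPreconnected_compl (U := B ∩ C') (V := A ∪ C) (v := s) hpre
      (h.openB.inter hCC.openB) (h.openA.union hCC.openA) ?_ ?_ (Or.inr (hC ⟨hs, hs'⟩))
      (fun e => hs' e.2) ⟨ht, htC'⟩
    · exact hBS t ht this.1
    · rintro t ⟨h1, h2⟩ (h3 | h3)
      exacts [h.disj t h3 h1, hCC.disj t h3 h2]
    · intro t ht
      by_cases htS : t ∈ S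
      · exact Or.inr (Or.inr (hC ⟨htS, fun e => ht ⟨htS, e⟩⟩))
      by_cases htS' : t ∈ S'
      · exact Or.inr (Or.inl (hA ⟨htS', htS⟩))
      rcases (h.cover t).1 htS with h1 | h1
      · exact Or.inr (Or.inl h1)
      rcases (hCC.cover t).1 htS' with h2 | h2
      · exact Or.inr (Or.inr h2)
      · exact Or.inl ⟨h1, h2⟩
  rcases h'.diff_subset_of_not_crosses hS hc with hA' | hB'
  · obtain ⟨t, ht, ht'⟩ := hBB
    exact absurd ht' (key h' hA' t ht)
  · have hBA : ∀ t, t ∈ B → t ∉ A' := key h'.symm hB'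
    refine ⟨fun t ht ht' => hA ⟨ht, ht'⟩, fun t ht ht' => hB' ⟨ht, ht'⟩, fun t ht => ?_,
      fun t ht => ?_⟩
    · exact ((h'.cover t).1 (hBS' t ht)).resolve_left (hBA t ht)
    · have htS : t ∉ S := fun e => h'.disj t ht (hB' ⟨e, (h'.cover t).2 (Or.inl ht)⟩)
      exact ((h.cover t).1 htS).resolve_right fun e => hBA t e ht

/-- A cut point does not separate the points of a cut pair. -/
theorem not_crosses_singleton [T1Space X] [LocallyConnectedSpace X] {R : Set X} (hR : IsCutPair R)
    (c : X) : ¬ Crosses R {c} := by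
  rintro ⟨x, y, rfl, hx, hy, hne⟩
  obtain ⟨A, B, h, rfl, hyB⟩ :=
    exists_separation_of_connectedComponentIn_ne isClosed_singleton hx hy hne
  have hxA := mem_connectedComponentIn (show x ∈ ({c} : Set X)ᶜ from hx)
  set A := connectedComponentIn {c}ᶜ x
  have hxy : x ≠ y := fun e => h.disj x hxA (e ▸ hyB)
  obtain ⟨E, F, hEF, hcE⟩ : ∃ E F, Separation {x, y} E F ∧ c ∈ E := by
    obtain ⟨E, F, hEF⟩ := hR.isCutSet.exists_separation (Set.toFinite _).isClosed
    have hc : c ∉ ({x, y} : Set X) := by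
      rintro (e | e)
      exacts [hx e.symm, hy e.symm]
    rcases (hEF.cover c).1 hc with h' | h'
    exacts [⟨E, F, hEF, h'⟩, ⟨F, E, hEF.symm, h'⟩]
  -- With `c` on the side `E`, the region `F ∩ A` is bounded by the single point `x`, and `F ∩ B` by
  -- `y`. Neither is a cut point, so both regions, and hence `F`, are empty.
  have key : ∀ {x y : X} {A B : Set X}, Separation {c} A B → Separation {x, y} E F → x ≠ y →
      y ∈ B → IsPreconnected ({x}ᶜ : Set X) → ∀ t, t ∈ F → t ∉ A := by
    intro x y A B h hEF hxy hyB hpre t htF htA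
    have := mem_of_isPreconnected_compl (U := F ∩ A) (V := E ∪ B) (v := y) hpre
      (hEF.openB.inter h.openA) (hEF.openA.union h.openB) ?_ ?_ (Or.inr hyB) hxy.symm ⟨htF, htA⟩
    · exact (hEF.cover t).2 (Or.inr htF) (Or.inl this)
    · rintro t ⟨h1, h2⟩ (h3 | h3)
      exacts [hEF.disj t h3 h1, h.disj t h2 h3]
    · intro t ht
      by_cases hty : t = y
      · exact Or.inr (Or.inr (hty ▸ hyB))
      by_cases htc : t = c
      · exact Or.inr (Or.inl (htc ▸ hcE))
      rcases (hEF.cover t).1 (by rintro (e | e); exacts [ht e, hty e]) with h1 | h1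
      · exact Or.inr (Or.inl h1)
      rcases (h.cover t).1 htc with h2 | h2
      exacts [Or.inl ⟨h1, h2⟩, Or.inr (Or.inr h2)]
  obtain ⟨t, ht⟩ := hEF.nonemptyB
  have h1 := key h hEF hxy hyB (hR.isPreconnected_compl (by simp)) t ht
  have h2 := key h.symm (by rw [Set.pair_comm]; exact hEF) hxy.symm hxA
    (hR.isPreconnected_compl (by simp)) t ht
  have htc : t ≠ c := fun e => hEF.disj t (e ▸ hcE) ht
  rcases (h.cover t).1 htc with h3 | h3
  exacts [h1 h3, h2 h3]

end Separations

/-! ### Uncrossed cut pairs near two distinct points -/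

section Finiteness

variable {X : Type} [TopologicalSpace X]

/-- An uncrossed cut pair with one point in `P` and one in `Q`, and a separation of its
complement. -/
structure SplitPair (P Q S A B : Set X) (a b : X) : Prop where
  eq_pair : S = {a, b}
  memP : a ∈ P
  memQ : b ∈ Q
  uncrossed : IsUncrossedCutPair S
  sep : Separation S A B

theorem SplitPair.symm {P Q S A B : Set X} {a b : X} (h : SplitPair P Q S A B a b) :
    SplitPair Q P S A B b a :=
  ⟨by rw [h.eq_pair, Set.pair_comm], h.memQ, h.memP, h.uncrossed, h.sep⟩

variable {P Q : Set X} {S₁ A₁ B₁ S₂ A₂ B₂ S₃ A₃ B₃ : Set X} {a₁ b₁ a₂ b₂ a₃ b₃ : X}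

theorem SplitPair.mem_iff {P Q S A B : Set X} {a b : X} (h : SplitPair P Q S A B a b) {t : X} :
    t ∈ S ↔ t = a ∨ t = b := by
  rw [h.eq_pair]; rfl

/-- The region between `S₁` and `S₃` falls into a part in `P` and a part in `Q`. Joining the
`Q`-part to `B₁` and the `P`-part to `A₃` shows that the diagonal `{a₁, b₃}` is a cut pair. As `a₁ ∈
B₂` and `b₃ ∈ A₂`, it crosses `S₂`. -/
theorem false_of_precedes_of_notMem (hP : IsOpen P) (hQ : IsOpen Q)
    (hPQ : ∀ t, t ∈ P → t ∉ Q)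
    (h₁ : SplitPair P Q S₁ A₁ B₁ a₁ b₁) (h₂ : SplitPair P Q S₂ A₂ B₂ a₂ b₂)
    (h₃ : SplitPair P Q S₃ A₃ B₃ a₃ b₃) (h₁₂ : Precedes S₁ A₁ B₁ S₂ A₂ B₂)
    (h₂₃ : Precedes S₂ A₂ B₂ S₃ A₃ B₃) (hmid : ∀ t, t ∈ A₁ → t ∈ B₃ → t ∈ P ∨ t ∈ Q)
    (ha : a₁ ∉ S₂) (hb : b₃ ∉ S₂) : False := by
  have ha1 : a₁ ∈ S₁ := h₁.mem_iff.2 (Or.inl rfl)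
  have hb1 : b₁ ∈ S₁ := h₁.mem_iff.2 (Or.inr rfl)
  have ha3 : a₃ ∈ S₃ := h₃.mem_iff.2 (Or.inl rfl)
  have hb3 : b₃ ∈ S₃ := h₃.mem_iff.2 (Or.inr rfl)
  have haB : a₁ ∈ B₂ := h₁₂.diff_subset' _ ha1 ha
  have hbA : b₃ ∈ A₂ := h₂₃.diff_subset _ hb3 hb
  have hab : a₁ ≠ b₃ := fun e => hPQ a₁ h₁.memP (e ▸ h₃.memQ)
  have hS13 : ∀ t, t ∈ S₁ → t ∈ S₃ → t ∈ S₂ := by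
    intro t h1 h3
    by_contra h2
    exact h₂.sep.disj t (h₂₃.diff_subset _ h3 h2) (h₁₂.diff_subset' _ h1 h2)
  have hS1 : ∀ t, t ∈ S₁ → t ∉ S₃ → t ∈ B₃ := by
    intro t h1 h3
    by_cases h2 : t ∈ S₂
    · exact h₂₃.diff_subset' _ h2 h3
    · exact h₂₃.subsetB (h₁₂.diff_subset' _ h1 h2)
  have hS3 : ∀ t, t ∈ S₃ → t ∉ S₁ → t ∈ A₁ := by
    intro t h3 h1
    by_cases h2 : t ∈ S₂
    · exact h₁₂.diff_subset _ h2 h1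
    · exact h₁₂.subsetA (h₂₃.diff_subset _ h3 h2)
  have hb1' : b₁ ∉ S₃ := by
    intro h
    rcases h₃.mem_iff.1 h with e | e
    · exact hPQ _ h₃.memP (e ▸ h₁.memQ)
    · exact hb (e ▸ hS13 _ hb1 h)
  have ha3' : a₃ ∉ S₁ := by
    intro h
    rcases h₁.mem_iff.1 h with e | e
    · exact ha (e ▸ hS13 _ h ha3)
    · exact hPQ _ h₃.memP (e ▸ h₁.memQ)
  have hB13 := h₁₂.subsetB.trans h₂₃.subsetB
  have hA31 := h₂₃.subsetA.trans h₁₂.subsetA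
  have ha1B : a₁ ∉ B₁ := fun h => (h₁.sep.cover _).2 (Or.inr h) ha1
  have hb3A : b₃ ∉ A₃ := fun h => (h₃.sep.cover _).2 (Or.inl h) hb3
  have hsep : Separation {a₁, b₃} (B₃ ∩ (B₁ ∪ Q)) (A₁ ∩ (A₃ ∪ P)) := by
    refine ⟨h₃.sep.openB.inter (h₁.sep.openB.union hQ), h₁.sep.openA.inter (h₃.sep.openA.union hP),
      ?_, ?_, ?_, ?_⟩
    · obtain ⟨t, ht⟩ := h₁.sep.nonemptyB
      exact ⟨t, hB13 ht, Or.inl ht⟩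
    · obtain ⟨t, ht⟩ := h₃.sep.nonemptyA
      exact ⟨t, hA31 ht, Or.inl ht⟩
    · rintro t ⟨h1, h2⟩ ⟨h3, h4⟩
      have h2 := h2.resolve_left fun h => h₁.sep.disj t h3 h
      have h4 := h4.resolve_left fun h => h₃.sep.disj t h h1
      exact hPQ t h4 h2
    · intro t
      constructor
      · intro ht
        have hta : t ≠ a₁ := fun e => ht (Or.inl e)
        have htb : t ≠ b₃ := fun e => ht (Or.inr e)
        by_cases ht3 : t ∈ S₃
        · have := (h₃.mem_iff.1 ht3).resolve_right htb
          subst this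
          exact Or.inr ⟨hS3 t ha3 ha3', Or.inr h₃.memP⟩
        by_cases ht1 : t ∈ S₁
        · have := (h₁.mem_iff.1 ht1).resolve_left hta
          subst this
          exact Or.inl ⟨hS1 t hb1 hb1', Or.inr h₁.memQ⟩
        rcases (h₃.sep.cover t).1 ht3 with h3 | h3
        · exact Or.inr ⟨hA31 h3, Or.inl h3⟩
        rcases (h₁.sep.cover t).1 ht1 with h1 | h1
        · rcases hmid t h1 h3 with h | h
          exacts [Or.inr ⟨h1, Or.inr h⟩, Or.inl ⟨h3, Or.inr h⟩]
        · exact Or.inl ⟨h3, Or.inl h1⟩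
      · rintro (⟨h1, h2⟩ | ⟨h1, h2⟩) (rfl | rfl)
        · rcases h2 with h2 | h2
          exacts [ha1B h2, hPQ _ h₁.memP h2]
        · exact (h₃.sep.cover _).2 (Or.inr h1) hb3
        · exact (h₁.sep.cover _).2 (Or.inl h1) ha1
        · rcases h2 with h2 | h2
          exacts [hb3A h2, hPQ _ h2 h₃.memQ]
  refine h₂.uncrossed.2 {a₁, b₃} ⟨a₁, b₃, hab, rfl, hsep.isCutSet,
    not_not.2 (h₁.uncrossed.1.isPreconnected_compl ha1),
    not_not.2 (h₃.uncrossed.1.isPreconnected_compl hb3)⟩ ⟨a₁, b₃, rfl, ha, hb, ?_⟩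
  exact h₂.sep.symm.connectedComponentIn_ne haB hbA

/-- When the three pairs share `a`, the `P`-part of the region between `S₁` and `S₃` is bounded by
`a` alone and hence empty. The whole region is then cut off by `{b₁, b₃}`, a cut pair that crosses
`S₂`. -/
theorem false_of_precedes_of_common (hP : IsOpen P) (hQ : IsOpen Q)
    (hPQ : ∀ t, t ∈ P → t ∉ Q) {a : X}
    (h₁ : SplitPair P Q S₁ A₁ B₁ a b₁) (h₂ : SplitPair P Q S₂ A₂ B₂ a b₂)
    (h₃ : SplitPair P Q S₃ A₃ B₃ a b₃) (h₁₂ : Precedes S₁ A₁ B₁ S₂ A₂ B₂)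
    (h₂₃ : Precedes S₂ A₂ B₂ S₃ A₃ B₃) (hmid : ∀ t, t ∈ A₁ → t ∈ B₃ → t ∈ P ∨ t ∈ Q)
    (hb₁ : b₁ ∉ S₂) (hb₃ : b₃ ∉ S₂) : False := by
  have haS : a ∈ S₁ := h₁.mem_iff.2 (Or.inl rfl)
  have hb1 : b₁ ∈ S₁ := h₁.mem_iff.2 (Or.inr rfl)
  have hb2 : b₂ ∈ S₂ := h₂.mem_iff.2 (Or.inr rfl)
  have haS3 : a ∈ S₃ := h₃.mem_iff.2 (Or.inl rfl)
  have hb3 : b₃ ∈ S₃ := h₃.mem_iff.2 (Or.inr rfl)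
  have hbB : b₁ ∈ B₂ := h₁₂.diff_subset' _ hb1 hb₁
  have hbA : b₃ ∈ A₂ := h₂₃.diff_subset _ hb3 hb₃
  have hab2 : b₂ ≠ a := fun e => hPQ a h₁.memP (e ▸ h₂.memQ)
  have hb2A : b₂ ∈ A₁ := h₁₂.diff_subset _ hb2 fun h => (h₁.mem_iff.1 h).elim hab2
    fun e => hb₁ (e ▸ hb2)
  have hb2B : b₂ ∈ B₃ := h₂₃.diff_subset' _ hb2 fun h => (h₃.mem_iff.1 h).elim hab2
    fun e => hb₃ (e ▸ hb2)
  have hB13 := h₁₂.subsetB.trans h₂₃.subsetB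
  have hA31 := h₂₃.subsetA.trans h₁₂.subsetA
  have hne : b₁ ≠ b₃ := fun e => h₂.sep.disj b₃ hbA (e ▸ hbB)
  have hbS : b₁ ≠ a := fun e => hPQ a h₁.memP (e ▸ h₁.memQ)
  have hMP : ∀ t, t ∈ A₁ → t ∈ B₃ → t ∉ P := by
    intro t h1 h3 hp
    have := mem_of_isPreconnected_compl (T := {a}) (U := A₁ ∩ B₃ ∩ P) (V := B₁ ∪ A₃ ∪ Q) (v := b₁)
      (h₁.uncrossed.1.isPreconnected_compl haS) ((h₁.sep.openA.inter h₃.sep.openB).inter hP)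
      ((h₁.sep.openB.union h₃.sep.openA).union hQ) ?_ ?_ (Or.inr h₁.memQ) hbS ⟨⟨h1, h3⟩, hp⟩
    · exact (h₁.sep.cover t).2 (Or.inl h1) (this ▸ haS)
    · rintro t ⟨⟨h1, h3⟩, hp⟩ ((h | h) | h)
      exacts [h₁.sep.disj t h1 h, h₃.sep.disj t h h3, hPQ t hp h]
    · intro t hta
      by_cases ht1 : t ∈ S₁
      · exact Or.inr (Or.inr ((h₁.mem_iff.1 ht1).resolve_left hta ▸ h₁.memQ))
      by_cases ht3 : t ∈ S₃
      · exact Or.inr (Or.inr ((h₃.mem_iff.1 ht3).resolve_left hta ▸ h₃.memQ))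
      rcases (h₁.sep.cover t).1 ht1 with h1 | h1
      swap
      · exact Or.inr (Or.inl (Or.inl h1))
      rcases (h₃.sep.cover t).1 ht3 with h3 | h3
      · exact Or.inr (Or.inl (Or.inr h3))
      rcases hmid t h1 h3 with h | h
      exacts [Or.inl ⟨⟨h1, h3⟩, h⟩, Or.inr (Or.inr h)]
  have hsep : Separation {b₁, b₃} (A₁ ∩ B₃) (B₁ ∪ A₃ ∪ P) := by
    refine ⟨h₁.sep.openA.inter h₃.sep.openB, (h₁.sep.openB.union h₃.sep.openA).union hP,
      ⟨b₂, hb2A, hb2B⟩, ⟨a, Or.inr h₁.memP⟩, ?_, ?_⟩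
    · rintro t ⟨h1, h3⟩ ((h | h) | h)
      exacts [h₁.sep.disj t h1 h, h₃.sep.disj t h h3, hMP t h1 h3 h]
    · intro t
      constructor
      · intro ht
        by_cases ht1 : t ∈ S₁
        · exact Or.inr (Or.inr (((h₁.mem_iff.1 ht1).resolve_right fun e => ht (Or.inl e)) ▸
            h₁.memP))
        by_cases ht3 : t ∈ S₃
        · exact Or.inr (Or.inr (((h₃.mem_iff.1 ht3).resolve_right fun e => ht (Or.inr e)) ▸
            h₁.memP))
        rcases (h₁.sep.cover t).1 ht1 with h1 | h1
        swap
        · exact Or.inr (Or.inl (Or.inl h1))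
        rcases (h₃.sep.cover t).1 ht3 with h3 | h3
        · exact Or.inr (Or.inl (Or.inr h3))
        · exact Or.inl ⟨h1, h3⟩
      · rintro (⟨h1, h3⟩ | ((h | h) | h)) (rfl | rfl)
        · exact (h₁.sep.cover _).2 (Or.inl h1) hb1
        · exact (h₃.sep.cover _).2 (Or.inr h3) hb3
        · exact (h₁.sep.cover _).2 (Or.inr h) hb1
        · exact h₂.sep.disj _ hbA (h₁₂.subsetB h)
        · exact h₂.sep.disj _ (h₂₃.subsetA h) hbB
        · exact (h₃.sep.cover _).2 (Or.inl h) hb3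
        · exact hPQ _ h h₁.memQ
        · exact hPQ _ h h₃.memQ
  refine h₂.uncrossed.2 {b₁, b₃} ⟨b₁, b₃, hne, rfl, hsep.isCutSet,
    not_not.2 (h₁.uncrossed.1.isPreconnected_compl hb1),
    not_not.2 (h₃.uncrossed.1.isPreconnected_compl hb3)⟩ ⟨b₁, b₃, rfl, hb₁, hb₃, ?_⟩
  exact h₂.sep.symm.connectedComponentIn_ne hbB hbA

/-- Each outer pair has a point off `S₂`. If one of them offers such a point in `P` and the other
one in `Q`, a diagonal crosses `S₂`. Otherwise both share with `S₂` the same one of its points. -/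
theorem false_of_precedes (hP : IsOpen P) (hQ : IsOpen Q) (hPQ : ∀ t, t ∈ P → t ∉ Q)
    (h₁ : SplitPair P Q S₁ A₁ B₁ a₁ b₁) (h₂ : SplitPair P Q S₂ A₂ B₂ a₂ b₂)
    (h₃ : SplitPair P Q S₃ A₃ B₃ a₃ b₃) (h₁₂ : Precedes S₁ A₁ B₁ S₂ A₂ B₂)
    (h₂₃ : Precedes S₂ A₂ B₂ S₃ A₃ B₃) (hmid : ∀ t, t ∈ A₁ → t ∈ B₃ → t ∈ P ∨ t ∈ Q)
    (hne₁ : S₁ ≠ S₂) (hne₃ : S₃ ≠ S₂) : False := by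
  have hQP : ∀ t, t ∈ Q → t ∉ P := fun t h h' => hPQ t h' h
  have hmid' : ∀ t, t ∈ A₁ → t ∈ B₃ → t ∈ Q ∨ t ∈ P := fun t h h' => (hmid t h h').symm
  have hα := false_of_precedes_of_notMem hP hQ hPQ h₁ h₂ h₃ h₁₂ h₂₃ hmid
  have hβ := false_of_precedes_of_notMem hQ hP hQP h₁.symm h₂.symm h₃.symm h₁₂ h₂₃ hmid'
  have ha : ∀ {S A B : Set X} {a b : X}, SplitPair P Q S A B a b → a ∈ S₂ → a = a₂ :=
    fun h h' => (h₂.mem_iff.1 h').resolve_right fun e => hPQ _ h.memP (e ▸ h₂.memQ)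
  have hb : ∀ {S A B : Set X} {a b : X}, SplitPair P Q S A B a b → b ∈ S₂ → b = b₂ :=
    fun h h' => (h₂.mem_iff.1 h').resolve_left fun e => hPQ _ h₂.memP (e ▸ h.memQ)
  have hn : ∀ {S A B : Set X} {a b : X}, SplitPair P Q S A B a b → S ≠ S₂ → a ∉ S₂ ∨ b ∉ S₂ := by
    intro S A B a b h hne
    by_contra! hc
    exact hne (by rw [h.eq_pair, h₂.eq_pair, ha h hc.1, hb h hc.2])
  by_cases h1 : a₁ ∈ S₂
  · have h1' := (hn h₁ hne₁).resolve_left (not_not.2 h1)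
    by_cases h3 : a₃ ∈ S₂
    · have h3' := (hn h₃ hne₃).resolve_left (not_not.2 h3)
      have e1 := ha h₁ h1
      have e3 := ha h₃ h3
      subst e1
      subst e3
      exact false_of_precedes_of_common hP hQ hPQ h₁ h₂ h₃ h₁₂ h₂₃ hmid h1' h3'
    · exact hβ h1' h3
  · by_cases h3 : b₃ ∈ S₂
    · have h3' := (hn h₃ hne₃).resolve_right (not_not.2 h3)
      by_cases h1' : b₁ ∈ S₂
      · have e1 := hb h₁ h1'
        have e3 := hb h₃ h3
        subst e1
        subst e3
        exact false_of_precedes_of_common hQ hP hQP h₁.symm h₂.symm h₃.symm h₁₂ h₂₃ hmid' h1 h3'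
      · exact hβ h1' h3'
    · exact hα h1 h3

theorem SplitPair.precedes_or_precedes [PreconnectedSpace X]
    (h₁ : SplitPair P Q S₁ A₁ B₁ a₁ b₁) (h₂ : SplitPair P Q S₂ A₂ B₂ a₂ b₂) (hne : S₁ ≠ S₂)
    (hA : (A₁ ∩ A₂).Nonempty) (hB : (B₁ ∩ B₂).Nonempty) :
    Precedes S₁ A₁ B₁ S₂ A₂ B₂ ∨ Precedes S₂ A₂ B₂ S₁ A₁ B₁ := by
  have hc := h₂.uncrossed.2 S₁ h₁.uncrossed.1
  rcases h₁.sep.diff_subset_of_not_crosses h₂.uncrossed.1 (h₁.uncrossed.2 S₂ h₂.uncrossed.1)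
    with h | h
  · exact Or.inl (h₁.sep.precedes h₂.sep h₁.uncrossed.1 h₂.uncrossed.1 hne hc h hB)
  · have := h₁.sep.symm.precedes h₂.sep.symm h₁.uncrossed.1 h₂.uncrossed.1 hne hc h hA
    exact Or.inr ⟨this.diff_subset', this.diff_subset, this.subsetA, this.subsetB⟩

/-- If `A` were contained in `P ∪ Q`, then `A ∩ P` would be bounded by `a` alone and `A ∩ Q` by `b`
alone. Neither is a cut point, so `A` would be empty. -/
theorem SplitPair.exists_mem_compl (hP : IsOpen P) (hQ : IsOpen Q) (hPQ : ∀ t, t ∈ P → t ∉ Q)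
    {S A B : Set X} {a b : X} (h : SplitPair P Q S A B a b) : ∃ t ∈ A, t ∉ P ∧ t ∉ Q := by
  by_contra! hc
  have key : ∀ {P Q : Set X} {a b : X}, IsOpen P → IsOpen Q → (∀ t, t ∈ P → t ∉ Q) →
      SplitPair P Q S A B a b → (∀ t ∈ A, t ∉ P → t ∈ Q) → ∀ t ∈ A, t ∉ P := by
    intro P Q a b hP hQ hPQ h hc t htA htP
    have haS : a ∈ S := h.mem_iff.2 (Or.inl rfl)
    have := mem_of_isPreconnected_compl (T := {a}) (U := A ∩ P) (V := B ∪ Q) (v := b)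
      (h.uncrossed.1.isPreconnected_compl haS) (h.sep.openA.inter hP) (h.sep.openB.union hQ)
      ?_ ?_ (Or.inr h.memQ) (fun e => hPQ a h.memP (e ▸ h.memQ)) ⟨htA, htP⟩
    · exact (h.sep.cover t).2 (Or.inl htA) (this ▸ haS)
    · rintro t ⟨h1, h2⟩ (h3 | h3)
      exacts [h.sep.disj t h1 h3, hPQ t h2 h3]
    · intro t hta
      by_cases htS : t ∈ S
      · exact Or.inr (Or.inr ((h.mem_iff.1 htS).resolve_left hta ▸ h.memQ))
      rcases (h.sep.cover t).1 htS with h1 | h1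
      · by_cases htP : t ∈ P
        exacts [Or.inl ⟨h1, htP⟩, Or.inr (Or.inr (hc t h1 htP))]
      · exact Or.inr (Or.inl h1)
  obtain ⟨t, ht⟩ := h.sep.nonemptyA
  have h1 := key hP hQ hPQ h hc t ht
  exact key hQ hP (fun t h h' => hPQ t h' h) h.symm
    (fun t ht htQ => by by_contra htP; exact htQ (hc t ht htP)) t ht (hc t ht h1)

/-- Finitely many connected sets `O y` cover the compact complement of `P ∪ Q`. Pairs close enough
to `p` and `q` avoid them, so each `O y` lies on one side of the chosen separation. There are
finitely many ways to distribute the `O y`, and each is realized by at most two pairs. -/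
theorem exists_nhds_finite_uncrossed [CompactSpace X] [T2Space X] [LocallyConnectedSpace X]
    [PreconnectedSpace X] {p q : X} (hpq : p ≠ q) :
    ∃ P ∈ 𝓝 p, ∃ Q ∈ 𝓝 q,
      {S : Set X | IsUncrossedCutPair S ∧ ∃ a ∈ P, ∃ b ∈ Q, S = {a, b}}.Finite := by
  classical
  obtain ⟨P, Q, hP, hQ, hpP, hqQ, hPQ⟩ := t2_separation hpq
  have hPQ' : ∀ t, t ∈ P → t ∉ Q := fun t ht => Set.disjoint_left.1 hPQ ht
  have hM : IsCompact (P ∪ Q)ᶜ := (hP.union hQ).isClosed_compl.isCompact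
  have h1 : ∀ y ∈ (P ∪ Q)ᶜ, ∃ O P' Q' : Set X, O ∈ 𝓝 y ∧ IsPreconnected O ∧ P' ∈ 𝓝 p ∧
      Q' ∈ 𝓝 q ∧ (∀ t ∈ O, t ∉ P') ∧ ∀ t ∈ O, t ∉ Q' := by
    intro y hy
    obtain ⟨U, P', hU, hP', hyU, hpP', hd⟩ := t2_separation
      (show y ≠ p from fun e => hy (Or.inl (e ▸ hpP)))
    obtain ⟨V, Q', hV, hQ', hyV, hqQ', hd'⟩ := t2_separation
      (show y ≠ q from fun e => hy (Or.inr (e ▸ hqQ)))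
    obtain ⟨O, hO, hOc, hOU⟩ := locallyConnectedSpace_iff_connected_subsets.1 ‹_› y (U ∩ V)
      ((hU.inter hV).mem_nhds ⟨hyU, hyV⟩)
    exact ⟨O, P', Q', hO, hOc, hP'.mem_nhds hpP', hQ'.mem_nhds hqQ',
      fun t ht => Set.disjoint_left.1 hd (hOU ht).1,
      fun t ht => Set.disjoint_left.1 hd' (hOU ht).2⟩
  choose! O P' Q' hO hOc hP' hQ' hOP hOQ using h1
  obtain ⟨s, hs, hcov⟩ := hM.elim_nhds_subcover O hO
  refine ⟨P ∩ ⋂ y ∈ s, P' y, inter_mem (hP.mem_nhds hpP)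
    ((biInter_finset_mem s).2 fun y hy => hP' y (hs y hy)), Q ∩ ⋂ y ∈ s, Q' y,
    inter_mem (hQ.mem_nhds hqQ) ((biInter_finset_mem s).2 fun y hy => hQ' y (hs y hy)), ?_⟩
  set 𝒮 := {S : Set X | IsUncrossedCutPair S ∧ ∃ a ∈ P ∩ ⋂ y ∈ s, P' y,
    ∃ b ∈ Q ∩ ⋂ y ∈ s, Q' y, S = {a, b}} with h𝒮
  have h2 : ∀ S ∈ 𝒮, ∃ A B a b, SplitPair P Q S A B a b ∧ ∀ y ∈ s, O y ⊆ A ∨ O y ⊆ B := by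
    rintro S ⟨hS, a, ha, b, hb, hab⟩
    have hcl : IsClosed S := by rw [hab]; exact (Set.toFinite _).isClosed
    obtain ⟨A, B, hAB⟩ := hS.1.isCutSet.exists_separation hcl
    refine ⟨A, B, a, b, ⟨hab, ha.1, hb.1, hS, hAB⟩, fun y hy => ?_⟩
    refine hAB.subset_or_subset (hOc y (hs y hy)) fun t ht htS => ?_
    rw [hab] at htS
    rcases htS with rfl | rfl
    · exact hOP y (hs y hy) _ ht (Set.mem_iInter₂.1 ha.2 y hy)
    · exact hOQ y (hs y hy) _ ht (Set.mem_iInter₂.1 hb.2 y hy)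
  choose! A B a b hsp hOAB using h2
  -- Separations with the same distribution agree outside `P ∪ Q`. Both their `A`-sides and their
  -- `B`-sides therefore meet, so they are nested, and the region between them lies in `P ∪ Q`.
  refine Set.Finite.of_finite_fibers (fun S => s.filter (O · ⊆ A S))
    ((s.powerset.finite_toSet).subset ?_) ?_
  · rintro _ ⟨S, -, rfl⟩
    exact Finset.mem_coe.2 (Finset.mem_powerset.2 (Finset.filter_subset _ _))
  rintro σ -
  by_contra hinf
  obtain ⟨τ, hτ, hcard⟩ := Set.Infinite.exists_subset_card_eq hinf 3
  obtain ⟨S₁, S₂, S₃, h12, h13, h23, rfl⟩ := Finset.card_eq_three.1 hcard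
  have hmem : ∀ S ∈ ({S₁, S₂, S₃} : Finset (Set X)), S ∈ 𝒮 ∧ s.filter (O · ⊆ A S) = σ :=
    fun S hS => hτ hS
  have hmid : ∀ S ∈ 𝒮, ∀ t, t ∉ P → t ∉ Q → ∃ y ∈ s, t ∈ O y := by
    intro S _ t h1 h2
    obtain ⟨y, hy, ht⟩ := Set.mem_iUnion₂.1 (hcov (show t ∈ (P ∪ Q)ᶜ from fun h => h.elim h1 h2))
    exact ⟨y, hy, ht⟩
  have hAA : ∀ S S' : Set X, S ∈ 𝒮 → S' ∈ 𝒮 → s.filter (O · ⊆ A S) = s.filter (O · ⊆ A S') →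
      (∀ t, t ∉ P → t ∉ Q → t ∈ A S → t ∈ A S') ∧
      (∀ t, t ∉ P → t ∉ Q → t ∈ B S → t ∈ B S') := by
    intro S S' hS hS' e
    have hiff : ∀ y ∈ s, O y ⊆ A S ↔ O y ⊆ A S' := fun y hy => by
      have := Finset.ext_iff.1 e y
      simpa [hy] using this
    constructor
    · intro t h1 h2 htA
      obtain ⟨y, hy, hty⟩ := hmid S hS t h1 h2
      rcases hOAB S hS y hy with h | h
      · exact (hiff y hy).1 h hty
      · exact absurd (h hty) ((hsp S hS).sep.disj t htA)
    · intro t h1 h2 htB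
      obtain ⟨y, hy, hty⟩ := hmid S hS t h1 h2
      rcases hOAB S hS y hy with h | h
      · exact absurd htB ((hsp S hS).sep.disj t (h hty))
      · refine ((hOAB S' hS' y hy).resolve_left fun h' => ?_) hty
        exact (hsp S hS).sep.disj t ((hiff y hy).2 h' hty) htB
  have hcomp : ∀ S ∈ ({S₁, S₂, S₃} : Finset (Set X)), ∀ S' ∈ ({S₁, S₂, S₃} : Finset (Set X)),
      S ≠ S' → Precedes S (A S) (B S) S' (A S') (B S') ∨
        Precedes S' (A S') (B S') S (A S) (B S) := by
    intro S hS S' hS' hne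
    obtain ⟨hS, e⟩ := hmem S hS
    obtain ⟨hS', e'⟩ := hmem S' hS'
    obtain ⟨h1, h2⟩ := hAA S S' hS hS' (e.trans e'.symm)
    refine (hsp S hS).precedes_or_precedes (hsp S' hS') hne ?_ ?_
    · obtain ⟨t, ht, htP, htQ⟩ := (hsp S hS).exists_mem_compl hP hQ hPQ'
      exact ⟨t, ht, h1 t htP htQ ht⟩
    · obtain ⟨t, ht, htP, htQ⟩ := SplitPair.exists_mem_compl hP hQ hPQ'
        ⟨(hsp S hS).eq_pair, (hsp S hS).memP, (hsp S hS).memQ, (hsp S hS).uncrossed,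
          (hsp S hS).sep.symm⟩
      exact ⟨t, ht, h2 t htP htQ ht⟩
  have hfalse : ∀ R₁ ∈ ({S₁, S₂, S₃} : Finset (Set X)), ∀ R₂ ∈ ({S₁, S₂, S₃} : Finset (Set X)),
      ∀ R₃ ∈ ({S₁, S₂, S₃} : Finset (Set X)), R₁ ≠ R₂ → R₃ ≠ R₂ →
      Precedes R₁ (A R₁) (B R₁) R₂ (A R₂) (B R₂) →
      Precedes R₂ (A R₂) (B R₂) R₃ (A R₃) (B R₃) → False := by
    intro R₁ h₁ R₂ h₂ R₃ h₃ hne₁ hne₃ h₁₂ h₂₃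
    obtain ⟨h₁, e₁⟩ := hmem R₁ h₁
    obtain ⟨h₂, e₂⟩ := hmem R₂ h₂
    obtain ⟨h₃, e₃⟩ := hmem R₃ h₃
    refine false_of_precedes hP hQ hPQ' (hsp R₁ h₁) (hsp R₂ h₂) (hsp R₃ h₃) h₁₂ h₂₃ ?_ hne₁ hne₃
    intro t ht1 ht3
    by_contra! hc
    exact (hsp R₃ h₃).sep.disj t ((hAA R₁ R₃ h₁ h₃ (e₁.trans e₃.symm)).1 t hc.1 hc.2 ht1) ht3
  have m1 : S₁ ∈ ({S₁, S₂, S₃} : Finset (Set X)) := by simp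
  have m2 : S₂ ∈ ({S₁, S₂, S₃} : Finset (Set X)) := by simp
  have m3 : S₃ ∈ ({S₁, S₂, S₃} : Finset (Set X)) := by simp
  -- Three pairwise comparable separations always contain a chain of three, whose middle pair cannot
  -- be uncrossed.
  rcases hcomp S₁ m1 S₂ m2 h12 with h | h <;> rcases hcomp S₂ m2 S₃ m3 h23 with h' | h' <;>
    rcases hcomp S₁ m1 S₃ m3 h13 with h'' | h''
  · exact hfalse _ m1 _ m2 _ m3 h12 h23.symm h h'
  · exact hfalse _ m1 _ m2 _ m3 h12 h23.symm h h'
  · exact hfalse _ m1 _ m3 _ m2 h13 h23 h'' h'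
  · exact hfalse _ m3 _ m1 _ m2 h13.symm h12.symm h'' h
  · exact hfalse _ m2 _ m1 _ m3 h12.symm h13.symm h h''
  · exact hfalse _ m2 _ m3 _ m1 h23 h13 h' h''
  · exact hfalse _ m3 _ m2 _ m1 h23.symm h12 h' h
  · exact hfalse _ m3 _ m2 _ m1 h23.symm h12 h' h

/-- A compact subset of the complement of a point that does not separate lies in a connected set
that stays away from the point. -/
theorem exists_preconnected_superset [T2Space X] [LocallyConnectedSpace X] {a : X}
    (ha : IsPreconnected ({a}ᶜ : Set X)) {L : Set X} (hL : IsCompact L) (haL : a ∉ L) :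
    ∃ K, IsPreconnected K ∧ L ⊆ K ∧ a ∉ closure K := by
  classical
  rcases L.eq_empty_or_nonempty with rfl | ⟨x₀, hx₀⟩
  · exact ⟨∅, isPreconnected_empty, subset_rfl, by simp⟩
  have hnhd : ∀ y, y ≠ a → ∃ O, IsOpen O ∧ y ∈ O ∧ IsPreconnected O ∧ a ∉ closure O := by
    intro y hy
    obtain ⟨U, V, hU, hV, hyU, haV, hd⟩ := t2_separation hy
    obtain ⟨O, hOU, hO, hyO, hOc⟩ :=
      locallyConnectedSpace_iff_subsets_isOpen_isConnected.1 ‹_› y U (hU.mem_nhds hyU)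
    refine ⟨O, hO, hyO, hOc.isPreconnected, fun h => ?_⟩
    obtain ⟨t, ht, ht'⟩ := mem_closure_iff.1 h V hV haV
    exact Set.disjoint_left.1 hd (hOU ht') ht
  -- Points that can be joined to `x₀` by a connected set staying away from `a`. Local connectedness
  -- makes `G` and its complement in `{a}ᶜ` open, so `G` is all of `{a}ᶜ`; compactness of `L` then
  -- leaves finitely many sets to unite.
  set G : Set X := {y | ∃ K, IsPreconnected K ∧ x₀ ∈ K ∧ y ∈ K ∧ a ∉ closure K} with hG
  have hstep : ∀ O, IsPreconnected O → a ∉ closure O → ∀ y ∈ O, ∀ z ∈ O, y ∈ G → z ∈ G := by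
    rintro O hO haO y hy z hz ⟨K, hK, hx, hyK, haK⟩
    refine ⟨K ∪ O, hK.union y hyK hy hO, Or.inl hx, Or.inr hz, ?_⟩
    rw [closure_union]
    rintro (h | h)
    exacts [haK h, haO h]
  have hGa : ∀ y ∈ G, y ≠ a := by
    rintro y ⟨K, -, -, hy, haK⟩ rfl
    exact haK (subset_closure hy)
  have hGopen : IsOpen G := by
    rw [isOpen_iff_mem_nhds]
    intro y hy
    obtain ⟨O, hO, hyO, hOc, haO⟩ := hnhd y (hGa y hy)
    exact mem_of_superset (hO.mem_nhds hyO) fun z hz => hstep O hOc haO y hyO z hz hy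
  have hGcopen : IsOpen (Gᶜ \ {a}) := by
    rw [isOpen_iff_mem_nhds]
    rintro y ⟨hy, hya⟩
    obtain ⟨O, hO, hyO, hOc, haO⟩ := hnhd y hya
    exact mem_of_superset (hO.mem_nhds hyO) fun z hz =>
      ⟨fun h => hy (hstep O hOc haO z hz y hyO h), fun e => haO (e ▸ subset_closure hz)⟩
  have hx₀G : x₀ ∈ G := by
    obtain ⟨O, -, hyO, hOc, haO⟩ := hnhd x₀ (fun e => haL (e ▸ hx₀))
    exact ⟨O, hOc, hyO, hyO, haO⟩
  have hall : ∀ y ∈ L, y ∈ G := by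
    intro y hy
    by_contra hyG
    have := mem_of_isPreconnected_compl ha hGcopen hGopen (fun t h h' => h.1 h')
      (fun t ht => (em (t ∈ G)).symm.imp (fun h => ⟨h, ht⟩) id) hx₀G
      (fun e => haL (e ▸ hx₀)) ⟨hyG, fun e => haL (e ▸ hy)⟩
    exact haL (this ▸ hy)
  have h1 : ∀ y ∈ L, ∃ K, IsPreconnected K ∧ x₀ ∈ K ∧ K ∈ 𝓝 y ∧ a ∉ closure K := by
    intro y hy
    obtain ⟨K, hK, hx, hyK, haK⟩ := hall y hy
    obtain ⟨O, hO, hyO, hOc, haO⟩ := hnhd y (fun e => haL (e ▸ hy))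
    refine ⟨K ∪ O, hK.union y hyK hyO hOc, Or.inl hx,
      mem_of_superset (hO.mem_nhds hyO) Set.subset_union_right, ?_⟩
    rw [closure_union]
    rintro (h | h)
    exacts [haK h, haO h]
  choose! K hK hxK hKn haK using h1
  obtain ⟨s, hs, hcov⟩ := hL.elim_nhds_subcover K hKn
  refine ⟨⋃ y ∈ s, K y, ?_, hcov, ?_⟩
  · rw [← Finset.set_biUnion_coe, ← Set.sUnion_image]
    refine isPreconnected_sUnion x₀ _ ?_ ?_
    · rintro _ ⟨y, hy, rfl⟩; exact hxK y (hs y hy)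
    · rintro _ ⟨y, hy, rfl⟩; exact hK y (hs y hy)
  · rw [Finset.closure_biUnion]
    intro h
    obtain ⟨y, hy, h⟩ := Set.mem_iUnion₂.1 h
    exact haK y (hs y hy) h

end Finiteness

end LinePattern

/-! ### Geodesics off the pattern, and points with one preimage -/

namespace LinePattern

theorem smul_pair {G X : Type*} [SMul G X] (g : G) (x y : X) :
    g • ({x, y} : Set X) = {g • x, g • y} :=
  Set.image_pair _ _ _

section Action

variable {G X : Type} [Group G] [TopologicalSpace X] [MulAction G X] [ContinuousConstSMul G X]

theorem isPreconnected_smul {T : Set X} (h : IsPreconnected T) (g : G) :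
    IsPreconnected (g • T) :=
  h.image _ (continuous_const_smul g).continuousOn

theorem IsCutSet.smul {S : Set X} (h : IsCutSet S) (g : G) : IsCutSet (g • S) := by
  intro hc
  apply h
  have := isPreconnected_smul hc g⁻¹
  rwa [← Set.smul_set_compl, inv_smul_smul] at this

theorem isPreconnected_compl_smul_singleton {x : X} (h : IsPreconnected ({x}ᶜ : Set X)) (g : G) :
    IsPreconnected ({g • x}ᶜ : Set X) := by
  rw [← Set.smul_set_singleton, ← Set.smul_set_compl]
  exact isPreconnected_smul h g

theorem IsCutPair.smul {S : Set X} (h : IsCutPair S) (g : G) : IsCutPair (g • S) := by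
  obtain ⟨x, y, hxy, rfl, hS, hx, hy⟩ := h
  refine ⟨g • x, g • y, fun e => hxy (smul_left_cancel g e), smul_pair g x y, ?_, ?_, ?_⟩
  · rw [← smul_pair]; exact hS.smul g
  · exact not_not.2 (isPreconnected_compl_smul_singleton (not_not.1 hx) g)
  · exact not_not.2 (isPreconnected_compl_smul_singleton (not_not.1 hy) g)

theorem Crosses.smul {R S : Set X} (h : Crosses R S) (g : G) : Crosses (g • R) (g • S) := by
  obtain ⟨x, y, rfl, hx, hy, hne⟩ := h
  refine ⟨g • x, g • y, smul_pair g x y, Set.smul_mem_smul_set_iff.not.2 hx,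
    Set.smul_mem_smul_set_iff.not.2 hy, ?_⟩
  rw [← smul_connectedComponentIn g S hx, ← smul_connectedComponentIn g S hy]
  exact fun e => hne (smul_left_cancel g e)

theorem IsUncrossedCutPair.smul {S : Set X} (h : IsUncrossedCutPair S) (g : G) :
    IsUncrossedCutPair (g • S) := by
  refine ⟨h.1.smul g, fun R hR hc => h.2 (g⁻¹ • R) (hR.smul _) ?_⟩
  simpa only [inv_smul_smul] using hc.smul g⁻¹

end Action

variable {n : ℕ} {W : List (FreeGroup (Fin n))}

variable (W) in
/-- The pairs of boundary points joined by a geodesic through the identity that differs within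
radius `m` of the identity from all lines of the pattern. -/
def offPattern (m : ℕ) : Set (Boundary n × Boundary n) :=
  {p | p.1.1 0 ≠ p.2.1 0 ∧ ∀ r : Boundary n × Boundary n, proj W r.1 = proj W r.2 →
    r.1.1 0 ≠ r.2.1 0 → ¬ ((∀ j < m, r.1.1 j = p.1.1 j) ∧ ∀ j < m, r.2.1 j = p.2.1 j)}

theorem proj_ne_of_mem_offPattern {m : ℕ} {p : Boundary n × Boundary n}
    (hp : p ∈ offPattern W m) : proj W p.1 ≠ proj W p.2 := fun h =>
  hp.2 p h hp.1 ⟨fun _ _ => rfl, fun _ _ => rfl⟩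

theorem isClosed_offPattern (m : ℕ) : IsClosed (offPattern W m) := by
  set L := {p : Boundary n × Boundary n | proj W p.1 = proj W p.2 ∧ p.1.1 0 ≠ p.2.1 0}
  have h1 : IsClosed {p : Boundary n × Boundary n | p.1.1 0 ≠ p.2.1 0} := by
    have hc : Continuous fun p : Boundary n × Boundary n => (p.1.1 0, p.2.1 0) :=
      ((Boundary.continuous_coord 0).comp continuous_fst).prodMk
        ((Boundary.continuous_coord 0).comp continuous_snd)
    exact (isClosed_discrete {q : (Fin n × Bool) × (Fin n × Bool) | q.1 ≠ q.2}).preimage hc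
  have h2 : IsOpen (⋃ r ∈ L, cyl r.1 m ×ˢ cyl r.2 m) :=
    isOpen_biUnion fun r _ => (isClopen_cyl _ _).2.prod (isClopen_cyl _ _).2
  have : offPattern W m =
      {p : Boundary n × Boundary n | p.1.1 0 ≠ p.2.1 0} ∩ (⋃ r ∈ L, cyl r.1 m ×ˢ cyl r.2 m)ᶜ := by
    ext p
    constructor
    · rintro ⟨hp, h⟩
      refine ⟨hp, fun h' => ?_⟩
      obtain ⟨r, hr, h1, h2⟩ := Set.mem_iUnion₂.1 h'
      exact h r hr.1 hr.2 ⟨fun j hj => (h1 j hj).symm, fun j hj => (h2 j hj).symm⟩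
    · rintro ⟨hp, h⟩
      refine ⟨hp, fun r hr hr' h' => h (Set.mem_iUnion₂.2 ⟨r, ⟨hr, hr'⟩,
        fun j hj => (h'.1 j hj).symm, fun j hj => (h'.2 j hj).symm⟩)⟩
  rw [this]
  exact h1.inter h2.isClosed_compl

theorem exists_separating_depth {T : Set (Boundary n)} (hT : T.Finite) :
    ∃ m, 0 < m ∧ ∀ y ∈ T, ∀ z ∈ T, (∀ j < m, y.1 j = z.1 j) → y = z := by
  have h : ∀ p : Boundary n × Boundary n, ∃ m, p.1 ≠ p.2 → p.1.1 m ≠ p.2.1 m := by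
    intro p
    by_cases hp : p.1 = p.2
    · exact ⟨0, fun h => absurd hp h⟩
    · obtain ⟨m, hm, -⟩ := exists_first_ne hp
      exact ⟨m, fun _ => hm⟩
  choose m hm using h
  obtain ⟨M, hM⟩ := ((hT.prod hT).image m).bddAbove
  refine ⟨M + 1, by omega, fun y hy z hz h => ?_⟩
  by_contra hne
  exact hm (y, z) hne (h _ (Nat.lt_succ_of_le (hM ⟨(y, z), ⟨hy, hz⟩, rfl⟩)))

/-- A geodesic one of whose ends is not an end of a line of the pattern leaves the pattern at
infinitely many vertices near that end. -/
theorem exists_forall_exists_mem_offPattern (hW : ∀ w ∈ W, w ≠ 1) :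
    ∃ m, ∀ ξ η : Boundary n, (∀ ζ, proj W ζ = proj W ξ → ζ = ξ) → η ≠ ξ →
      ∀ K, ∃ k ≥ K, ((pre ξ k)⁻¹ • ξ, (pre ξ k)⁻¹ • η) ∈ offPattern W m := by
  -- Finitely many lines pass through the identity; depth `m` distinguishes all their second ends.
  obtain ⟨m, hm, hsep⟩ := exists_separating_depth ((finite_proj_eq hW).image Prod.snd)
  refine ⟨m, fun ξ η hξ hne K => ?_⟩
  by_contra! hc
  obtain ⟨i, hi, hlt⟩ := exists_first_ne hne
  set u : ℕ → Boundary n := fun k => (pre ξ k)⁻¹ • η with hu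
  have hξ0 : ∀ k j, ((pre ξ k)⁻¹ • ξ).1 j = ξ.1 (k + j) := fun k => pre_inv_smul ξ k
  have hustep : ∀ k, u (k + 1) = Boundary.letterMul (invLetter (ξ.1 k)) (u k) := by
    intro k
    rw [← letter_smul, ← letter_inv, hu]
    simp only [pre_succ, mul_inv_rev, mul_smul]
  have hu0 : ∀ k, i ≤ k → (u k).1 0 ≠ ξ.1 k := by
    intro k hk
    induction k, hk using Nat.le_induction with
    | base =>
      have : (u i).1 0 = η.1 i := by
        simp only [hu]
        rw [← pre_congr hlt, pre_inv_smul]; rfl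
      rwa [this]
    | succ k hk ih =>
      rw [hustep, Boundary.letterMul_zero (by rwa [invLetter_invLetter])]
      exact fun e => ξ.2 k e.symm
  have hex : ∀ k, max K i ≤ k → ∃ r : Boundary n × Boundary n, proj W r.1 = proj W r.2 ∧
      r.1.1 0 ≠ r.2.1 0 ∧ (∀ j < m, r.1.1 j = ξ.1 (k + j)) ∧ ∀ j < m, r.2.1 j = (u k).1 j := by
    intro k hk
    have := hc k (le_trans (le_max_left _ _) hk)
    by_contra! hno
    refine this ⟨?_, fun r h1 h2 h3 => ?_⟩
    · change ((pre ξ k)⁻¹ • ξ).1 0 ≠ (u k).1 0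
      rw [hξ0]
      exact (hu0 k (le_trans (le_max_right _ _) hk)).symm
    · obtain ⟨j, hj, hj'⟩ := hno r h1 h2 (fun j hj => (h3.1 j hj).trans (hξ0 k j))
      exact hj' (h3.2 j hj)
  have : Nonempty (Boundary n × Boundary n) := ⟨(ξ, η)⟩
  choose! r hr1 hr2 hr3 hr4 using hex
  -- If the geodesic follows a line `r k` at every late vertex, consecutive lines are the same line:
  -- `r k` moved by one letter still passes through the identity, its second end agrees with that of
  -- `r (k + 1)` to depth `m`, and a fibre has at most two points.
  have hstep : ∀ k, max K i ≤ k → (r (k + 1)).1 = (r k).1.tail := by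
    intro k hk
    have hk' : max K i ≤ k + 1 := by omega
    have h0 : (r k).1.1 0 = ξ.1 k := hr3 k hk 0 hm
    have e1 : (letter (ξ.1 k))⁻¹ • (r k).1 = (r k).1.tail := by
      rw [letter_inv, letter_smul, Boundary.letterMul_of_eq (by rw [invLetter_invLetter, h0])]
    have hne0 : (r k).2.1 0 ≠ invLetter (invLetter (ξ.1 k)) := by
      rw [invLetter_invLetter, ← h0]; exact (hr2 k hk).symm
    have e2 : (letter (ξ.1 k))⁻¹ • (r k).2 =
        Boundary.letterMul (invLetter (ξ.1 k)) (r k).2 := by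
      rw [letter_inv, letter_smul]
    have h2 : (Boundary.letterMul (invLetter (ξ.1 k)) (r k).2).1 0 = invLetter (ξ.1 k) :=
      Boundary.letterMul_zero hne0
    have hproj : proj W (r k).1.tail =
        proj W (Boundary.letterMul (invLetter (ξ.1 k)) (r k).2) := by
      rw [← e1, ← e2, proj_smul_eq_iff]; exact hr1 k hk
    have htail : (r k).1.tail.1 0 ≠
        (Boundary.letterMul (invLetter (ξ.1 k)) (r k).2).1 0 := by
      rw [h2, ← h0]; exact (r k).1.2 0
    have hunz : (u k).1 0 ≠ invLetter (invLetter (ξ.1 k)) := by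
      rw [invLetter_invLetter]; exact hu0 k (by omega)
    have hμ : (r (k + 1)).2 = Boundary.letterMul (invLetter (ξ.1 k)) (r k).2 := by
      refine hsep _ ⟨_, ⟨hr1 _ hk', hr2 _ hk'⟩, rfl⟩ _
        ⟨((r k).1.tail, Boundary.letterMul (invLetter (ξ.1 k)) (r k).2), ⟨hproj, htail⟩, rfl⟩ ?_
      intro j hj
      rw [hr4 _ hk' j hj, hustep]
      cases j with
      | zero => rw [h2, Boundary.letterMul_zero hunz]
      | succ j =>
        rw [Boundary.letterMul_succ hunz, Boundary.letterMul_succ hne0]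
        exact (hr4 k hk j (by omega)).symm
    rcases eq_of_proj_eq hW (hr1 _ hk') ((hr1 _ hk').trans ((congrArg (proj W) hμ).trans
      hproj.symm)) with h | h | h
    · exact absurd (by rw [h]) (hr2 _ hk')
    · exact h
    · rw [hμ] at h
      exact absurd (by rw [h]) htail
  set k₀ := max K i with hk₀
  have hall : ∀ j k, k₀ ≤ k → (r k).1.1 j = ξ.1 (k + j) := by
    intro j
    induction j with
    | zero => intro k hk; exact hr3 k hk 0 hm
    | succ j ih =>
      intro k hk
      have := ih (k + 1) (by omega)
      rw [hstep k hk] at this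
      rw [show k + (j + 1) = k + 1 + j by omega, ← this]; rfl
  have e : (pre ξ k₀)⁻¹ • ξ = (r k₀).1 := by
    apply Subtype.ext
    funext j
    rw [hξ0, hall j k₀ le_rfl]
  -- The ray to `ξ` thus ends along a single line, whose other end would be a second preimage of
  -- `proj W ξ`.
  have h3 : pre ξ k₀ • (r k₀).2 = ξ := hξ _ (by
    rw [proj_smul, ← hr1 k₀ le_rfl, ← e, ← proj_smul, smul_inv_smul])
  have h4 : (r k₀).2 = (r k₀).1 := (eq_inv_smul_iff.2 h3).trans e
  exact hr2 k₀ le_rfl (by rw [h4])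

theorem exists_tendsto_ultrafilter {ι X : Type*} [TopologicalSpace X] [CompactSpace X]
    (l : Ultrafilter ι) (u : ι → X) : ∃ x, Tendsto u l (𝓝 x) := by
  obtain ⟨x, -, hx⟩ := isCompact_univ.ultrafilter_le_nhds (l.map u) (by simp)
  exact ⟨x, hx⟩

/-- A point of the decomposition space with only one preimage in the boundary is not a cut
point. -/
theorem isPreconnected_compl_of_fiber (hW : ∀ w ∈ W, w ≠ 1) [ConnectedSpace (DecompSpace W)]
    {ξ : Boundary n} (hξ : ∀ ζ, proj W ζ = proj W ξ → ζ = ξ) :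
    IsPreconnected ({proj W ξ}ᶜ : Set (DecompSpace W)) := by
  have := t2Space_decompSpace hW
  have := locallyConnectedSpace_decompSpace hW
  by_contra hcut
  obtain ⟨A, B, hAB⟩ := IsCutSet.exists_separation hcut isClosed_singleton
  obtain ⟨a, haA⟩ := hAB.nonemptyA
  obtain ⟨b, hbB⟩ := hAB.nonemptyB
  obtain ⟨y, rfl⟩ := proj_surjective a
  obtain ⟨z, rfl⟩ := proj_surjective b
  have hy : y ≠ ξ := fun e => (hAB.cover _).2 (Or.inl haA) (by rw [e]; rfl)
  have hz : z ≠ ξ := fun e => (hAB.cover _).2 (Or.inr hbB) (by rw [e]; rfl)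
  obtain ⟨m, hm⟩ := exists_forall_exists_mem_offPattern (n := n) hW
  -- Zoom in along the vertices where the geodesic from `y` to `ξ` is off the pattern. In the limit
  -- `y` and `z` both go to `α`, while `ξ` goes to a point with a different image. A small connected
  -- neighbourhood of the image of `α`, moved back, joins the images of `y` and `z` without meeting
  -- that of `ξ`.
  set E := {k | ((pre ξ k)⁻¹ • ξ, (pre ξ k)⁻¹ • y) ∈ offPattern W m} with hE
  have hfreq : ∃ᶠ k in atTop, k ∈ E := frequently_atTop.2 fun K => hm ξ y hξ hy K
  have hnb : (atTop ⊓ 𝓟 E).NeBot := frequently_mem_iff_neBot.1 hfreq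
  set l := Ultrafilter.of (atTop ⊓ 𝓟 E) with hl
  have hle : (l : Filter ℕ) ≤ atTop ⊓ 𝓟 E := Ultrafilter.of_le _
  have hlE : ∀ᶠ k in l, k ∈ E := (hle.trans inf_le_right) (mem_principal_self E)
  have hlt : (l : Filter ℕ) ≤ atTop := hle.trans inf_le_left
  have hβ : ConvTo l (fun k => ((pre ξ k)⁻¹)⁻¹) ξ := fun k => by
    simp only [inv_inv]; exact hlt (convTo_pre ξ k)
  obtain ⟨α, hα⟩ := exists_convTo l (u := fun k => (pre ξ k)⁻¹) (fun k => by
    simp only [FreeGroup.norm_inv_eq, norm_pre]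
    exact hlt (eventually_ge_atTop k))
  obtain ⟨ξ', hξ'⟩ := exists_tendsto_ultrafilter l (fun k => (pre ξ k)⁻¹ • ξ)
  have hty := hα.tendsto_smul hβ hy
  have htz := hα.tendsto_smul hβ hz
  have hmem : (ξ', α) ∈ offPattern W m :=
    (isClosed_offPattern m).mem_of_tendsto (hξ'.prodMk_nhds hty) hlE
  obtain ⟨U, V, hU, hV, hξU, hαV, hUV⟩ := t2_separation (proj_ne_of_mem_offPattern hmem)
  obtain ⟨N, hN, hNc, hNV⟩ := locallyConnectedSpace_iff_connected_subsets.1 this _ V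
    (hV.mem_nhds hαV)
  have h1 := ((continuous_proj (W := W)).tendsto _).comp hξ'
  have h2 := ((continuous_proj (W := W)).tendsto _).comp hty
  have h3 := ((continuous_proj (W := W)).tendsto _).comp htz
  obtain ⟨k, hk1, hk2, hk3⟩ := ((h1.eventually_mem (hU.mem_nhds hξU)).and
    ((h2.eventually_mem hN).and (h3.eventually_mem hN))).exists
  have hk1 : (pre ξ k)⁻¹ • proj W ξ ∈ U := hk1
  have hk2 : (pre ξ k)⁻¹ • proj W y ∈ N := hk2
  have hk3 : (pre ξ k)⁻¹ • proj W z ∈ N := hk3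
  have hsub := hAB.subset_of_mem (isPreconnected_smul hNc (pre ξ k)) (x := proj W y) ?_ ?_ haA
  · exact hAB.disj _ (hsub (Set.mem_smul_set_iff_inv_smul_mem.2 hk3)) hbB
  · rintro t ht rfl
    rw [Set.mem_smul_set_iff_inv_smul_mem] at ht
    exact Set.disjoint_left.1 hUV hk1 (hNV ht)
  · exact Set.mem_smul_set_iff_inv_smul_mem.2 hk2

end LinePattern

/-! ### Points with two preimages and two-ended complements -/

namespace LinePattern

theorem mem_zpow_smul_iff {G X : Type*} [Group G] [MulAction G X] {h : G} {j : ℤ} {K : Set X}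
    {t : X} : t ∈ h ^ j • K ↔ h ^ (-j) • t ∈ K := by
  rw [Set.mem_smul_set_iff_inv_smul_mem, zpow_neg]

section TwoEnded

variable {G X : Type} [Group G] [TopologicalSpace X] [T1Space X] [MulAction G X]
  [ContinuousConstSMul G X]

/-- If the complement of a point `a` is connected and covered by the translates of a connected set
away from `a` under an infinite cyclic group that fixes `a` and moves the other points towards `a`,
then this complement has two ends, and every cut pair that contains `a` is crossed. -/
theorem exists_crosses_of_zpow {h : G} {a b : X} {K : Set X} (hha : h • a = a)
    (hK : IsPreconnected K) (haK : a ∉ closure K) (hcov : ∀ t, t ≠ a → ∃ j : ℤ, t ∈ h ^ j • K)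
    (hchain : (K ∩ h • K).Nonempty)
    (hesc : ∀ t, t ≠ a → ∀ U ∈ 𝓝 a, ∃ J : ℕ, ∀ j : ℤ, (J : ℤ) ≤ |j| → h ^ j • t ∈ U)
    (hab : a ≠ b) (hS : IsCutPair ({a, b} : Set X)) :
    ∃ R : Set X, IsCutPair R ∧ Crosses R {a, b} := by
  have hja : ∀ j : ℤ, h ^ j • a = a := fun j =>
    zpow_mem (show h ∈ MulAction.stabilizer G a from hha) j
  have haKj : ∀ j : ℤ, a ∉ h ^ j • K := fun j hj => haK (subset_closure (by
    rwa [mem_zpow_smul_iff, hja] at hj))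
  have hb0 : ∀ j : ℤ, h ^ j • b ≠ a := fun j e => hab (smul_left_cancel (h ^ j) ((hja j).trans e.symm))
  have hV : ∀ N : ℕ, ∃ V : Set X, IsOpen V ∧ a ∈ V ∧
      ∀ j : ℤ, |j| < N → ∀ t ∈ h ^ j • K, t ∉ V := by
    intro N
    refine ⟨⋂ j ∈ Finset.Ioo (-(N : ℤ)) N, (fun t => h ^ (-j) • t) ⁻¹' (closure K)ᶜ,
      isOpen_biInter_finset fun j _ =>
        isClosed_closure.isOpen_compl.preimage (continuous_const_smul _), ?_, ?_⟩
    · refine Set.mem_iInter₂.2 fun j _ => ?_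
      change h ^ (-j) • a ∉ closure K
      rwa [hja]
    · intro j hj t ht htV
      exact Set.mem_iInter₂.1 htV j (Finset.mem_Ioo.2 (abs_lt.1 hj))
        (subset_closure (mem_zpow_smul_iff.1 ht))
  obtain ⟨J, hJ⟩ := hesc b hab.symm _ (isClosed_closure.isOpen_compl.mem_nhds haK)
  have hbK : ∀ j : ℤ, (J : ℤ) ≤ |j| → b ∉ h ^ j • K := fun j hj hb =>
    hJ (-j) (by rwa [abs_neg]) (subset_closure (mem_zpow_smul_iff.1 hb))
  have hKS : ∀ j : ℤ, (J : ℤ) ≤ |j| → ∀ t ∈ h ^ j • K, t ∉ ({a, b} : Set X) := by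
    rintro j hj t ht (rfl | rfl)
    exacts [haKj j ht, hbK j hj ht]
  have hmeet : ∀ j : ℤ, (h ^ j • K ∩ h ^ (j + 1) • K).Nonempty := by
    intro j
    obtain ⟨t, ht, ht'⟩ := hchain
    refine ⟨h ^ j • t, Set.smul_mem_smul_set ht, ?_⟩
    rw [zpow_add_one, mul_smul]
    exact Set.smul_mem_smul_set ht'
  -- For `|j| ≥ J` the translates of `K` miss `a` and `b`, and consecutive ones overlap. Hence each
  -- of the two tails lies on one side of any separation.
  have htail : ∀ t : Set ℤ, t.OrdConnected → (∀ j ∈ t, (J : ℤ) ≤ |j|) → ∀ {A B : Set X},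
      Separation {a, b} A B → (∀ j ∈ t, h ^ j • K ⊆ A) ∨ (∀ j ∈ t, h ^ j • K ⊆ B) := by
    intro t ht htJ A B hAB
    have hpre : IsPreconnected (⋃ j ∈ t, h ^ j • K) := IsPreconnected.biUnion_of_chain ht
      (fun j _ => isPreconnected_smul hK _) fun j _ _ => hmeet j
    refine (hAB.subset_or_subset hpre fun x hx => ?_).imp (fun h j hj => ?_) (fun h j hj => ?_)
    · obtain ⟨j, hj, hx⟩ := Set.mem_iUnion₂.1 hx
      exact hKS j (htJ j hj) x hx
    · exact (Set.subset_biUnion_of_mem (u := fun j : ℤ => _ ^ j • K) hj).trans h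
    · exact (Set.subset_biUnion_of_mem (u := fun j : ℤ => _ ^ j • K) hj).trans h
  have habs : ∀ j : ℤ, (J : ℤ) ≤ |j| → (J : ℤ) ≤ j ∨ j ≤ -J := fun j hj => by
    rcases le_abs.1 hj with h | h
    exacts [Or.inl h, Or.inr (by omega)]
  have hpos : ∀ j ∈ Set.Ici (J : ℤ), (J : ℤ) ≤ |j| := fun j hj => le_trans hj (le_abs_self j)
  have hneg : ∀ j ∈ Set.Iic (-(J : ℤ)), (J : ℤ) ≤ |j| := fun j hj => by
    have h1 : j ≤ -J := hj
    exact le_trans (by omega) (neg_le_abs j)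
  -- If both tails lie in `A`, then `B` is covered by finitely many translates of `K` and stays away
  -- from `a`. It is then bounded by `b` alone, which is no cut point.
  have hcontra : ∀ {A B : Set X}, Separation {a, b} A B → (∀ j ∈ Set.Ici (J : ℤ), h ^ j • K ⊆ A) →
      (∀ j ∈ Set.Iic (-(J : ℤ)), h ^ j • K ⊆ A) → False := by
    intro A B hAB hp hn
    obtain ⟨V, hVo, haV, hVK⟩ := hV J
    obtain ⟨t, ht⟩ := hAB.nonemptyB
    have := mem_of_isPreconnected_compl (T := {b}) (U := B) (V := A ∪ V) (v := a) (t := t)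
      (hS.isPreconnected_compl (by simp)) hAB.openB (hAB.openA.union hVo) ?_ ?_ (Or.inr haV) hab ht
    · exact (hAB.cover t).2 (Or.inr ht) (Or.inr this)
    · intro t ht ht'
      have htS := (hAB.cover t).2 (Or.inr ht)
      rcases ht' with h | h
      · exact hAB.disj t h ht
      · obtain ⟨j, hj⟩ := hcov t fun e => htS (Or.inl e)
        by_cases hjJ : |j| < J
        · exact hVK j hjJ t hj h
        rcases habs j (not_lt.1 hjJ) with h' | h'
        exacts [hAB.disj t (hp j h' hj) ht, hAB.disj t (hn j h' hj) ht]
    · intro t ht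
      by_cases hta : t = a
      · exact Or.inr (Or.inr (hta ▸ haV))
      rcases (hAB.cover t).1 (by rintro (e | e); exacts [hta e, ht e]) with h | h
      exacts [Or.inr (Or.inl h), Or.inl h]
  -- If the tails lie on different sides, take `k` so large that `c = h ^ k • b` and `d = h ^ (-k) •
  -- b` lie in opposite tails. The points sent into `A` by `h ^ k` and into `B` by `h ^ (-k)`
  -- include `b` but avoid a neighbourhood of `a`, so `{c, d}` cuts them off; it crosses `{a, b}`.
  have hmain : ∀ {A B : Set X}, Separation {a, b} A B → (∀ j ∈ Set.Ici (J : ℤ), h ^ j • K ⊆ A) →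
      (∀ j ∈ Set.Iic (-(J : ℤ)), h ^ j • K ⊆ B) → ∃ R : Set X, IsCutPair R ∧ Crosses R {a, b} := by
    intro A B hAB hp hn
    obtain ⟨i, hi⟩ := hcov b hab.symm
    have hshift : ∀ k : ℤ, h ^ k • b ∈ h ^ (k + i) • K := fun k => by
      rw [zpow_add, mul_smul]; exact Set.smul_mem_smul_set hi
    obtain ⟨k, hk1, hk2⟩ : ∃ k : ℕ, (J : ℤ) ≤ k + i ∧ -(k : ℤ) + i ≤ -J :=
      ⟨J + i.natAbs, by omega, by omega⟩
    have hkA : h ^ (k : ℤ) • b ∈ A := hp _ hk1 (hshift k)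
    have hkB : h ^ (-k : ℤ) • b ∈ B := hn _ hk2 (hshift (-k))
    set c := h ^ (k : ℤ) • b with hc
    set d := h ^ (-k : ℤ) • b with hd
    have hcd : c ≠ d := fun e => hAB.disj c hkA (e ▸ hkB)
    have hdc : h ^ (k : ℤ) • d = b := by rw [hd, smul_smul, ← zpow_add]; simp
    have hcd' : h ^ (-k : ℤ) • c = b := by rw [hc, smul_smul, ← zpow_add]; simp
    obtain ⟨V, hVo, haV, hVK⟩ := hV (J + k)
    have hbS : ∀ {C : Set X}, (∀ t, t ∈ C → t ∉ ({a, b} : Set X)) → b ∉ C := fun hC hb =>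
      hC b hb (Or.inr rfl)
    have hA : ∀ t, t ∈ A → t ∉ ({a, b} : Set X) := fun t ht => (hAB.cover t).2 (Or.inl ht)
    have hB : ∀ t, t ∈ B → t ∉ ({a, b} : Set X) := fun t ht => (hAB.cover t).2 (Or.inr ht)
    have hopen : ∀ {C : Set X} (j : ℤ), IsOpen C → IsOpen ((fun t => h ^ j • t) ⁻¹' C) :=
      fun j hC => hC.preimage (continuous_const_smul _)
    have hmem : ∀ {t : X} {j l : ℤ}, t ∈ h ^ j • K → h ^ l • t ∈ h ^ (l + j) • K := by
      intro t j l ht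
      rw [zpow_add, mul_smul]; exact Set.smul_mem_smul_set ht
    have hsep : Separation {c, d}
        ((fun t => h ^ (k : ℤ) • t) ⁻¹' A ∩ (fun t => h ^ (-k : ℤ) • t) ⁻¹' B)
        (((fun t => h ^ (k : ℤ) • t) ⁻¹' B ∪ (fun t => h ^ (-k : ℤ) • t) ⁻¹' A ∪ V) ∩ {c, d}ᶜ) := by
      refine ⟨(hopen _ hAB.openA).inter (hopen _ hAB.openB),
        (((hopen _ hAB.openB).union (hopen _ hAB.openA)).union hVo).inter
          (Set.toFinite _).isClosed.isOpen_compl, ⟨b, hkA, hkB⟩, ⟨a, Or.inr haV, ?_⟩, ?_, ?_⟩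
      · rintro (e | e)
        exacts [hb0 _ e.symm, hb0 _ e.symm]
      · rintro t ⟨h1, h2⟩ ⟨(h3 | h3) | h3, -⟩
        · exact hAB.disj _ h1 h3
        · exact hAB.disj _ h3 h2
        · have hta : t ≠ a := by
            rintro rfl
            exact hA _ h1 (Or.inl (hja _))
          obtain ⟨j, hj⟩ := hcov t hta
          by_cases hjJ : |j| < (J + k : ℕ)
          · exact hVK j hjJ t hj h3
          rcases le_abs.1 (not_lt.1 hjJ) with h' | h'
          · push_cast at h'
            have h4 : (J : ℤ) ≤ -(k : ℤ) + j := by omega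
            exact hAB.disj _ (hp _ h4 (hmem hj)) h2
          · push_cast at h'
            have h4 : (k : ℤ) + j ≤ -J := by omega
            exact hAB.disj _ h1 (hn _ h4 (hmem hj))
      · intro t
        constructor
        · intro ht
          by_cases hta : t = a
          · exact Or.inr ⟨Or.inr (hta ▸ haV), ht⟩
          have hinj : ∀ j : ℤ, h ^ j • t ≠ a := fun j e =>
            hta (smul_left_cancel (h ^ j) (e.trans (hja j).symm))
          have h1 : h ^ (k : ℤ) • t ∉ ({a, b} : Set X) := by
            rintro (e | e)
            · exact hinj _ e
            · exact ht (Or.inr (smul_left_cancel _ ((show _ = b from e).trans hdc.symm)))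
          have h2 : h ^ (-k : ℤ) • t ∉ ({a, b} : Set X) := by
            rintro (e | e)
            · exact hinj _ e
            · exact ht (Or.inl (smul_left_cancel _ ((show _ = b from e).trans hcd'.symm)))
          rcases (hAB.cover _).1 h1 with h3 | h3
          swap
          · exact Or.inr ⟨Or.inl (Or.inl h3), ht⟩
          rcases (hAB.cover _).1 h2 with h4 | h4
          · exact Or.inr ⟨Or.inl (Or.inr h4), ht⟩
          · exact Or.inl ⟨h3, h4⟩
        · rintro (⟨h1, h2⟩ | h1)
          · rintro (rfl | rfl)
            · exact hB _ h2 (Or.inr hcd')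
            · exact hA _ h1 (Or.inr hdc)
          · exact h1.2
    refine ⟨{c, d}, ⟨c, d, hcd, rfl, hsep.isCutSet, ?_, ?_⟩, c, d, rfl, hA _ hkA, hB _ hkB,
      hAB.connectedComponentIn_ne hkA hkB⟩
    · exact not_not.2 (isPreconnected_compl_smul_singleton (hS.isPreconnected_compl (by simp)) _)
    · exact not_not.2 (isPreconnected_compl_smul_singleton (hS.isPreconnected_compl (by simp)) _)
  obtain ⟨A, B, hAB⟩ := hS.isCutSet.exists_separation (Set.toFinite _).isClosed
  rcases htail _ Set.ordConnected_Ici hpos hAB with h1 | h1 <;>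
    rcases htail _ Set.ordConnected_Iic hneg hAB with h2 | h2
  · exact (hcontra hAB h1 h2).elim
  · exact hmain hAB h1 h2
  · exact hmain hAB.symm h1 h2
  · exact (hcontra hAB.symm h1 h2).elim

end TwoEnded

variable {n : ℕ} {W : List (FreeGroup (Fin n))}

/-- A cut pair that contains a point with two preimages in the boundary is crossed. -/
theorem exists_crosses_of_fiber (hW : ∀ w ∈ W, w ≠ 1) [ConnectedSpace (DecompSpace W)]
    {ξ η : Boundary n} (hξη : proj W ξ = proj W η) (hne : ξ ≠ η) {b : DecompSpace W}
    (hab : proj W ξ ≠ b) (hS : IsCutPair ({proj W ξ, b} : Set (DecompSpace W))) :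
    ∃ R : Set (DecompSpace W), IsCutPair R ∧ Crosses R {proj W ξ, b} := by
  have := t2Space_decompSpace hW
  have := locallyConnectedSpace_decompSpace hW
  obtain ⟨h, hh, h1, h2, hhξ, hhη⟩ := exists_axis hW hξη hne
  have h2' : ConvTo atTop (fun i : ℕ => ((h ^ i)⁻¹)⁻¹) ξ := by simpa only [inv_inv] using h1
  obtain ⟨m, hm⟩ := exists_cyl_subset (isOpen_compl_singleton.mem_nhds hne)
  have hηm : η ∉ cyl ξ m := fun h => hm h rfl
  have hjξ : ∀ j : ℤ, h ^ j • ξ = ξ := fun j =>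
    zpow_mem (show h ∈ MulAction.stabilizer _ ξ from hhξ) j
  have hjη : ∀ j : ℤ, h ^ j • η = η := fun j =>
    zpow_mem (show h ∈ MulAction.stabilizer _ η from hhη) j
  have hfib : ∀ y, proj W y ≠ proj W ξ → y ≠ ξ ∧ y ≠ η := fun y hy =>
    ⟨fun e => hy (by rw [e]), fun e => hy (by rw [e, hξη])⟩
  -- A compact set meeting every orbit of `h` other than its two fixed points: the orbit of `y` runs
  -- from `η` to `ξ` and enters `cyl ξ m` at some step.
  set D : Set (Boundary n) := (cyl ξ m)ᶜ ∩ (fun y => h • y) ⁻¹' cyl ξ m with hD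
  have hDcl : IsClosed D := (isClopen_cyl ξ m).compl.1.inter
    ((isClopen_cyl ξ m).1.preimage (continuous_const_smul h))
  have hDmem : ∀ y, y ≠ ξ → y ≠ η → ∃ j : ℤ, h ^ j • y ∈ D := by
    intro y hy hy'
    obtain ⟨M, hM⟩ := eventually_atTop.1
      ((h1.tendsto_smul h2 hy').eventually_mem (cyl_mem_nhds ξ m))
    obtain ⟨N, hN⟩ := ((h2.tendsto_smul h2' hy).eventually_mem
      ((isClopen_cyl ξ m).compl.2.mem_nhds hηm)).exists
    obtain ⟨i, hi, hi'⟩ := exists_int_switch (p := fun j => h ^ j • y ∈ cyl ξ m) (M := M) (N := N)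
      (by simpa using hN) (fun k hk => by simpa using hM k hk)
    refine ⟨i, hi, ?_⟩
    change h • h ^ i • y ∈ cyl ξ m
    rwa [smul_smul, ← zpow_one_add, add_comm]
  have hL : IsCompact (proj W '' D) := hDcl.isCompact.image continuous_proj
  have haL : proj W ξ ∉ proj W '' D := by
    rintro ⟨y, hy, e⟩
    rcases eq_of_proj_eq hW hξη e.symm with h' | h' | h'
    · exact hne h'
    · exact hy.1 (h' ▸ mem_cyl_self ξ m)
    · apply hηm
      have : h • y ∈ cyl ξ m := hy.2
      rwa [← h', hhη] at this
  have hha : h • proj W ξ = proj W ξ := by rw [← proj_smul, hhξ]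
  have haL' : proj W ξ ∉ h • (proj W '' D) := by
    intro h'
    rw [← hha, Set.smul_mem_smul_set_iff] at h'
    exact haL h'
  -- Including the translate by `h` makes `K` and `h • K` overlap.
  obtain ⟨K, hK, hLK, haK⟩ := exists_preconnected_superset (hS.isPreconnected_compl (by simp))
    (hL.union (hL.smul h)) (fun h' => h'.elim haL haL')
  refine exists_crosses_of_zpow hha hK haK ?_ ?_ ?_ hab hS
  · intro t ht
    obtain ⟨y, rfl⟩ := proj_surjective t
    obtain ⟨j, hj⟩ := hDmem y (hfib y ht).1 (hfib y ht).2
    refine ⟨-j, mem_zpow_smul_iff.2 (hLK (Or.inl ⟨_, hj, ?_⟩))⟩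
    rw [neg_neg]; rfl
  · obtain ⟨y, rfl⟩ := proj_surjective b
    obtain ⟨j, hj⟩ := hDmem y (hfib y hab.symm).1 (hfib y hab.symm).2
    exact ⟨h • proj W (h ^ j • y), hLK (Or.inr (Set.smul_mem_smul_set ⟨_, hj, rfl⟩)),
      Set.smul_mem_smul_set (hLK (Or.inl ⟨_, hj, rfl⟩))⟩
  · intro t ht U hU
    obtain ⟨y, rfl⟩ := proj_surjective t
    obtain ⟨M, hM⟩ := eventually_atTop.1 (((continuous_proj.tendsto _).comp
      (h1.tendsto_smul h2 (hfib y ht).2)).eventually_mem hU)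
    obtain ⟨N, hN⟩ := eventually_atTop.1 (((continuous_proj.tendsto _).comp
      (h2.tendsto_smul h2' (hfib y ht).1)).eventually_mem (by rw [← hξη]; exact hU))
    refine ⟨M + N, fun j hj => ?_⟩
    obtain ⟨i, rfl | rfl⟩ := j.eq_nat_or_neg
    · simpa [proj_smul] using hM i (by push_cast at hj; simp at hj; omega)
    · simpa [proj_smul] using hN i (by push_cast at hj; simp at hj; omega)

end LinePattern

/-! ### Finitely many orbits, axial sets and finitely many separators -/

namespace LinePattern

variable {n : ℕ} {W : List (FreeGroup (Fin n))}

/-- The pairs off the pattern form a compact set and project to distinct points, so finiteness near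
each of them gives finiteness overall. -/
theorem finite_uncrossed_offPattern (hW : ∀ w ∈ W, w ≠ 1) [ConnectedSpace (DecompSpace W)]
    (m : ℕ) : {S : Set (DecompSpace W) | IsUncrossedCutPair S ∧
      ∃ p ∈ offPattern W m, S = {proj W p.1, proj W p.2}}.Finite := by
  have := t2Space_decompSpace hW
  have := locallyConnectedSpace_decompSpace hW
  have h1 : ∀ p ∈ offPattern W m, ∃ N ∈ 𝓝 p, {S : Set (DecompSpace W) | IsUncrossedCutPair S ∧
      ∃ r ∈ N, S = {proj W r.1, proj W r.2}}.Finite := by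
    intro p hp
    obtain ⟨P, hP, Q, hQ, hfin⟩ := exists_nhds_finite_uncrossed (proj_ne_of_mem_offPattern hp)
    refine ⟨(proj W ⁻¹' P) ×ˢ (proj W ⁻¹' Q),
      prod_mem_nhds (continuous_proj.continuousAt hP) (continuous_proj.continuousAt hQ),
      hfin.subset ?_⟩
    rintro S ⟨hS, r, hr, e⟩
    exact ⟨hS, _, hr.1, _, hr.2, e⟩
  choose! N hN hfin using h1
  obtain ⟨s, hs, hcov⟩ := (isClosed_offPattern m).isCompact.elim_nhds_subcover N hN
  refine (s.finite_toSet.biUnion fun p hp => hfin p (hs p hp)).subset ?_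
  rintro S ⟨hS, p, hp, e⟩
  obtain ⟨r, hr, hpr⟩ := Set.mem_iUnion₂.1 (hcov hp)
  exact Set.mem_iUnion₂.2 ⟨r, hr, hS, p, hpr, e⟩

theorem IsUncrossedCutPair.exists_fibers (hW : ∀ w ∈ W, w ≠ 1) [ConnectedSpace (DecompSpace W)]
    {S : Set (DecompSpace W)} (hS : IsUncrossedCutPair S) :
    ∃ ξ η, S = {proj W ξ, proj W η} ∧ η ≠ ξ ∧ ∀ ζ, proj W ζ = proj W ξ → ζ = ξ := by
  obtain ⟨x, y, hxy, rfl, -, -, -⟩ := id hS.1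
  obtain ⟨ξ, rfl⟩ := proj_surjective x
  obtain ⟨η, rfl⟩ := proj_surjective y
  refine ⟨ξ, η, rfl, fun e => hxy (by rw [e]), fun ζ hζ => ?_⟩
  by_contra hne
  obtain ⟨R, hR, hc⟩ := exists_crosses_of_fiber hW hζ.symm (Ne.symm hne) hxy hS.1
  exact hS.2 R hR hc

theorem IsCutPoint.exists_fiber (hW : ∀ w ∈ W, w ≠ 1) [ConnectedSpace (DecompSpace W)]
    {S : Set (DecompSpace W)} (hS : IsCutPoint S) :
    ∃ ξ η, S = {proj W ξ} ∧ proj W ξ = proj W η ∧ ξ ≠ η := by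
  obtain ⟨x, rfl, hx⟩ := hS
  obtain ⟨ξ, rfl⟩ := proj_surjective x
  by_contra! hc
  exact hx (isPreconnected_compl_of_fiber hW fun ζ hζ => (hc ξ ζ rfl hζ.symm).symm)

/-- A cut point comes from a line, which can be moved to pass through the identity. For an uncrossed
pair, a vertex at which its geodesic is off the pattern is moved there. -/
theorem exists_finite_representatives (hW : ∀ w ∈ W, w ≠ 1) [ConnectedSpace (DecompSpace W)] :
    ∃ 𝓡 : Set (Set (DecompSpace W)), 𝓡.Finite ∧ ∀ S : Set (DecompSpace W),
      IsCutPoint S ∨ IsUncrossedCutPair S → ∃ g : FreeGroup (Fin n), g • S ∈ 𝓡 := by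
  obtain ⟨m, hm⟩ := exists_forall_exists_mem_offPattern (n := n) hW
  refine ⟨_, ((finite_proj_eq hW).image fun p => {proj W p.1}).union
    (finite_uncrossed_offPattern hW m), ?_⟩
  rintro S (hS | hS)
  · obtain ⟨ξ, η, rfl, h, hne⟩ := hS.exists_fiber hW
    obtain ⟨i, hi, hlt⟩ := exists_first_ne hne
    refine ⟨(pre ξ i)⁻¹, Or.inl ⟨((pre ξ i)⁻¹ • ξ, (pre ξ i)⁻¹ • η),
      ⟨(proj_smul_eq_iff _ _ _).2 h, ?_⟩, by rw [Set.smul_set_singleton]; rfl⟩⟩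
    change ((pre ξ i)⁻¹ • ξ).1 0 ≠ ((pre ξ i)⁻¹ • η).1 0
    rw [pre_inv_smul, pre_congr hlt, pre_inv_smul]
    exact hi
  · obtain ⟨ξ, η, e, hne, hξ⟩ := hS.exists_fibers hW
    obtain ⟨k, -, hk⟩ := hm ξ η hξ hne 0
    refine ⟨(pre ξ k)⁻¹, Or.inr ⟨hS.smul _, _, hk, ?_⟩⟩
    rw [e, smul_pair]; rfl

/-- For a cut point the axis of its line serves. For an uncrossed pair, infinitely many vertices
yield only finitely many translates of `S`; two that agree give a stabilizing element. -/
theorem exists_smul_eq_self (hW : ∀ w ∈ W, w ≠ 1) [ConnectedSpace (DecompSpace W)]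
    {S : Set (DecompSpace W)} (hS : IsCutPoint S ∨ IsUncrossedCutPair S) :
    ∃ r : FreeGroup (Fin n), r ≠ 1 ∧ r • S = S := by
  rcases hS with hS | hS
  · obtain ⟨ξ, η, rfl, h, hne⟩ := hS.exists_fiber hW
    obtain ⟨a, ha, -, -, haξ, -⟩ := exists_axis hW h hne
    exact ⟨a, ha, by rw [Set.smul_set_singleton, ← proj_smul, haξ]⟩
  · obtain ⟨m, hm⟩ := exists_forall_exists_mem_offPattern (n := n) hW
    obtain ⟨ξ, η, e, hne, hξ⟩ := hS.exists_fibers hW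
    have hinf : {k | ((pre ξ k)⁻¹ • ξ, (pre ξ k)⁻¹ • η) ∈ offPattern W m}.Infinite :=
      Nat.frequently_atTop_iff_infinite.1 (frequently_atTop.2 fun K => hm ξ η hξ hne K)
    have hmaps : Set.MapsTo (fun k => (pre ξ k)⁻¹ • S)
        {k | ((pre ξ k)⁻¹ • ξ, (pre ξ k)⁻¹ • η) ∈ offPattern W m}
        {S : Set (DecompSpace W) | IsUncrossedCutPair S ∧
          ∃ p ∈ offPattern W m, S = {proj W p.1, proj W p.2}} := fun k hk =>
      ⟨hS.smul _, _, hk, by simp only [e, smul_pair]; rfl⟩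
    obtain ⟨k, -, l, -, hkl, h⟩ := hinf.exists_ne_map_eq_of_mapsTo hmaps
      (finite_uncrossed_offPattern hW m)
    refine ⟨pre ξ k * (pre ξ l)⁻¹, fun h' => hkl (pre_injective ξ (mul_inv_eq_one.1 h')), ?_⟩
    have h : (pre ξ k)⁻¹ • S = (pre ξ l)⁻¹ • S := h
    rw [mul_smul, ← h, smul_inv_smul]

/-- The subset `S` has at least two preimages in the boundary, and a nontrivial element of the
group fixes all of them. -/
def IsAxial (S : Set (DecompSpace W)) : Prop :=
  (∃ r : FreeGroup (Fin n), r ≠ 1 ∧ ∀ y, proj W y ∈ S → r • y = y) ∧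
    ∃ y z, y ≠ z ∧ proj W y ∈ S ∧ proj W z ∈ S

theorem isAxial_of_smul_eq (hW : ∀ w ∈ W, w ≠ 1) [ConnectedSpace (DecompSpace W)]
    {S : Set (DecompSpace W)} (hS : IsCutPoint S ∨ IsCutPair S) {r : FreeGroup (Fin n)}
    (hr : r ≠ 1) (hrS : r • S = S) : IsAxial S := by
  have hfin : S.Finite := by
    rcases hS with ⟨x, rfl, -⟩ | ⟨x, y, -, rfl, -⟩ <;> exact Set.toFinite _
  refine ⟨?_, ?_⟩
  · have hT : (proj W ⁻¹' S).Finite := by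
      rw [← Set.biUnion_preimage_singleton]
      exact hfin.biUnion fun x _ => finite_fiber hW x
    have hmaps : ∀ k : ℕ, ∀ y ∈ proj W ⁻¹' S, r ^ k • y ∈ proj W ⁻¹' S := by
      intro k y hy
      have hk : r ^ k • S = S := pow_mem (show r ∈ MulAction.stabilizer _ S from hrS) k
      change r ^ k • proj W y ∈ S
      rw [← hk]
      exact Set.smul_mem_smul_set hy
    have := hT.to_subtype
    -- The powers of `r` act on the finite preimage of `S`, so two of them act alike. Their quotient
    -- is nontrivial because free groups are torsion-free.
    obtain ⟨k, l, hkl, h⟩ := Finite.exists_ne_map_eq_of_infinite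
      fun (k : ℕ) (y : proj W ⁻¹' S) => (⟨r ^ k • y.1, hmaps k y.1 y.2⟩ : proj W ⁻¹' S)
    have h' : ∀ y, proj W y ∈ S → r ^ k • y = r ^ l • y := fun y hy =>
      congrArg Subtype.val (congrFun h ⟨y, hy⟩)
    refine ⟨r ^ (-(l : ℤ) + k), fun h1 => ?_, fun y hy => ?_⟩
    · rw [IsMulTorsionFree.zpow_eq_one_iff_right hr] at h1
      omega
    · rw [zpow_add, mul_smul, zpow_natCast, h' y hy, zpow_neg, zpow_natCast, inv_smul_smul]
  · rcases hS with hS | ⟨x, y, hxy, rfl, -⟩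
    · obtain ⟨ξ, η, rfl, h, hne⟩ := hS.exists_fiber hW
      exact ⟨ξ, η, hne, rfl, h.symm⟩
    · obtain ⟨ξ, rfl⟩ := proj_surjective x
      obtain ⟨η, rfl⟩ := proj_surjective y
      exact ⟨ξ, η, fun e => hxy (by rw [e]), Or.inl rfl, Or.inr rfl⟩

theorem isAxial_of_isCutPoint_or (hW : ∀ w ∈ W, w ≠ 1) [ConnectedSpace (DecompSpace W)]
    {S : Set (DecompSpace W)} (hS : IsCutPoint S ∨ IsUncrossedCutPair S) : IsAxial S := by
  obtain ⟨r, hr, hrS⟩ := exists_smul_eq_self hW hS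
  exact isAxial_of_smul_eq hW (hS.imp_right fun h => h.1) hr hrS

/-- Axial sets are equal or disjoint. -/
theorem IsAxial.eq_of_mem {S S' : Set (DecompSpace W)} (hS : IsAxial S) (hS' : IsAxial S')
    {x : DecompSpace W} (hx : x ∈ S) (hx' : x ∈ S') : S = S' := by
  obtain ⟨⟨r, hr, hrS⟩, y, z, hyz, hy, hz⟩ := hS
  obtain ⟨⟨r', hr', hrS'⟩, y', z', hyz', hy', hz'⟩ := hS'
  obtain ⟨ξ, rfl⟩ := proj_surjective x
  -- The element `c` fixes the preimages of both sets, each of which already has two points; so both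
  -- preimages are the full fixed point set of `c`.
  obtain ⟨c, hc, hcc⟩ := exists_common_power hr hr' (hrS ξ hx) (hrS' ξ hx')
  apply Set.Subset.antisymm
  · intro t ht
    obtain ⟨u, rfl⟩ := proj_surjective t
    rcases eq_or_eq_or_eq_of_smul_eq hc ((hcc u).1 (hrS u ht)) ((hcc y').2 (hrS' y' hy'))
      ((hcc z').2 (hrS' z' hz')) with h | h | h
    exacts [h ▸ hy', h ▸ hz', absurd h hyz']
  · intro t ht
    obtain ⟨u, rfl⟩ := proj_surjective t
    rcases eq_or_eq_or_eq_of_smul_eq hc ((hcc u).2 (hrS' u ht)) ((hcc y).1 (hrS y hy))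
      ((hcc z).1 (hrS z hz)) with h | h | h
    exacts [h ▸ hy, h ▸ hz, absurd h hyz]

theorem IsAxial.exists_stabilizing {S : Set (DecompSpace W)} (hS : IsAxial S) :
    ∃ r : FreeGroup (Fin n), r ≠ 1 ∧ r • S = S ∧ ∀ y, proj W y ∈ S → r • y = y := by
  obtain ⟨⟨r, hr, h⟩, -⟩ := hS
  refine ⟨r, hr, ?_, h⟩
  have : ∀ t ∈ S, r • t = t := by
    intro t ht
    obtain ⟨y, rfl⟩ := proj_surjective t
    rw [← proj_smul, h y ht]
  ext t
  constructor
  · rintro ⟨s, hs, rfl⟩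
    change r • s ∈ S
    rwa [this s hs]
  · intro ht
    exact ⟨t, ht, this t ht⟩

/-- Only finitely many members of an uncrossed collection separate two given sets. -/
theorem UncrossedCollection.finite_separates (hW : ∀ w ∈ W, w ≠ 1)
    [ConnectedSpace (DecompSpace W)] (C : UncrossedCollection W) {S S' : Set (DecompSpace W)}
    (hS : ∃ y z, y ≠ z ∧ proj W y ∈ S ∧ proj W z ∈ S)
    (hS' : ∃ y z, y ≠ z ∧ proj W y ∈ S' ∧ proj W z ∈ S') :
    {P ∈ C.sets | Separates P S S'}.Finite := by
  have := t2Space_decompSpace hW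
  have := locallyConnectedSpace_decompSpace hW
  obtain ⟨𝓡, h𝓡, hrep⟩ := exists_finite_representatives (n := n) hW
  suffices h : ∀ R ∈ 𝓡, {P ∈ C.sets | Separates P S S' ∧
      ∃ g : FreeGroup (Fin n), g • P = R}.Finite by
    refine (h𝓡.biUnion h).subset ?_
    rintro P ⟨hP, hsep⟩
    obtain ⟨g, hg⟩ := hrep P (C.isCutPoint_or_isUncrossedCutPair P hP)
    exact Set.mem_iUnion₂.2 ⟨_, hg, hP, hsep, g, rfl⟩
  rintro R -
  by_contra hinf
  set 𝒬 := {P ∈ C.sets | Separates P S S' ∧ ∃ g : FreeGroup (Fin n), g • P = R}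
  have : Infinite 𝒬 := Set.infinite_coe_iff.2 hinf
  -- Shortest elements carrying the separators to `R`. They are distinct, so their norms tend to
  -- infinity.
  have hmin : ∀ P : 𝒬, ∃ g : FreeGroup (Fin n), g • P.1 = R ∧
      ∀ g' : FreeGroup (Fin n), g' • P.1 = R → g.norm ≤ g'.norm := by
    intro P
    obtain ⟨g, hg, hg'⟩ := WellFounded.has_min (measure FreeGroup.norm).wf
      {g : FreeGroup (Fin n) | g • P.1 = R} P.2.2.2
    exact ⟨g, hg, fun g' h => not_lt.1 (hg' g' h)⟩
  choose g hgR hgmin using hmin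
  have hginj : Function.Injective g := by
    intro P P' e
    apply Subtype.ext
    apply smul_left_cancel (g P)
    rw [hgR, e, hgR]
  set l : Ultrafilter 𝒬 := hyperfilter 𝒬
  have hnorm : ∀ k, ∀ᶠ P in l, k ≤ (g P).norm := by
    intro k
    refine hyperfilter_le_cofinite ?_
    have hfin : {P | (g P).norm ≤ k}.Finite := (finite_norm_le k).preimage hginj.injOn
    filter_upwards [hfin.compl_mem_cofinite] with P hP
    exact le_of_lt (not_le.1 hP)
  obtain ⟨α, hα⟩ := exists_convTo l hnorm
  obtain ⟨β, hβ⟩ := exists_convTo l (u := fun P => (g P)⁻¹)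
    (fun k => by simpa only [FreeGroup.norm_inv_eq] using hnorm k)
  have hRC : R ∈ C.sets := by
    obtain ⟨P⟩ : Nonempty 𝒬 := inferInstance
    rw [← hgR P]
    exact C.smul_mem _ _ P.2.1
  -- Otherwise an element stabilizing `R` and fixing `α` would shorten some `g P`.
  have hαR : proj W α ∉ R := by
    intro hmem
    obtain ⟨r, hr, hrR, hfix⟩ := (isAxial_of_isCutPoint_or hW
      (C.isCutPoint_or_isUncrossedCutPair R hRC)).exists_stabilizing
    obtain ⟨k, hk⟩ := exists_startsWith_imp_shorter hr (hfix α hmem)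
    obtain ⟨P, hP⟩ := (hα k).exists
    rcases hk (g P) hP with h | h
    · exact absurd (hgmin P (r * g P) (by rw [mul_smul, hgR, hrR])) (not_le.2 h)
    · refine absurd (hgmin P (r⁻¹ * g P) ?_) (not_le.2 h)
      rw [mul_smul, hgR, inv_smul_eq_iff, hrR]
  have hRcl : IsClosed R := by
    rcases C.isCutPoint_or_isUncrossedCutPair R hRC with ⟨x, rfl, -⟩ | ⟨⟨x, y, -, rfl, -⟩, -⟩ <;>
      exact (Set.toFinite _).isClosed
  have hN : connectedComponentIn Rᶜ (proj W α) ∈ 𝓝 (proj W α) :=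
    hRcl.isOpen_compl.connectedComponentIn.mem_nhds (mem_connectedComponentIn hαR)
  -- Only the repelling point `β` may fail to be attracted to `α`, and `Q` has a preimage other than
  -- `β`.
  have hev : ∀ {Q : Set (DecompSpace W)}, (∃ y z, y ≠ z ∧ proj W y ∈ Q ∧ proj W z ∈ Q) →
      ∃ y, proj W y ∈ Q ∧ ∀ᶠ P in l, g P • proj W y ∈ connectedComponentIn Rᶜ (proj W α) := by
    rintro Q ⟨y, z, hyz, hy, hz⟩
    obtain ⟨u, huβ, hu⟩ : ∃ u, u ≠ β ∧ proj W u ∈ Q := by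
      by_cases h : y = β
      exacts [⟨z, fun e => hyz (h.trans e.symm), hz⟩, ⟨y, h, hy⟩]
    exact ⟨u, hu, (((continuous_proj (W := W)).tendsto _).comp
      (hα.tendsto_smul hβ huβ)).eventually_mem hN⟩
  obtain ⟨y, hy, hyev⟩ := hev hS
  obtain ⟨y', hy', hyev'⟩ := hev hS'
  obtain ⟨P, hP, hP'⟩ := (hyev.and hyev').exists
  have hsep := P.2.2.1.smul ⟨_, hy⟩ ⟨_, hy'⟩ (g P)
  rw [hgR] at hsep
  obtain ⟨s, t, hs, ht, hne⟩ := hsep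
  apply hne
  rw [connectedComponentIn_eq (hs (Set.smul_mem_smul_set hy)),
    connectedComponentIn_eq (ht (Set.smul_mem_smul_set hy')), ← connectedComponentIn_eq hP,
    ← connectedComponentIn_eq hP']

end LinePattern

/-! ### Separation as betweenness, and the star around `S` -/

namespace LinePattern

section Separators

variable {X : Type} [TopologicalSpace X]

/-- The component of the complement of `P` that contains `x`. -/
abbrev side (P : Set X) (x : X) : Set X := connectedComponentIn Pᶜ x

theorem side_eq {P : Set X} {x y : X} (h : y ∈ side P x) : side P x = side P y :=
  connectedComponentIn_eq h

theorem notMem_of_mem_side {P : Set X} {x y : X} (h : y ∈ side P x) : y ∉ P :=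
  connectedComponentIn_subset _ _ h

variable {C : Set (Set X)} {S : Set X}

theorem separates_iff (hsub : ∀ A ∈ insert S C, ∀ P ∈ C, A ≠ P → ∀ a ∈ A, A ⊆ side P a)
    {P A B : Set X} (hP : P ∈ C) (hA : A ∈ insert S C) (hB : B ∈ insert S C) {a b : X}
    (ha : a ∈ A) (hb : b ∈ B) : Separates P A B ↔ A ≠ P ∧ B ≠ P ∧ side P a ≠ side P b := by
  constructor
  · rintro ⟨x, y, hx, hy, hne⟩
    refine ⟨?_, ?_, ?_⟩
    · rintro rfl; exact notMem_of_mem_side (hx ha) ha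
    · rintro rfl; exact notMem_of_mem_side (hy hb) hb
    · rwa [← side_eq (hx ha), ← side_eq (hy hb)]
  · rintro ⟨h1, h2, h3⟩
    exact ⟨a, b, hsub A hA P hP h1 a ha, hsub B hB P hP h2 b hb, h3⟩

theorem exists_mem_closure_side [ConnectedSpace X] [LocallyConnectedSpace X] {P : Set X}
    (hP : IsClosed P) (hne : P.Nonempty) {x : X} (hx : x ∉ P) :
    ∃ s ∈ P, IsPreconnected (insert s (side P x)) := by
  have hpre : IsPreconnected (side P x) := isPreconnected_connectedComponentIn
  have hxU : x ∈ side P x := mem_connectedComponentIn hx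
  by_cases h : ∃ s ∈ P, s ∈ closure (side P x)
  · obtain ⟨s, hs, hs'⟩ := h
    exact ⟨s, hs, hpre.subset_closure (Set.subset_insert _ _)
      (Set.insert_subset hs' subset_closure)⟩
  · push Not at h
    have h1 : closure (side P x) ⊆ side P x := hpre.closure.subset_connectedComponentIn
      (subset_closure hxU) fun t ht ht' => h t ht' ht
    have h2 : IsClopen (side P x) :=
      ⟨isClosed_of_closure_subset h1, hP.isOpen_compl.connectedComponentIn⟩
    obtain ⟨s, hs⟩ := hne
    exact absurd hs (notMem_of_mem_side ((h2.eq_univ ⟨x, hxU⟩).ge (Set.mem_univ s)))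

/-- A side of `A` together with a suitable point of `A` in its closure is connected; if it misses
`P`, it joins `x` to `A` off `P`. -/
theorem side_eq_of_disjoint_side [ConnectedSpace X] [LocallyConnectedSpace X] {A P : Set X}
    (hA : IsClosed A) {a x : X} (ha : a ∈ A) (hAP : A ⊆ side P a) (hx : x ∉ A)
    (hd : ∀ t ∈ side A x, t ∉ P) : side P x = side P a := by
  obtain ⟨s, hs, hpre⟩ := exists_mem_closure_side hA ⟨a, ha⟩ hx
  rw [side_eq (hAP hs)]
  have hsub := hpre.subset_connectedComponentIn (F := Pᶜ) (Set.mem_insert s _) (by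
    rintro t (rfl | ht)
    exacts [notMem_of_mem_side (hAP hs), hd t ht])
  exact (side_eq (hsub (Or.inr (mem_connectedComponentIn hx)))).symm

/-- `P` must lie on the side of `R` that contains `S`, since otherwise that side would join `R` to
`S` off `P`. The side of `R` containing `R₀` then misses `P`, so `R₀` and `R` lie on the same side
of `P`. -/
theorem separates_trans [ConnectedSpace X] [LocallyConnectedSpace X]
    (hcl : ∀ P ∈ C, IsClosed P) (hne : ∀ A ∈ insert S C, A.Nonempty)
    (hsub : ∀ A ∈ insert S C, ∀ P ∈ C, A ≠ P → ∀ a ∈ A, A ⊆ side P a)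
    {P R R₀ : Set X} (hP : P ∈ C) (hR : R ∈ C) (hR₀ : R₀ ∈ C) (h₀ : Separates R R₀ S)
    (h : Separates P R S) : Separates P R₀ S := by
  have hSC : S ∈ insert S C := Set.mem_insert _ _
  obtain ⟨s, hs⟩ := hne S hSC
  obtain ⟨r, hr⟩ := hne R (Or.inr hR)
  obtain ⟨r₀, hr₀⟩ := hne R₀ (Or.inr hR₀)
  obtain ⟨p, hp⟩ := hne P (Or.inr hP)
  rw [separates_iff hsub hR (Or.inr hR₀) hSC hr₀ hs] at h₀
  rw [separates_iff hsub hP (Or.inr hR) hSC hr hs] at h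
  rw [separates_iff hsub hP (Or.inr hR₀) hSC hr₀ hs]
  obtain ⟨h1, h2, h3⟩ := h₀
  obtain ⟨h4, h5, h6⟩ := h
  have hPR : P ⊆ side R p := hsub P (Or.inr hP) R hR h4.symm p hp
  have hRP := hsub R (Or.inr hR) P hP h4 r hr
  have hsR : s ∉ R := notMem_of_mem_side (hsub S hSC R hR h2 s hs hs)
  have hr₀R : r₀ ∉ R := notMem_of_mem_side (hsub R₀ (Or.inr hR₀) R hR h1 r₀ hr₀ hr₀)
  have hps : side R p = side R s := by
    by_contra hne'
    refine h6 (side_eq_of_disjoint_side (hcl R hR) hr hRP hsR fun t ht htP => ?_).symm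
    exact hne' ((side_eq (hPR htP)).trans (side_eq ht).symm)
  refine ⟨?_, h5, ?_⟩
  · rintro rfl
    exact h3 ((side_eq (hPR hr₀)).symm.trans hps)
  · rw [side_eq_of_disjoint_side (hcl R hR) hr hRP hr₀R fun t ht htP => ?_]
    · exact h6
    · exact h3 ((side_eq ht).trans ((side_eq (hPR htP)).symm.trans hps))

/-- Take `R` with the fewest separators from `S`. A separator `P` of `R` would have strictly fewer,
because its separators also separate `R` and `P` is not one of its own. -/
theorem exists_forall_not_separates [ConnectedSpace X] [LocallyConnectedSpace X]
    (hcl : ∀ P ∈ C, IsClosed P) (hne : ∀ A ∈ insert S C, A.Nonempty)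
    (hsub : ∀ A ∈ insert S C, ∀ P ∈ C, A ≠ P → ∀ a ∈ A, A ⊆ side P a)
    (hfin : ∀ R ∈ C, {P ∈ C | Separates P R S}.Finite) (hC : C.Nonempty) :
    ∃ R ∈ C, ∀ P ∈ C, ¬ Separates P R S := by
  obtain ⟨R, hR, hmin⟩ := WellFounded.has_min
    (measure fun R : Set X => {P ∈ C | Separates P R S}.ncard).wf C hC
  refine ⟨R, hR, fun P hP hsep => hmin P hP ?_⟩
  refine Set.ncard_lt_ncard ⟨fun Q hQ => ⟨hQ.1, ?_⟩, fun h => ?_⟩ (hfin R hR)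
  · exact separates_trans hcl hne hsub hQ.1 hP hR hsep hQ.2
  · obtain ⟨s, hs⟩ := hne S (Set.mem_insert _ _)
    obtain ⟨p, hp⟩ := hne P (Or.inr hP)
    have := (h ⟨hP, hsep⟩ : P ∈ {Q ∈ C | Separates Q P S}).2
    exact ((separates_iff hsub hP (Or.inr hP) (Set.mem_insert _ _) hp hs).1 this).1 rfl

/-- A member not separated from `S` lies on the same side as `S` of every other member. Being
separated from `R` is therefore the same as being separated from `S`, apart from separation by `R`
itself, which the choice of the component at `x` controls. The right-hand side no longer mentions
`R`. -/
theorem minimalStar_eq (hne : ∀ A ∈ insert S C, A.Nonempty)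
    (hsub : ∀ A ∈ insert S C, ∀ P ∈ C, A ≠ P → ∀ a ∈ A, A ⊆ side P a) (hSC : S ∉ C)
    {R : Set X} (hR : R ∈ C) (hsep : ∀ P ∈ C, ¬ Separates P R S) {x : X} (hx : x ∈ S) :
    minimalStar C R x = {Q ∈ C | ∀ P ∈ C, ¬ Separates P Q S} := by
  have hS : S ∈ insert S C := Set.mem_insert _ _
  have hSne : ∀ P ∈ C, S ≠ P := fun P hP e => hSC (e ▸ hP)
  obtain ⟨r, hr⟩ := hne R (Or.inr hR)
  have hside : ∀ {Q : Set X}, Q ∈ C → (∀ P ∈ C, ¬ Separates P Q S) → ∀ q ∈ Q, ∀ P ∈ C, Q ≠ P →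
      side P q = side P x := by
    intro Q hQ h q hq P hP hne'
    by_contra hc
    exact h P hP ((separates_iff hsub hP (Or.inr hQ) hS hq hx).2 ⟨hne', hSne P hP, hc⟩)
  ext Q
  constructor
  · rintro (rfl | ⟨hQ, hQR, hmin⟩)
    · exact ⟨hR, hsep⟩
    refine ⟨hQ, fun P hP h => ?_⟩
    obtain ⟨q, hq⟩ := hne Q (Or.inr hQ)
    obtain ⟨h1, -, h3⟩ := (separates_iff hsub hP (Or.inr hQ) hS hq hx).1 h
    by_cases hPR : R = P
    · subst hPR
      exact h3 (side_eq (hQR hq)).symm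
    · refine hmin P hP ((separates_iff hsub hP (Or.inr hR) (Or.inr hQ) hr hq).2 ⟨hPR, h1, ?_⟩)
      rw [hside hR hsep r hr P hP hPR]
      exact h3.symm
  · rintro ⟨hQ, h⟩
    by_cases hQR : Q = R
    · exact Or.inl hQR
    obtain ⟨q, hq⟩ := hne Q (Or.inr hQ)
    refine Or.inr ⟨hQ, ?_, fun P hP h' => ?_⟩
    · have := hsub Q (Or.inr hQ) R hR hQR q hq
      rwa [hside hQ h q hq R hR hQR] at this
    · obtain ⟨h1, h2, h3⟩ := (separates_iff hsub hP (Or.inr hR) (Or.inr hQ) hr hq).1 h'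
      exact h3 ((hside hR hsep r hr P hP h1).trans (hside hQ h q hq P hP h2).symm)

theorem subset_side [T1Space X] [LocallyConnectedSpace X] {A P : Set X}
    (hA : IsCutPoint A ∨ IsCutPair A) (hP : IsCutPoint P ∨ IsUncrossedCutPair P)
    (hd : ∀ t ∈ A, t ∉ P) {a : X} (ha : a ∈ A) : A ⊆ side P a := by
  intro b hb
  by_contra hab
  have hne : a ≠ b := fun e => hab (e ▸ mem_connectedComponentIn (hd a ha))
  have hA' : IsCutPair A := hA.resolve_left (by
    rintro ⟨c, rfl, -⟩
    exact hne ((show a = c from ha).trans (show b = c from hb).symm))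
  have hcr : Crosses A P := ⟨a, b, hA'.eq_pair ha hb hne, hd a ha, hd b hb, fun e =>
    hab (by rw [side, e]; exact mem_connectedComponentIn (hd b hb))⟩
  rcases hP with ⟨c, rfl, -⟩ | hP
  · exact not_crosses_singleton hA' c hcr
  · exact hP.2 A hA' hcr

end Separators

variable {n : ℕ} {W : List (FreeGroup (Fin n))}

theorem UncrossedCollection.isElliptic_of_smul_eq {C : UncrossedCollection W}
    {H : Subgroup (FreeGroup (Fin n))} (v : C.Vertex) (h : ∀ g ∈ H, g • v = v) :
    C.IsElliptic H := by
  obtain ⟨f, hf⟩ : ∃ f : FreeGroup (Fin n), f • v = Quotient.out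
      (Quotient.mk (MulAction.orbitRel (FreeGroup (Fin n)) C.Vertex) v) :=
    Quotient.exact (s := MulAction.orbitRel (FreeGroup (Fin n)) C.Vertex)
      (Quotient.out_eq (Quotient.mk (MulAction.orbitRel (FreeGroup (Fin n)) C.Vertex) v))
  refine ⟨Quotient.mk _ v, f, fun g hg => ?_⟩
  change (f * g * f⁻¹) • Quotient.out _ = Quotient.out _
  rw [← hf, mul_smul, mul_smul, inv_smul_smul, h g hg]

end LinePattern

/-! ### The stabilizer fixes a vertex -/

theorem mainTheorem11 (n : ℕ) (hn : 2 ≤ n) (W : List (FreeGroup (Fin n)))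
    (hW : ∀ w ∈ W, w ≠ 1) (hconn : ConnectedSpace (LinePattern.DecompSpace W))
    (C : LinePattern.UncrossedCollection W) (S : Set (LinePattern.DecompSpace W))
    (hS : LinePattern.IsCutPoint S ∨ LinePattern.IsCutPair S) :
    C.IsElliptic (MulAction.stabilizer (FreeGroup (Fin n)) S) := by
  open LinePattern in
  have := t2Space_decompSpace hW
  have := locallyConnectedSpace_decompSpace hW
  obtain ⟨S₀, hS₀⟩ := C.nonempty
  by_cases htriv : ∀ g ∈ MulAction.stabilizer (FreeGroup (Fin n)) S, g = 1
  · exact UncrossedCollection.isElliptic_of_smul_eq (.inl ⟨S₀, hS₀⟩) fun g hg => by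
      rw [htriv g hg, one_smul]
  by_cases hSC : S ∈ C.sets
  · exact UncrossedCollection.isElliptic_of_smul_eq (.inl ⟨S, hSC⟩) fun g hg =>
      congrArg Sum.inl (Subtype.ext hg)
  push Not at htriv
  obtain ⟨r, hrS, hr⟩ := htriv
  have hax := isAxial_of_smul_eq hW hS hr hrS
  have hCax : ∀ P ∈ C.sets, IsAxial P := fun P hP =>
    isAxial_of_isCutPoint_or hW (C.isCutPoint_or_isUncrossedCutPair P hP)
  have hne : ∀ A ∈ insert S C.sets, A.Nonempty := by
    rintro A (rfl | hA)
    · obtain ⟨-, y, -, -, hy, -⟩ := hax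
      exact ⟨_, hy⟩
    · exact C.nonempty_of_mem A hA
  have hsub : ∀ A ∈ insert S C.sets, ∀ P ∈ C.sets, A ≠ P → ∀ a ∈ A, A ⊆ side P a := by
    intro A hA P hP hAP a ha
    have hA' : (IsCutPoint A ∨ IsCutPair A) ∧ IsAxial A := by
      rcases hA with rfl | hA
      · exact ⟨hS, hax⟩
      · exact ⟨(C.isCutPoint_or_isUncrossedCutPair A hA).imp_right fun h => h.1, hCax A hA⟩
    exact subset_side hA'.1 (C.isCutPoint_or_isUncrossedCutPair P hP)
      (fun t ht ht' => hAP (hA'.2.eq_of_mem (hCax P hP) ht ht')) ha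
  have hcl : ∀ P ∈ C.sets, IsClosed P := by
    intro P hP
    rcases C.isCutPoint_or_isUncrossedCutPair P hP with ⟨x, rfl, -⟩ | ⟨⟨x, y, -, rfl, -⟩, -⟩ <;>
      exact (Set.toFinite _).isClosed
  obtain ⟨R, hR, hsep⟩ := exists_forall_not_separates hcl hne hsub
    (fun R hR => C.finite_separates hW (hCax R hR).2 hax.2) C.nonempty
  obtain ⟨x, hx⟩ := hne S (Set.mem_insert _ _)
  -- A member sharing a point with `S` would equal `S`, both being axial.
  have hxR : ∀ R ∈ C.sets, x ∉ R := fun R hR hxR =>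
    hSC (hax.eq_of_mem (hCax R hR) hx hxR ▸ hR)
  refine UncrossedCollection.isElliptic_of_smul_eq
    (.inr ⟨minimalStar C.sets R x, R, hR, x, hxR R hR, rfl⟩) fun g hg => ?_
  have hgS : g • S = S := hg
  refine congrArg Sum.inr (Subtype.ext ?_)
  change g • minimalStar C.sets R x = minimalStar C.sets R x
  rw [smul_minimalStar C.nonempty_of_mem C.smul_mem hR (hxR R hR) g,
    minimalStar_eq hne hsub hSC hR hsep hx]
  -- Since `g` preserves `S` and the collection, `g • R` is not separated from `S` either, so its
  -- star towards `S` is the same set.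
  refine minimalStar_eq hne hsub hSC (C.smul_mem g R hR) (fun P hP h => ?_)
    (hgS ▸ Set.smul_mem_smul_set hx)
  have h' := h.smul (C.nonempty_of_mem _ (C.smul_mem g R hR)) ⟨x, hx⟩ g⁻¹
  rw [inv_smul_smul, inv_smul_eq_iff.2 hgS.symm] at h'
  exact hsep _ (C.smul_mem _ P hP) h'
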